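/- Let $L_1,L_2>0$ and let $\mathbb T^2=[0,L_1]\times[0,L_2]$ with periodic boundary conditions and Lebesgue measure; write $\operatorname{avg} g=(L_1L_2)^{-1}\int_{\mathbb T^2}g\,dx$. There is a constant $C=C(L_1,L_2)>0$, depending only on $L_1,L_2$, with the following two properties. (i) For every mean-free $\psi\in H^2(\mathbb T^2)$, the function $N(\psi)=\tfrac12|\nabla\psi|^2-\tfrac12\operatorname{avg}|\nabla\psi|^2+\Delta\psi$ belongs to $L^2(\mathbb T^2)$ and $$\Big|\int_{\mathbb T^2}\psi N(\psi)\,dx\Big|\le \tfrac12\|\Delta\psi\|_{L^2}^2+C\|\psi\|_{L^2}^2+C\|\psi\|_{L^2}^6,\qquad \|N(\psi)\|_{L^2}\le C\|\Delta\psi\|_{L^2}^2+C\|\Delta\psi\|_{L^2}.$$ (ii) For $\mu,B>0$ put $$T_0(B)=\int_{B^2}^{4B^2}\frac{dy}{Cy+Cy^3},\qquad T_1(B)=\frac{1}{4C(2\mu+4C+64CB^4)B+4C(2\mu+4C+64CB^4)^{1/2}}.$$ Let $v\in L^\infty([0,\infty);W^{1,\infty}(\mathbb T^2))$ be a divergence-free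 velocity field, let $\mathcal S_{s,t}$ ($0\le s\le t$) be the solution operator of $\partial_t f+v\cdot\nabla f+\Delta^2 f=0$ on $L^2(\mathbb{T}^2)$, and let $$\tau^*=\inf\{t\ge 0:\ \|\mathcal S_{s,s+t}f\|_{L^2}\le\tfrac12\|f\|_{L^2}\ \text{for all } s\ge0 \text{ and all mean-free } f\in L^2(\mathbb T^2)\}$$ be its dissipation time. Let $\mu>0$, let $\mathcal L=\Delta^2+\Delta$, and let $\psi$ be a mean-free mild solution on $[0,T]$ of $$\partial_t\psi+v\cdot\nabla\psi+\tfrac12|\nabla\psi|^2-\tfrac12\operatorname{avg}|\nabla\psi|^2+\Delta^2\psi+\Delta\psi=0 ,$$ that is, $\psi\in C([0,T];L^2(\mathbb T^2))$ has mean zero, $\sup_{0<t\le T}t^{1/4}\|\nabla\psi(t)\|_{L^2}<\infty$, and $$\psi(t)=e^{-t\mathcal L}\psi(0)-\int_0^t e^{-(t-\tau)\mathcal L}\Big(\tfrac12|\nabla\psi|^2-\tfrac12\operatorname{avg}|\nabla\psi|^2+v\cdot\nabla\psi\Big)(\tau)\,d\tau,\qquad 0\le t\le T,$$ as a Bochner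 integral in $L^2$. Let $0\le t_0\le T$ and suppose that $B=\|\psi(t_0)\|_{L^2}>0$. If $$\tau^*\le\min\Big(T_0(B),\,T_1(B),\,\frac1{4\mu}\Big),$$ then $$\|\psi(t_0+t)\|_{L^2}\le C_0\,e^{-\mu t}\,\|\psi(t_0)\|_{L^2}\qquad\text{for all } t>0 \text{ with } t_0+t\le T,$$ with the absolute constant $C_0=2e^{1/4}$. (In particular, if the solution exists on $[0,\infty)$, the estimate holds for all $t>0$.) -/

import Mathlib

open MeasureTheory Set
open scoped NNReal

noncomputable section

namespace AdvKS

/-- The torus `[0, L₁] × [0, L₂]` with periodic boundary conditions, carrying its Lebesgue measure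
(total mass `L₁ L₂`). -/
abbrev Torus (L₁ L₂ : ℝ) : Type := AddCircle L₁ × AddCircle L₂

/-- Real-valued square-integrable functions on the torus (norm with respect to Lebesgue measure). -/
abbrev L2 (L₁ L₂ : ℝ) [Fact (0 < L₁)] [Fact (0 < L₂)] : Type :=
  Lp ℝ 2 (volume : Measure (Torus L₁ L₂))

section Fourier

variable {L₁ L₂ : ℝ} [Fact (0 < L₁)] [Fact (0 < L₂)]

/-- The average of a function over the torus. -/
def average (f : Torus L₁ L₂ → ℝ) : ℝ := (L₁ * L₂)⁻¹ * ∫ x, f x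

/-- The `k`-th Fourier coefficient `(L₁ L₂)⁻¹ ∫ f(x) exp (-i k̃ · x) dx`. -/
def fourierCoef (f : Torus L₁ L₂ → ℝ) (k : ℤ × ℤ) : ℂ :=
  ((L₁ * L₂ : ℝ) : ℂ)⁻¹ * ∫ x : Torus L₁ L₂, fourier (-k.1) x.1 * fourier (-k.2) x.2 * (f x : ℂ)

/-- The image of `f` under the Fourier multiplier with symbol `m` exists and lies in `L²`. -/
def InDomain (m : ℤ × ℤ → ℂ) (f : Torus L₁ L₂ → ℝ) : Prop :=
  ∃ g : L2 L₁ L₂, ∀ k, fourierCoef g k = m k * fourierCoef f k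

open Classical in
/-- The Fourier multiplier with symbol `m`, as an unbounded operator into `L²`: the (unique)
`L²` function with Fourier coefficients `m(k) f̂(k)`; the value is `0` off the domain. -/
def multiplier (m : ℤ × ℤ → ℂ) (f : Torus L₁ L₂ → ℝ) : L2 L₁ L₂ :=
  if h : InDomain m f then h.choose else 0

variable (L₁ L₂) in
/-- The rescaled frequency `k̃ = 2π (k₁ / L₁, k₂ / L₂)`. -/
def freq (k : ℤ × ℤ) : ℝ × ℝ := (2 * Real.pi * k.1 / L₁, 2 * Real.pi * k.2 / L₂)

variable (L₁ L₂) in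
/-- `|k̃|²`. -/
def freqSq (k : ℤ × ℤ) : ℝ := (freq L₁ L₂ k).1 ^ 2 + (freq L₁ L₂ k).2 ^ 2

variable (L₁ L₂) in
/-- Symbol of `∂₁`. -/
def symD₁ (k : ℤ × ℤ) : ℂ := Complex.I * ((freq L₁ L₂ k).1 : ℂ)

variable (L₁ L₂) in
/-- Symbol of `∂₂`. -/
def symD₂ (k : ℤ × ℤ) : ℂ := Complex.I * ((freq L₁ L₂ k).2 : ℂ)

variable (L₁ L₂) in
/-- Symbol of `Δ`. -/
def symLap (k : ℤ × ℤ) : ℂ := -(freqSq L₁ L₂ k : ℂ)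

variable (L₁ L₂) in
/-- Symbol of `exp (-t (Δ² + Δ))`. -/
def symKS (t : ℝ) (k : ℤ × ℤ) : ℂ :=
  (Real.exp (-t * (freqSq L₁ L₂ k ^ 2 - freqSq L₁ L₂ k)) : ℂ)

variable (L₁ L₂) in
/-- Symbol of `exp (-t Δ²)`. -/
def symHyper (t : ℝ) (k : ℤ × ℤ) : ℂ := (Real.exp (-t * freqSq L₁ L₂ k ^ 2) : ℂ)

/-- Membership in the Sobolev space `H¹`. -/
def MemH1 (f : L2 L₁ L₂) : Prop := InDomain (symD₁ L₁ L₂) f ∧ InDomain (symD₂ L₁ L₂) f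

/-- Membership in the Sobolev space `H²`. -/
def MemH2 (f : L2 L₁ L₂) : Prop := InDomain (symLap L₁ L₂) f

/-- `∂₁ f`. -/
def D₁ (f : L2 L₁ L₂) : L2 L₁ L₂ := multiplier (symD₁ L₁ L₂) f

/-- `∂₂ f`. -/
def D₂ (f : L2 L₁ L₂) : L2 L₁ L₂ := multiplier (symD₂ L₁ L₂) f

/-- `Δ f`. -/
def lap (f : L2 L₁ L₂) : L2 L₁ L₂ := multiplier (symLap L₁ L₂) f

/-- The semigroup `exp (-t (Δ² + Δ))`, applied to an integrable function. -/
def semigroupKS (t : ℝ) (f : Torus L₁ L₂ → ℝ) : L2 L₁ L₂ := multiplier (symKS L₁ L₂ t) f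

/-- The semigroup `exp (-t Δ²)`, applied to an integrable function. -/
def semigroupHyper (t : ℝ) (f : Torus L₁ L₂ → ℝ) : L2 L₁ L₂ := multiplier (symHyper L₁ L₂ t) f

/-- `‖∇ f‖_{L²}`. -/
def gradNorm (f : L2 L₁ L₂) : ℝ := Real.sqrt (‖D₁ f‖ ^ 2 + ‖D₂ f‖ ^ 2)

/-- `|∇ f|²`. -/
def gradSq (f : L2 L₁ L₂) (x : Torus L₁ L₂) : ℝ := D₁ f x ^ 2 + D₂ f x ^ 2

/-- `w · ∇ f`. -/
def advect (w : Torus L₁ L₂ → ℝ × ℝ) (f : L2 L₁ L₂) (x : Torus L₁ L₂) : ℝ :=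
  (w x).1 * D₁ f x + (w x).2 * D₂ f x

/-- `f` has zero mean. -/
def MeanFree (f : L2 L₁ L₂) : Prop := average f = 0

/-- The operator `N(ψ) = ½ |∇ψ|² - ½ avg |∇ψ|² + Δψ`. -/
def opN (ψ : L2 L₁ L₂) (x : Torus L₁ L₂) : ℝ :=
  gradSq ψ x / 2 - average (gradSq ψ) / 2 + lap ψ x

end Fourier

/-- `C` is an admissible constant in the two basic estimates of the operator `N` on mean-free
`H²` functions. -/
def NEstimates (L₁ L₂ : ℝ) [Fact (0 < L₁)] [Fact (0 < L₂)] (C : ℝ) : Prop :=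
  ∀ ψ : L2 L₁ L₂, MeanFree ψ → MemH2 ψ →
    MemLp (opN ψ) 2 volume ∧
    |∫ x, ψ x * opN ψ x| ≤ ‖lap ψ‖ ^ 2 / 2 + C * ‖ψ‖ ^ 2 + C * ‖ψ‖ ^ 6 ∧
    (eLpNorm (opN ψ) 2 volume).toReal ≤ C * ‖lap ψ‖ ^ 2 + C * ‖lap ψ‖

/-- `T₀(B) = ∫_{B²}^{4B²} dy / (C y + C y³)`. -/
def T₀ (C B : ℝ) : ℝ := ∫ y in (B ^ 2)..(4 * B ^ 2), 1 / (C * y + C * y ^ 3)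

/-- `T₁(B) = 1 / (4C (2μ + 4C + 64CB⁴) B + 4C (2μ + 4C + 64CB⁴)^{1/2})`. -/
def T₁ (C μ B : ℝ) : ℝ :=
  1 / (4 * C * (2 * μ + 4 * C + 64 * C * B ^ 4) * B
    + 4 * C * Real.sqrt (2 * μ + 4 * C + 64 * C * B ^ 4))

section Evolution

variable {L₁ L₂ : ℝ} [Fact (0 < L₁)] [Fact (0 < L₂)]

/-- Velocity fields in `L^∞([0,∞); W^{1,∞})`, i.e. bounded and Lipschitz in space, uniformly
in (almost every) time. -/
def UniformlyLipschitz (v : ℝ → Torus L₁ L₂ → ℝ × ℝ) : Prop :=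
  Measurable (Function.uncurry v) ∧
  ∃ K : ℝ≥0, ∀ᵐ t ∂(volume.restrict (Ici (0 : ℝ))), LipschitzWith K (v t) ∧ ∀ x, ‖v t x‖ ≤ K

/-- `div v = 0` in the sense of distributions on the torus at almost every time: every Fourier
coefficient `i k̃ · v̂(k)` of the divergence vanishes. -/
def DivergenceFree (v : ℝ → Torus L₁ L₂ → ℝ × ℝ) : Prop :=
  ∀ᵐ t ∂(volume.restrict (Ici (0 : ℝ))), ∀ k : ℤ × ℤ,
    symD₁ L₁ L₂ k * fourierCoef (fun x => (v t x).1) k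
      + symD₂ L₁ L₂ k * fourierCoef (fun x => (v t x).2) k = 0

/-- `f` is the mild solution on `[s, ∞)` of `∂ₜ f + v · ∇f + Δ² f = 0` with `f(s) = f₀`. -/
structure IsLinearSolution (v : ℝ → Torus L₁ L₂ → ℝ × ℝ) (s : ℝ) (f₀ : L2 L₁ L₂)
    (f : ℝ → L2 L₁ L₂) : Prop where
  continuousOn : ContinuousOn f (Ici s)
  grad_bound : ∀ T > s, ∃ M : ℝ, ∀ t ∈ Ioc s T,
    MemH1 (f t) ∧ (t - s) ^ (1 / 4 : ℝ) * gradNorm (f t) ≤ M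
  integrable : ∀ t ≥ s, IntervalIntegrable
    (fun τ => semigroupHyper (t - τ) (advect (v τ) (f τ))) volume s t
  duhamel : ∀ t ≥ s, f t = semigroupHyper (t - s) f₀
    - ∫ τ in s..t, semigroupHyper (t - τ) (advect (v τ) (f τ))

open Classical in
/-- The solution operator `𝒮_{s,t}` of `∂ₜ f + v · ∇f + Δ² f = 0`. -/
def solutionOp (v : ℝ → Torus L₁ L₂ → ℝ × ℝ) (s t : ℝ) (f₀ : L2 L₁ L₂) : L2 L₁ L₂ :=
  if h : ∃ f, IsLinearSolution v s f₀ f then h.choose t else 0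

/-- The dissipation time of `v`: the infimum of the `t ≥ 0` such that, for all `s ≥ 0`, the
operator norm of `𝒮_{s,s+t}` on mean-free `L²` functions is at most `1/2`. -/
def dissipationTime (v : ℝ → Torus L₁ L₂ → ℝ × ℝ) : ℝ :=
  sInf {t : ℝ | 0 ≤ t ∧ ∀ s ≥ 0, ∀ f : L2 L₁ L₂, MeanFree f →
    ‖solutionOp v s (s + t) f‖ ≤ 1 / 2 * ‖f‖}

/-- The lower-order terms `½ (|∇ψ|² - avg |∇ψ|²) + w · ∇ψ`. -/
def forcing (w : Torus L₁ L₂ → ℝ × ℝ) (ψ : L2 L₁ L₂) (x : Torus L₁ L₂) : ℝ :=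
  (gradSq ψ x - average (gradSq ψ)) / 2 + advect w ψ x

/-- `ψ` is a (mean-free) mild solution on `[0, T]` of
`∂ₜ ψ + v · ∇ψ + ½ |∇ψ|² - ½ avg |∇ψ|² + Δ² ψ + Δ ψ = 0`: it belongs to `C([0,T]; L²)` with
`sup_{0 < t ≤ T} t^{1/4} ‖∇ψ(t)‖_{L²} < ∞`, and Duhamel's formula holds for every time, with a
Bochner integral in `L²`. -/
structure IsMildSolution (v : ℝ → Torus L₁ L₂ → ℝ × ℝ) (T : ℝ) (ψ : ℝ → L2 L₁ L₂) : Prop where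
  continuousOn : ContinuousOn ψ (Icc 0 T)
  meanFree : ∀ t ∈ Icc 0 T, MeanFree (ψ t)
  grad_bound : ∃ M : ℝ, ∀ t ∈ Ioc 0 T, MemH1 (ψ t) ∧ t ^ (1 / 4 : ℝ) * gradNorm (ψ t) ≤ M
  integrable : ∀ t ∈ Icc 0 T, IntervalIntegrable
    (fun τ => semigroupKS (t - τ) (forcing (v τ) (ψ τ))) volume 0 t
  duhamel : ∀ t ∈ Icc 0 T, ψ t = semigroupKS t (ψ 0)
    - ∫ τ in (0 : ℝ)..t, semigroupKS (t - τ) (forcing (v τ) (ψ τ))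

end Evolution

end AdvKS

end

/-!
The torus is treated through Fourier series: the exponentials form a Hilbert basis of complex `L²`
(Stone–Weierstrass), so that real `L²` functions are the square-summable families `c` with
`c (-k) = conj (c k)`, and Sobolev regularity, derivatives and semigroups become statements about
these families.

*Estimates of `N`.* Convolution of Fourier coefficients and Cauchy–Schwarz against the lattice sum
`∑ (R² + |k̃|²)⁻² ≲ R⁻²` bound `‖f²‖` by `R⁻¹ (R² ‖f‖² + ‖∇f‖²)` for every `R ≥ 1` (`sq_mem_L2`).
Applied to the first derivatives of `ψ` with `R = 1` this gives the bound of `‖N(ψ)‖`; with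
`R ~ 1 + ‖ψ‖` it lets the trilinear term `∫ ψ |∇ψ|²` be absorbed into `‖Δψ‖²` at the price of
`‖ψ‖² + ‖ψ‖⁶` (`nEstimates_nConst`).

*From mild solutions to energy identities.* Duhamel's formula is, in each Fourier mode, a scalar
linear equation in integrated form (`hasModes_of_duhamel`). For positive times the forcing has
bounded Fourier coefficients, and `∑ |k̃|⁻⁴ < ∞` then yields `H²` regularity at almost every time
(`HasModes.summable_H2`). Summing the energy balances of the modes gives the energy identity
(`HasModes.energy`), in which divergence-free transport does not contribute
(`BddVel.inner_advectL`).

*The linear evolution.* Mild solutions of the linear equation exist by Picard iteration on the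
transport term `v · ∇f`, in spaces of functions of time that are square-integrable with values in
`L²` (`exists_picard_fixed`). The energy identity and Poincaré's inequality make them decay at a
rate that depends on the torus only, so that the dissipation time is an infimum over a nonempty
set; the set is closed, hence the infimum is attained (`exists_isLinearSolution_half`).

*Decay of `ψ`.* Let `τ` be the dissipation time and `‖ψ(t₀)‖ ≤ B`. The bound `τ ≤ T₀ C B` keeps
`‖ψ‖ ≤ 2 B` on `[t₀, t₀ + τ]` (`IsMildSolution.norm_le_two_mul`). If `∫ ‖Δψ‖²` over this interval is
at least `(2μ + 4C + 64CB⁴) B² τ`, the energy inequality forces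
`‖ψ(t₀ + τ)‖ ≤ exp (-μτ) B`. Otherwise `∫ ‖N(ψ)‖` is small because of `τ ≤ T₁ C μ B`, so `ψ` stays
close to the linear solution issued from `ψ(t₀)`, whose norm is halved at `t₀ + τ`; since
`3/4 ≤ exp (-1/4) ≤ exp (-μτ)`, the same bound follows. Iterating over intervals of length `τ`, with
`B` replaced by `exp (-nμτ) B`, gives the theorem.
-/

set_option linter.unusedSectionVars false

noncomputable section

namespace AdvKS

open Filter Topology ComplexConjugate

variable {L₁ L₂ : ℝ} [hL₁ : Fact (0 < L₁)] [hL₂ : Fact (0 < L₂)]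

/-! ### Fourier series on the torus -/

variable (L₁ L₂) in
/-- The exponential monomial `x ↦ exp (i k̃ · x)` on the torus. -/
def expMono (k : ℤ × ℤ) : C(Torus L₁ L₂, ℂ) where
  toFun x := fourier k.1 x.1 * fourier k.2 x.2
  continuous_toFun := by fun_prop

lemma expMono_apply (k : ℤ × ℤ) (x : Torus L₁ L₂) :
    expMono L₁ L₂ k x = fourier k.1 x.1 * fourier k.2 x.2 := rfl

lemma expMono_neg (k : ℤ × ℤ) (x : Torus L₁ L₂) :
    expMono L₁ L₂ (-k) x = conj (expMono L₁ L₂ k x) := by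
  simp [expMono_apply]

lemma expMono_add (k l : ℤ × ℤ) (x : Torus L₁ L₂) :
    expMono L₁ L₂ (k + l) x = expMono L₁ L₂ k x * expMono L₁ L₂ l x := by
  simp only [expMono_apply, Prod.fst_add, Prod.snd_add, fourier_add]; ring

lemma expMono_zero (x : Torus L₁ L₂) : expMono L₁ L₂ 0 x = 1 := by
  simp [expMono_apply]

lemma norm_expMono_apply (k : ℤ × ℤ) (x : Torus L₁ L₂) : ‖expMono L₁ L₂ k x‖ = 1 := by
  simp only [expMono_apply, fourier_apply, norm_mul, Circle.norm_coe, mul_one]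

lemma area_pos : 0 < L₁ * L₂ := mul_pos hL₁.out hL₂.out

lemma measureReal_univ_torus : (volume : Measure (Torus L₁ L₂)).real univ = L₁ * L₂ := by
  have : (univ : Set (Torus L₁ L₂)) = univ ×ˢ univ := by simp
  rw [this, Measure.volume_eq_prod, measureReal_prod_prod]
  simp [Measure.real, AddCircle.measure_univ, hL₁.out.le, hL₂.out.le]

lemma integral_fourier (T : ℝ) [hT : Fact (0 < T)] (n : ℤ) :
    ∫ x : AddCircle T, fourier n x = if n = 0 then (T : ℂ) else 0 := by
  have h := (orthonormal_iff_ite.mp (@orthonormal_fourier T _)) 0 n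
  simp only [ContinuousMap.inner_toLp, fourier_zero, map_one, mul_one,
    AddCircle.integral_haarAddCircle] at h
  have hT0 : (T : ℂ) ≠ 0 := by exact_mod_cast hT.out.ne'
  split_ifs with hn
  · subst hn
    simp only [if_true] at h
    rw [Complex.real_smul] at h
    push_cast at h
    field_simp at h
    simpa using h
  · rw [if_neg (Ne.symm hn)] at h
    rcases smul_eq_zero.mp h with h | h
    · exact absurd h (inv_ne_zero hT.out.ne')
    · exact h

lemma integral_expMono (k : ℤ × ℤ) :
    ∫ x, expMono L₁ L₂ k x = if k = 0 then ((L₁ * L₂ : ℝ) : ℂ) else 0 := by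
  simp only [expMono_apply]
  rw [Measure.volume_eq_prod,
    integral_prod_mul (fun x : AddCircle L₁ => (fourier k.1 x : ℂ))
      (fun x : AddCircle L₂ => (fourier k.2 x : ℂ)), integral_fourier, integral_fourier]
  rcases k with ⟨k, l⟩
  by_cases hk : k = 0 <;> by_cases hl : l = 0 <;> simp [hk, hl]

variable (L₁ L₂) in
/-- The star subalgebra of continuous functions generated by the exponential monomials. -/
def expSubalgebra : StarSubalgebra ℂ C(Torus L₁ L₂, ℂ) where
  toSubalgebra := Algebra.adjoin ℂ (range (expMono L₁ L₂))
  star_mem' := by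
    change Algebra.adjoin ℂ (range (expMono L₁ L₂)) ≤
      star (Algebra.adjoin ℂ (range (expMono L₁ L₂)))
    refine Algebra.adjoin_le ?_
    rintro _ ⟨n, rfl⟩
    refine Algebra.subset_adjoin ⟨-n, ?_⟩
    ext1 x
    simp only [expMono_neg, starRingEnd_apply, ContinuousMap.star_apply]

lemma expSubalgebra_coe :
    (expSubalgebra L₁ L₂).toSubalgebra.toSubmodule = Submodule.span ℂ (range (expMono L₁ L₂)) := by
  apply Algebra.adjoin_eq_span_of_subset
  refine .trans (fun x ↦ Submonoid.closure_induction (fun _ ↦ id) ⟨0, ?_⟩ ?_)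
    Submodule.subset_span
  · ext z
    simp [expMono_apply]
  · rintro _ _ _ _ ⟨m, rfl⟩ ⟨n, rfl⟩
    refine ⟨m + n, ?_⟩
    ext z
    simp [expMono_add]

lemma expSubalgebra_separatesPoints : (expSubalgebra L₁ L₂).SeparatesPoints := by
  intro x y hxy
  by_cases h1 : x.1 = y.1
  · have h2 : x.2 ≠ y.2 := fun h => hxy (Prod.ext h1 h)
    refine ⟨_, ⟨expMono L₁ L₂ (0, 1), Algebra.subset_adjoin ⟨(0, 1), rfl⟩, rfl⟩, ?_⟩
    simp only [expMono_apply, fourier_zero, one_mul, fourier_one, Ne]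
    contrapose h2
    exact AddCircle.injective_toCircle hL₂.out.ne' (Subtype.ext h2)
  · refine ⟨_, ⟨expMono L₁ L₂ (1, 0), Algebra.subset_adjoin ⟨(1, 0), rfl⟩, rfl⟩, ?_⟩
    simp only [expMono_apply, fourier_zero, mul_one, fourier_one, Ne]
    contrapose h1
    exact AddCircle.injective_toCircle hL₁.out.ne' (Subtype.ext h1)

lemma span_expMono_closure_eq_top :
    (Submodule.span ℂ (range (expMono L₁ L₂))).topologicalClosure = ⊤ := by
  rw [← expSubalgebra_coe]
  exact congr_arg (Subalgebra.toSubmodule <| StarSubalgebra.toSubalgebra ·)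
    (ContinuousMap.starSubalgebra_topologicalClosure_eq_top_of_separatesPoints _
      expSubalgebra_separatesPoints)

variable (L₁ L₂) in
/-- The `L²`-normalised exponential monomials. -/
def expLp (k : ℤ × ℤ) : Lp ℂ 2 (volume : Measure (Torus L₁ L₂)) :=
  (((√(L₁ * L₂))⁻¹ : ℝ) : ℂ) • ContinuousMap.toLp (E := ℂ) 2 volume ℂ (expMono L₁ L₂ k)

lemma orthonormal_expLp : Orthonormal ℂ (expLp L₁ L₂) := by
  rw [orthonormal_iff_ite]
  intro m n
  have hA : ((L₁ * L₂ : ℝ) : ℂ) ≠ 0 := by exact_mod_cast (area_pos (L₁ := L₁) (L₂ := L₂)).ne'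
  simp only [expLp, inner_smul_left, inner_smul_right, ContinuousMap.inner_toLp, ← expMono_neg,
    ← expMono_add, integral_expMono, Complex.conj_ofReal]
  have hs : (((√(L₁ * L₂))⁻¹ : ℝ) : ℂ) * (((√(L₁ * L₂))⁻¹ : ℝ) : ℂ) = ((L₁ * L₂ : ℝ) : ℂ)⁻¹ := by
    rw [← Complex.ofReal_mul, ← mul_inv, Real.mul_self_sqrt area_pos.le, Complex.ofReal_inv]
  by_cases h : m = n
  · subst h
    simp only [add_neg_cancel, if_true]
    rw [← mul_assoc, hs, inv_mul_cancel₀ hA]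
  · have : n + -m ≠ 0 := fun h' => h (by rw [← sub_eq_add_neg, sub_eq_zero] at h'; exact h'.symm)
    simp [this, h]

lemma span_expLp_closure_eq_top :
    (Submodule.span ℂ (range (expLp L₁ L₂))).topologicalClosure = ⊤ := by
  have h : (Submodule.span ℂ (range fun k =>
      ContinuousMap.toLp (E := ℂ) 2 (volume : Measure (Torus L₁ L₂)) ℂ
        (expMono L₁ L₂ k))).topologicalClosure = ⊤ := by
    simpa only [Submodule.map_span, ContinuousLinearMap.coe_coe, ← range_comp,
      Function.comp_def] using
      (ContinuousMap.toLp_denseRange ℂ (volume : Measure (Torus L₁ L₂)) ℂ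
        (by simp : (2 : ENNReal) ≠ ⊤)).topologicalClosure_map_submodule span_expMono_closure_eq_top
  refine top_le_iff.mp (h.symm.le.trans (Submodule.topologicalClosure_mono ?_))
  rw [Submodule.span_le]
  rintro _ ⟨k, rfl⟩
  have hs : (((√(L₁ * L₂)) : ℝ) : ℂ) • expLp L₁ L₂ k = ContinuousMap.toLp (E := ℂ) 2
      (volume : Measure (Torus L₁ L₂)) ℂ (expMono L₁ L₂ k) := by
    rw [expLp, smul_smul, ← Complex.ofReal_mul,
      mul_inv_cancel₀ (Real.sqrt_pos.mpr area_pos).ne', Complex.ofReal_one, one_smul]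
  simp only [SetLike.mem_coe]
  rw [← hs]
  exact Submodule.smul_mem _ _ (Submodule.subset_span ⟨k, rfl⟩)

variable (L₁ L₂) in
/-- The normalised exponential monomials as a Hilbert basis of complex `L²`. -/
def expBasis : HilbertBasis (ℤ × ℤ) ℂ (Lp ℂ 2 (volume : Measure (Torus L₁ L₂))) :=
  HilbertBasis.mk orthonormal_expLp span_expLp_closure_eq_top.ge

/-- Fourier coefficients of complex-valued functions. -/
def cCoef (f : Torus L₁ L₂ → ℂ) (k : ℤ × ℤ) : ℂ :=
  ((L₁ * L₂ : ℝ) : ℂ)⁻¹ * ∫ x, expMono L₁ L₂ (-k) x * f x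

lemma fourierCoef_eq_cCoef (f : Torus L₁ L₂ → ℝ) (k : ℤ × ℤ) :
    fourierCoef f k = cCoef (fun x => (f x : ℂ)) k := rfl

lemma cCoef_congr_ae {f g : Torus L₁ L₂ → ℂ} (h : f =ᵐ[volume] g) (k : ℤ × ℤ) :
    cCoef f k = cCoef g k := by
  unfold cCoef
  congr 1
  apply integral_congr_ae
  filter_upwards [h] with x hx
  rw [hx]

lemma expBasis_repr (f : Lp ℂ 2 (volume : Measure (Torus L₁ L₂))) (k : ℤ × ℤ) :
    (expBasis L₁ L₂).repr f k = ((√(L₁ * L₂) : ℝ) : ℂ) * cCoef f k := by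
  rw [HilbertBasis.repr_apply_apply, expBasis, HilbertBasis.coe_mk, expLp, inner_smul_left,
    MeasureTheory.L2.inner_def, Complex.conj_ofReal, cCoef, ← mul_assoc]
  congr 1
  · rw [← Complex.ofReal_inv, ← Complex.ofReal_mul]
    congr 1
    have h0 := area_pos (L₁ := L₁) (L₂ := L₂)
    rw [inv_eq_iff_eq_inv, mul_inv, inv_inv, eq_comm, mul_comm, ← div_eq_mul_inv, Real.div_sqrt]
  · apply integral_congr_ae
    filter_upwards [ContinuousMap.coeFn_toLp (𝕜 := ℂ) (p := 2)
      (volume : Measure (Torus L₁ L₂)) (expMono L₁ L₂ k)] with x hx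
    rw [hx, expMono_neg, RCLike.inner_apply, mul_comm]

/-- Parseval's identity for complex-valued square-integrable functions. -/
lemma hasSum_conj_cCoef_mul {f g : Torus L₁ L₂ → ℂ} (hf : MemLp f 2 volume)
    (hg : MemLp g 2 volume) :
    HasSum (fun k => conj (cCoef f k) * cCoef g k)
      (((L₁ * L₂ : ℝ) : ℂ)⁻¹ * ∫ x, conj (f x) * g x) := by
  have h := (expBasis L₁ L₂).hasSum_inner_mul_inner (hf.toLp f) (hg.toLp g)
  have h2 := h.mul_left (((L₁ * L₂ : ℝ) : ℂ)⁻¹)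
  have hA : ((L₁ * L₂ : ℝ) : ℂ) ≠ 0 := by exact_mod_cast (area_pos (L₁ := L₁) (L₂ := L₂)).ne'
  have hs : ((√(L₁ * L₂) : ℝ) : ℂ) * ((√(L₁ * L₂) : ℝ) : ℂ) = ((L₁ * L₂ : ℝ) : ℂ) := by
    rw [← Complex.ofReal_mul, Real.mul_self_sqrt area_pos.le]
  convert! h2 using 1
  · ext k
    rw [← HilbertBasis.repr_apply_apply, ← inner_conj_symm, ← HilbertBasis.repr_apply_apply,
      expBasis_repr, expBasis_repr, cCoef_congr_ae hf.coeFn_toLp, cCoef_congr_ae hg.coeFn_toLp,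
      map_mul, Complex.conj_ofReal]
    calc _ = (((L₁ * L₂ : ℝ) : ℂ)⁻¹ * ((L₁ * L₂ : ℝ) : ℂ)) *
        (conj (cCoef f k) * cCoef g k) := by rw [inv_mul_cancel₀ hA, one_mul]
      _ = _ := by rw [← hs]; ring
  · congr 1
    rw [MeasureTheory.L2.inner_def]
    apply integral_congr_ae
    filter_upwards [hf.coeFn_toLp, hg.coeFn_toLp] with x hx hy
    rw [hx, hy, RCLike.inner_apply, mul_comm]

/-- Riesz–Fischer: every square-summable family is a family of Fourier coefficients. -/
lemma exists_cCoef_eq {c : ℤ × ℤ → ℂ} (hc : Summable fun k => ‖c k‖ ^ 2) :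
    ∃ f : Lp ℂ 2 (volume : Measure (Torus L₁ L₂)), ∀ k, cCoef f k = c k := by
  have hs : ((√(L₁ * L₂) : ℝ) : ℂ) ≠ 0 := by
    exact_mod_cast (Real.sqrt_pos.mpr (area_pos (L₁ := L₁) (L₂ := L₂))).ne'
  have hm : Memℓp (fun k => ((√(L₁ * L₂) : ℝ) : ℂ) * c k) 2 := by
    refine memℓp_gen ?_
    simp only [ENNReal.toReal_ofNat, Real.rpow_ofNat, norm_mul, mul_pow]
    exact hc.mul_left _
  refine ⟨(expBasis L₁ L₂).repr.symm ⟨_, hm⟩, fun k => ?_⟩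
  have := expBasis_repr ((expBasis L₁ L₂).repr.symm ⟨_, hm⟩) k
  rw [LinearIsometryEquiv.apply_symm_apply] at this
  exact (mul_left_cancel₀ hs this).symm

/-- An integrable function all of whose Fourier coefficients vanish is zero almost everywhere. -/
lemma ae_eq_zero_of_cCoef_eq_zero {f : Torus L₁ L₂ → ℂ} (hf : Integrable f)
    (h : ∀ k, cCoef f k = 0) : f =ᵐ[volume] 0 := by
  have hA : ((L₁ * L₂ : ℝ) : ℂ) ≠ 0 := by exact_mod_cast (area_pos (L₁ := L₁) (L₂ := L₂)).ne'
  have hint : ∀ φ : C(Torus L₁ L₂, ℂ), Integrable (fun x => φ x * f x) := fun φ =>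
    hf.bdd_mul (c := ‖φ‖) φ.continuous.aestronglyMeasurable
      (Eventually.of_forall fun x => φ.norm_coe_le_norm x)
  let Λ : C(Torus L₁ L₂, ℂ) →ₗ[ℂ] ℂ :=
    { toFun := fun φ => ∫ x, φ x * f x
      map_add' := fun φ χ => by
        rw [← integral_add (hint φ) (hint χ)]
        simp [add_mul]
      map_smul' := fun a φ => by
        rw [RingHom.id_apply, smul_eq_mul, ← integral_const_mul]
        simp [mul_assoc] }
  have hcont : Continuous Λ := by
    refine (Λ.mkContinuous (∫ x, ‖f x‖) fun φ => ?_).continuous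
    refine (norm_integral_le_integral_norm _).trans ?_
    rw [mul_comm, ← integral_const_mul]
    refine integral_mono (hint φ).norm (hf.norm.const_mul _) fun x => ?_
    simp only [norm_mul]
    gcongr
    exact φ.norm_coe_le_norm x
  have hker : ∀ φ : C(Torus L₁ L₂, ℂ), Λ φ = 0 := by
    have : (⊤ : Submodule ℂ C(Torus L₁ L₂, ℂ)) ≤ LinearMap.ker Λ := by
      rw [← span_expMono_closure_eq_top]
      refine Submodule.topologicalClosure_minimal _ ?_ ?_
      · rw [Submodule.span_le]
        rintro _ ⟨k, rfl⟩
        have := h (-k)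
        simp only [cCoef, neg_neg, mul_eq_zero, inv_eq_zero, hA, false_or] at this
        exact this
      · exact isClosed_singleton.preimage hcont
    exact fun φ => this (Submodule.mem_top)
  refine ae_eq_zero_of_forall_setIntegral_isClosed_eq_zero hf fun K hK => ?_
  -- approximate the indicator of `K` from above by continuous functions
  have hlim : Tendsto (fun n : ℕ => ∫ x, ((thickenedIndicator
      (Nat.one_div_pos_of_nat (α := ℝ) (n := n)) K x : ℝ≥0) : ℂ) * f x) atTop
      (𝓝 (∫ x, K.indicator f x)) := by
    refine tendsto_integral_of_dominated_convergence (fun x => ‖f x‖) (fun n => ?_) hf.norm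
      (fun n => ?_) ?_
    · refine AEStronglyMeasurable.mul ?_ hf.1
      exact (by fun_prop : Continuous fun x => ((thickenedIndicator
        (Nat.one_div_pos_of_nat (α := ℝ) (n := n)) K x : ℝ≥0) : ℂ)).aestronglyMeasurable
    · refine Eventually.of_forall fun x => ?_
      rw [norm_mul]
      refine mul_le_of_le_one_left (norm_nonneg _) ?_
      have := thickenedIndicator_le_one (Nat.one_div_pos_of_nat (α := ℝ) (n := n)) K x
      rw [Complex.norm_of_nonneg (by positivity)]
      exact_mod_cast this
    · refine Eventually.of_forall fun x => ?_
      have ht := thickenedIndicator_tendsto_indicator_closure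
        (fun n => Nat.one_div_pos_of_nat (α := ℝ) (n := n)) tendsto_one_div_add_atTop_nhds_zero_nat K
      rw [tendsto_pi_nhds] at ht
      have hx := ht x
      rw [hK.closure_eq] at hx
      have hx2 : Tendsto (fun n : ℕ => ((thickenedIndicator
          (Nat.one_div_pos_of_nat (α := ℝ) (n := n)) K x : ℝ≥0) : ℂ)) atTop
          (𝓝 ((K.indicator (fun _ => (1 : ℝ≥0)) x : ℝ≥0) : ℂ)) :=
        ((by fun_prop : Continuous fun y : ℝ≥0 => (y : ℂ)).tendsto _).comp hx
      convert hx2.mul_const (f x) using 2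
      by_cases hxK : x ∈ K <;> simp [hxK]
  rw [← integral_indicator hK.measurableSet]
  refine tendsto_nhds_unique hlim ?_
  refine tendsto_const_nhds.congr fun n => ?_
  exact (hker ⟨fun x => ((thickenedIndicator
      (Nat.one_div_pos_of_nat (α := ℝ) (n := n)) K x : ℝ≥0) : ℂ), by fun_prop⟩).symm

/-! ### Fourier coefficients of real functions -/

lemma memLp_ofReal {f : Torus L₁ L₂ → ℝ} (hf : MemLp f 2 volume) :
    MemLp (fun x => (f x : ℂ)) 2 volume := hf.ofReal

lemma integrable_ofReal {f : Torus L₁ L₂ → ℝ} (hf : Integrable f) :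
    Integrable (fun x => (f x : ℂ)) := hf.ofReal

lemma fourierCoef_congr_ae {f g : Torus L₁ L₂ → ℝ} (h : f =ᵐ[volume] g) (k : ℤ × ℤ) :
    fourierCoef f k = fourierCoef g k := by
  simp only [fourierCoef_eq_cCoef]
  refine cCoef_congr_ae ?_ k
  filter_upwards [h] with x hx
  rw [hx]

lemma integrable_expMono_mul {f : Torus L₁ L₂ → ℂ} (hf : Integrable f) (k : ℤ × ℤ) :
    Integrable fun x => expMono L₁ L₂ k x * f x :=
  hf.bdd_mul (c := 1) (expMono L₁ L₂ k).continuous.aestronglyMeasurable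
    (Eventually.of_forall fun x => (norm_expMono_apply k x).le)

lemma fourierCoef_neg_freq (f : Torus L₁ L₂ → ℝ) (k : ℤ × ℤ) :
    fourierCoef f (-k) = conj (fourierCoef f k) := by
  simp only [fourierCoef_eq_cCoef, cCoef, map_mul, map_inv₀, Complex.conj_ofReal,
    ← integral_conj, ← expMono_neg, neg_neg]

lemma fourierCoef_add {f g : Torus L₁ L₂ → ℝ} (hf : Integrable f) (hg : Integrable g)
    (k : ℤ × ℤ) : fourierCoef (fun x => f x + g x) k = fourierCoef f k + fourierCoef g k := by
  simp only [fourierCoef_eq_cCoef, cCoef]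
  rw [← mul_add, ← integral_add (integrable_expMono_mul (integrable_ofReal hf) _)
    (integrable_expMono_mul (integrable_ofReal hg) _)]
  simp only [Complex.ofReal_add, mul_add]

lemma fourierCoef_const_mul (a : ℝ) (f : Torus L₁ L₂ → ℝ) (k : ℤ × ℤ) :
    fourierCoef (fun x => a * f x) k = a * fourierCoef f k := by
  simp only [fourierCoef_eq_cCoef, cCoef]
  have h : ∀ x, expMono L₁ L₂ (-k) x * ((a * f x : ℝ) : ℂ)
      = a * (expMono L₁ L₂ (-k) x * (f x : ℂ)) := fun x => by push_cast; ring
  simp only [h]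
  rw [integral_const_mul, mul_left_comm]

lemma fourierCoef_zero_freq (f : Torus L₁ L₂ → ℝ) : fourierCoef f 0 = (average f : ℂ) := by
  simp only [fourierCoef_eq_cCoef, cCoef, neg_zero, expMono_zero, one_mul, average]
  rw [integral_complex_ofReal]
  push_cast
  rfl

lemma norm_fourierCoef_le (f : Torus L₁ L₂ → ℝ) (k : ℤ × ℤ) :
    ‖fourierCoef f k‖ ≤ (L₁ * L₂)⁻¹ * ∫ x, |f x| := by
  simp only [fourierCoef_eq_cCoef, cCoef]
  rw [norm_mul, norm_inv, Complex.norm_of_nonneg area_pos.le]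
  have := area_pos (L₁ := L₁) (L₂ := L₂)
  gcongr
  refine (norm_integral_le_integral_norm _).trans (le_of_eq ?_)
  simp [norm_expMono_apply]

/-- Polarised Parseval identity for real functions. -/
lemma hasSum_conj_fourierCoef_mul {f g : Torus L₁ L₂ → ℝ} (hf : MemLp f 2 volume)
    (hg : MemLp g 2 volume) :
    HasSum (fun k => conj (fourierCoef f k) * fourierCoef g k)
      (((L₁ * L₂)⁻¹ * ∫ x, f x * g x : ℝ) : ℂ) := by
  convert! hasSum_conj_cCoef_mul (memLp_ofReal hf) (memLp_ofReal hg) using 1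
  simp only [Complex.conj_ofReal, ← Complex.ofReal_mul]
  rw [integral_complex_ofReal]
  push_cast
  rfl

lemma inner_eq_integral (f g : L2 L₁ L₂) : inner ℝ f g = ∫ x, f x * g x := by
  rw [MeasureTheory.L2.inner_def]
  refine integral_congr_ae (Eventually.of_forall fun x => ?_)
  simp [mul_comm]

lemma hasSum_re_conj_fourierCoef_mul (f g : L2 L₁ L₂) :
    HasSum (fun k => (conj (fourierCoef f k) * fourierCoef g k).re)
      ((L₁ * L₂)⁻¹ * inner ℝ f g) := by
  have := Complex.hasSum_re (hasSum_conj_fourierCoef_mul (Lp.memLp f) (Lp.memLp g))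
  rw [inner_eq_integral]
  simpa only [Complex.ofReal_re] using this

lemma re_conj_mul_self (z : ℂ) : (conj z * z).re = ‖z‖ ^ 2 := by
  rw [mul_comm, Complex.mul_conj, Complex.ofReal_re, Complex.normSq_eq_norm_sq]

lemma hasSum_normSq_fourierCoef (f : L2 L₁ L₂) :
    HasSum (fun k => ‖fourierCoef f k‖ ^ 2) ((L₁ * L₂)⁻¹ * ‖f‖ ^ 2) := by
  have := hasSum_re_conj_fourierCoef_mul f f
  simpa only [re_conj_mul_self, real_inner_self_eq_norm_sq] using this

lemma tsum_normSq_fourierCoef (f : L2 L₁ L₂) :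
    ‖f‖ ^ 2 = L₁ * L₂ * ∑' k, ‖fourierCoef f k‖ ^ 2 := by
  rw [(hasSum_normSq_fourierCoef f).tsum_eq, mul_inv_cancel_left₀ area_pos.ne']

/-- The Fourier coefficient at `k` as a continuous linear functional on `L²`. -/
def coefL (k : ℤ × ℤ) : L2 L₁ L₂ →L[ℝ] ℂ :=
  LinearMap.mkContinuous
    { toFun := fun f => fourierCoef f k
      map_add' := fun f g => by
        rw [fourierCoef_congr_ae (Lp.coeFn_add f g)]
        exact fourierCoef_add ((Lp.memLp f).integrable one_le_two)
          ((Lp.memLp g).integrable one_le_two) k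
      map_smul' := fun a f => by
        rw [fourierCoef_congr_ae (Lp.coeFn_smul a f)]
        exact fourierCoef_const_mul a f k }
    (√((L₁ * L₂)⁻¹)) (fun f => by
      have h := (hasSum_normSq_fourierCoef f).summable.le_tsum k (fun j _ => by positivity)
      rw [(hasSum_normSq_fourierCoef f).tsum_eq] at h
      refine le_of_sq_le_sq ?_ (by positivity)
      rw [mul_pow, Real.sq_sqrt (inv_nonneg.mpr area_pos.le)]
      exact h)

@[simp] lemma coefL_apply (k : ℤ × ℤ) (f : L2 L₁ L₂) : coefL k f = fourierCoef f k := rfl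

lemma coef_add (f g : L2 L₁ L₂) (k : ℤ × ℤ) :
    fourierCoef (f + g : L2 L₁ L₂) k = fourierCoef f k + fourierCoef g k :=
  (coefL k).map_add f g

lemma coef_sub (f g : L2 L₁ L₂) (k : ℤ × ℤ) :
    fourierCoef (f - g : L2 L₁ L₂) k = fourierCoef f k - fourierCoef g k :=
  (coefL k).map_sub f g

lemma coef_toLp {f : Torus L₁ L₂ → ℝ} (hf : MemLp f 2 volume) (k : ℤ × ℤ) :
    fourierCoef (hf.toLp f) k = fourierCoef f k :=
  fourierCoef_congr_ae hf.coeFn_toLp k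

lemma eq_of_coef_eq {f g : L2 L₁ L₂} (h : ∀ k, fourierCoef f k = fourierCoef g k) : f = g := by
  have : ‖f - g‖ ^ 2 = 0 := by
    rw [tsum_normSq_fourierCoef]
    simp only [coef_sub, h, sub_self, norm_zero]
    simp
  rw [← sub_eq_zero]
  simpa using this

/-- Uniqueness of Fourier series in `L¹`. -/
lemma ae_eq_of_coef_eq {f g : Torus L₁ L₂ → ℝ} (hf : Integrable f) (hg : Integrable g)
    (h : ∀ k, fourierCoef f k = fourierCoef g k) : f =ᵐ[volume] g := by
  have hfg : Integrable (fun x => ((f x : ℂ) - (g x : ℂ))) := (integrable_ofReal hf).sub (integrable_ofReal hg)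
  have := ae_eq_zero_of_cCoef_eq_zero hfg fun k => by
    have hk := h k
    simp only [fourierCoef_eq_cCoef, cCoef] at hk ⊢
    simp only [mul_sub]
    rw [integral_sub (integrable_expMono_mul (integrable_ofReal hf) _) (integrable_expMono_mul (integrable_ofReal hg) _),
      mul_sub, hk, sub_self]
  filter_upwards [this] with x hx
  have hx' : (f x : ℂ) - (g x : ℂ) = 0 := hx
  exact_mod_cast sub_eq_zero.mp hx'

/-- Riesz–Fischer for real functions: a square-summable family with the Hermitian symmetry
`c (-k) = conj (c k)` is the family of Fourier coefficients of a real `L²` function. -/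
lemma exists_coef_eq {c : ℤ × ℤ → ℂ} (hc : Summable fun k => ‖c k‖ ^ 2)
    (hsymm : ∀ k, c (-k) = conj (c k)) : ∃ g : L2 L₁ L₂, ∀ k, fourierCoef g k = c k := by
  obtain ⟨f, hf⟩ := exists_cCoef_eq (L₁ := L₁) (L₂ := L₂) hc
  have hre : MemLp (fun x => (f x).re) 2 (volume : Measure (Torus L₁ L₂)) := (Lp.memLp f).re
  have hint : Integrable f := (Lp.memLp f).integrable one_le_two
  have hint' : Integrable (fun x => conj (f x)) :=
    (Complex.conjCLE.toContinuousLinearMap.integrable_comp hint)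
  refine ⟨hre.toLp _, fun k => ?_⟩
  rw [coef_toLp, fourierCoef_eq_cCoef]
  have h1 : (fun x => (((f x).re : ℝ) : ℂ)) = fun x => (f x + conj (f x)) / 2 := by
    ext x; rw [Complex.re_eq_add_conj]
  have h2 : cCoef (fun x => conj (f x)) k = c k := by
    have : cCoef (fun x => conj (f x)) k = conj (cCoef f (-k)) := by
      simp only [cCoef, map_mul, map_inv₀, Complex.conj_ofReal, ← integral_conj, neg_neg]
      simp only [← expMono_neg]
    rw [this, hf, hsymm, Complex.conj_conj]
  have h3 : cCoef (fun x => (f x + conj (f x)) / 2) k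
      = (cCoef f k + cCoef (fun x => conj (f x)) k) / 2 := by
    simp only [cCoef]
    rw [← mul_add, mul_div_assoc, ← integral_add (integrable_expMono_mul hint _)
      (integrable_expMono_mul hint' _), ← integral_div]
    congr 2
    ext x
    ring
  rw [h1, h3, h2, hf]
  ring

/-- The Fourier coefficients of a product are the convolution of the Fourier coefficients. -/
lemma hasSum_fourierCoef_mul {f g : Torus L₁ L₂ → ℝ} (hf : MemLp f 2 volume)
    (hg : MemLp g 2 volume) (k : ℤ × ℤ) :
    HasSum (fun m => fourierCoef f (k - m) * fourierCoef g m)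
      (fourierCoef (fun x => f x * g x) k) := by
  have hef : MemLp (fun x => expMono L₁ L₂ k x * (f x : ℂ)) 2 volume := by
    refine (memLp_ofReal hf).of_le ?_ (Eventually.of_forall fun x => ?_)
    · exact (expMono L₁ L₂ k).continuous.aestronglyMeasurable.mul (memLp_ofReal hf).1
    · rw [norm_mul, norm_expMono_apply, one_mul]
  convert! hasSum_conj_cCoef_mul hef (memLp_ofReal hg) using 1
  · ext m
    rw [fourierCoef_eq_cCoef g]
    congr 1
    rw [← neg_sub m k, fourierCoef_neg_freq, fourierCoef_eq_cCoef]
    congr 1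
    simp only [cCoef]
    congr 2
    ext x
    rw [← mul_assoc, ← expMono_add, neg_sub, sub_eq_neg_add]
  · simp only [fourierCoef_eq_cCoef, cCoef]
    congr 2
    ext x
    rw [map_mul, ← expMono_neg, Complex.conj_ofReal]
    push_cast
    ring

/-! ### Fourier multipliers -/

lemma coef_multiplier {m : ℤ × ℤ → ℂ} {f : Torus L₁ L₂ → ℝ} (h : InDomain m f) (k : ℤ × ℤ) :
    fourierCoef (multiplier m f) k = m k * fourierCoef f k := by
  rw [multiplier, dif_pos h]
  exact h.choose_spec k

lemma InDomain.summable {m : ℤ × ℤ → ℂ} {f : Torus L₁ L₂ → ℝ} (h : InDomain m f) :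
    Summable fun k => ‖m k * fourierCoef f k‖ ^ 2 := by
  obtain ⟨g, hg⟩ := h
  simpa only [hg] using (hasSum_normSq_fourierCoef g).summable

lemma inDomain_of_summable {m : ℤ × ℤ → ℂ} (hm : ∀ k, m (-k) = conj (m k))
    {f : Torus L₁ L₂ → ℝ} (h : Summable fun k => ‖m k * fourierCoef f k‖ ^ 2) : InDomain m f :=
  exists_coef_eq h fun k => by rw [hm, fourierCoef_neg_freq, map_mul]

lemma hasSum_normSq_multiplier {m : ℤ × ℤ → ℂ} {f : Torus L₁ L₂ → ℝ} (h : InDomain m f) :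
    HasSum (fun k => ‖m k‖ ^ 2 * ‖fourierCoef f k‖ ^ 2) ((L₁ * L₂)⁻¹ * ‖multiplier m f‖ ^ 2) := by
  have := hasSum_normSq_fourierCoef (multiplier m f)
  simpa only [coef_multiplier h, norm_mul, mul_pow] using this

lemma freqSq_nonneg (k : ℤ × ℤ) : 0 ≤ freqSq L₁ L₂ k := by unfold freqSq; positivity

@[simp] lemma freqSq_neg (k : ℤ × ℤ) : freqSq L₁ L₂ (-k) = freqSq L₁ L₂ k := by
  simp [freqSq, freq]; ring

lemma freqSq_zero : freqSq L₁ L₂ 0 = 0 := by simp [freqSq, freq]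

lemma symD₁_neg (k : ℤ × ℤ) : symD₁ L₁ L₂ (-k) = conj (symD₁ L₁ L₂ k) := by
  simp only [symD₁, freq, map_mul, Complex.conj_I, Complex.conj_ofReal, Prod.fst_neg]
  push_cast; ring

lemma symD₂_neg (k : ℤ × ℤ) : symD₂ L₁ L₂ (-k) = conj (symD₂ L₁ L₂ k) := by
  simp only [symD₂, freq, map_mul, Complex.conj_I, Complex.conj_ofReal, Prod.snd_neg]
  push_cast; ring

lemma symLap_neg (k : ℤ × ℤ) : symLap L₁ L₂ (-k) = conj (symLap L₁ L₂ k) := by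
  simp [symLap]

lemma normSq_symD (k : ℤ × ℤ) :
    ‖symD₁ L₁ L₂ k‖ ^ 2 + ‖symD₂ L₁ L₂ k‖ ^ 2 = freqSq L₁ L₂ k := by
  simp [symD₁, symD₂, freqSq]

lemma normSq_symD₁_le (k : ℤ × ℤ) : ‖symD₁ L₁ L₂ k‖ ^ 2 ≤ freqSq L₁ L₂ k := by
  rw [← normSq_symD]; nlinarith [sq_nonneg ‖symD₂ L₁ L₂ k‖]

lemma normSq_symD₂_le (k : ℤ × ℤ) : ‖symD₂ L₁ L₂ k‖ ^ 2 ≤ freqSq L₁ L₂ k := by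
  rw [← normSq_symD]; nlinarith [sq_nonneg ‖symD₁ L₁ L₂ k‖]

lemma norm_symLap (k : ℤ × ℤ) : ‖symLap L₁ L₂ k‖ = freqSq L₁ L₂ k := by
  rw [symLap, norm_neg, Complex.norm_of_nonneg (freqSq_nonneg k)]

lemma memH1_iff {f : L2 L₁ L₂} :
    MemH1 f ↔ Summable fun k => freqSq L₁ L₂ k * ‖fourierCoef f k‖ ^ 2 := by
  constructor
  · rintro ⟨h1, h2⟩
    refine (h1.summable.add h2.summable).congr fun k => ?_
    rw [norm_mul, norm_mul, mul_pow, mul_pow, ← add_mul, normSq_symD]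
  · intro h
    refine ⟨inDomain_of_summable symD₁_neg (h.of_nonneg_of_le (fun _ => by positivity) fun k => ?_),
      inDomain_of_summable symD₂_neg (h.of_nonneg_of_le (fun _ => by positivity) fun k => ?_)⟩
    · rw [norm_mul, mul_pow]; gcongr; exact normSq_symD₁_le k
    · rw [norm_mul, mul_pow]; gcongr; exact normSq_symD₂_le k

lemma memH2_iff {f : L2 L₁ L₂} :
    MemH2 f ↔ Summable fun k => freqSq L₁ L₂ k ^ 2 * ‖fourierCoef f k‖ ^ 2 := by
  constructor
  · intro h
    simpa only [norm_mul, mul_pow, norm_symLap] using InDomain.summable h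
  · intro h
    refine inDomain_of_summable symLap_neg ?_
    simpa only [norm_mul, mul_pow, norm_symLap] using h

lemma coef_D₁ {f : L2 L₁ L₂} (h : MemH1 f) (k : ℤ × ℤ) :
    fourierCoef (D₁ f) k = symD₁ L₁ L₂ k * fourierCoef f k := coef_multiplier h.1 k

lemma coef_D₂ {f : L2 L₁ L₂} (h : MemH1 f) (k : ℤ × ℤ) :
    fourierCoef (D₂ f) k = symD₂ L₁ L₂ k * fourierCoef f k := coef_multiplier h.2 k

lemma coef_lap {f : L2 L₁ L₂} (h : MemH2 f) (k : ℤ × ℤ) :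
    fourierCoef (lap f) k = -(freqSq L₁ L₂ k : ℂ) * fourierCoef f k := coef_multiplier h k

lemma gradNorm_sq (f : L2 L₁ L₂) : gradNorm f ^ 2 = ‖D₁ f‖ ^ 2 + ‖D₂ f‖ ^ 2 :=
  Real.sq_sqrt (by positivity)

lemma gradNorm_nonneg (f : L2 L₁ L₂) : 0 ≤ gradNorm f := Real.sqrt_nonneg _

lemma norm_D₁_le (f : L2 L₁ L₂) : ‖D₁ f‖ ≤ gradNorm f :=
  Real.le_sqrt_of_sq_le (by nlinarith [sq_nonneg ‖D₂ f‖])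

lemma norm_D₂_le (f : L2 L₁ L₂) : ‖D₂ f‖ ≤ gradNorm f :=
  Real.le_sqrt_of_sq_le (by nlinarith [sq_nonneg ‖D₁ f‖])

lemma hasSum_gradNorm {f : L2 L₁ L₂} (h : MemH1 f) :
    HasSum (fun k => freqSq L₁ L₂ k * ‖fourierCoef f k‖ ^ 2)
      ((L₁ * L₂)⁻¹ * gradNorm f ^ 2) := by
  have := (hasSum_normSq_multiplier h.1).add (hasSum_normSq_multiplier h.2)
  simp only [← add_mul, normSq_symD, ← mul_add] at this
  rw [gradNorm_sq]
  exact this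

lemma hasSum_norm_lap {f : L2 L₁ L₂} (h : MemH2 f) :
    HasSum (fun k => freqSq L₁ L₂ k ^ 2 * ‖fourierCoef f k‖ ^ 2)
      ((L₁ * L₂)⁻¹ * ‖lap f‖ ^ 2) := by
  have := hasSum_normSq_multiplier h
  simp only [norm_symLap] at this
  exact this

lemma MemH2.memH1 {f : L2 L₁ L₂} (h : MemH2 f) : MemH1 f := by
  rw [memH1_iff]
  refine ((memH2_iff.mp h).add (hasSum_normSq_fourierCoef f).summable).of_nonneg_of_le
    (fun k => mul_nonneg (freqSq_nonneg k) (by positivity)) fun k => ?_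
  have := freqSq_nonneg (L₁ := L₁) (L₂ := L₂) k
  nlinarith [mul_nonneg (by nlinarith [sq_nonneg (freqSq L₁ L₂ k - 1)] :
    0 ≤ freqSq L₁ L₂ k ^ 2 + 1 - freqSq L₁ L₂ k) (sq_nonneg ‖fourierCoef f k‖)]

/-- Interpolation between `L²` and `H²`. -/
lemma gradNorm_sq_le {f : L2 L₁ L₂} (h : MemH2 f) : gradNorm f ^ 2 ≤ ‖f‖ * ‖lap f‖ := by
  have h0 := area_pos (L₁ := L₁) (L₂ := L₂)
  have h1 := hasSum_re_conj_fourierCoef_mul f (lap f)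
  have h2 : HasSum (fun k => freqSq L₁ L₂ k * ‖fourierCoef f k‖ ^ 2)
      (-((L₁ * L₂)⁻¹ * inner ℝ f (lap f))) := by
    convert! h1.neg using 1
    ext k
    have : conj (fourierCoef f k) * fourierCoef (lap f) k =
        ((-freqSq L₁ L₂ k : ℝ) : ℂ) * (conj (fourierCoef f k) * fourierCoef f k) := by
      rw [coef_lap h]; push_cast; ring
    rw [this, Complex.re_ofReal_mul, re_conj_mul_self]
    ring
  have h3 := h2.unique (hasSum_gradNorm h.memH1)
  have h4 : gradNorm f ^ 2 = -inner ℝ f (lap f) := by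
    rw [← mul_neg] at h3
    exact (mul_left_cancel₀ (inv_ne_zero h0.ne') h3).symm
  rw [h4]
  exact (neg_le_abs _).trans (abs_real_inner_le_norm _ _)

variable (L₁ L₂) in
/-- A positive lower bound for `|k̃|²` over `k ≠ 0`; it is not the optimal one, `L₁ + L₂` being used
as a convenient upper bound for both periods. -/
def gap : ℝ := (2 * Real.pi / (L₁ + L₂)) ^ 2

lemma gap_pos : 0 < gap L₁ L₂ := by
  have := hL₁.out
  have := hL₂.out
  unfold gap; positivity

lemma gap_le_freqSq {k : ℤ × ℤ} (hk : k ≠ 0) : gap L₁ L₂ ≤ freqSq L₁ L₂ k := by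
  have h1 := hL₁.out
  have h2 := hL₂.out
  have aux : ∀ (n : ℤ) (L : ℝ), n ≠ 0 → 0 < L → L ≤ L₁ + L₂ →
      (2 * Real.pi / (L₁ + L₂)) ^ 2 ≤ (2 * Real.pi * n / L) ^ 2 := by
    intro n L hn hL hle
    have hn1 : (1 : ℝ) ≤ (n : ℝ) ^ 2 := by
      rw [one_le_sq_iff_one_le_abs]; exact_mod_cast Int.one_le_abs hn
    calc (2 * Real.pi / (L₁ + L₂)) ^ 2 ≤ (2 * Real.pi / L) ^ 2 := by gcongr
      _ ≤ (2 * Real.pi / L) ^ 2 * (n : ℝ) ^ 2 := le_mul_of_one_le_right (by positivity) hn1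
      _ = _ := by ring
  unfold gap freqSq freq
  by_cases hk1 : k.1 = 0
  · have hk2 : k.2 ≠ 0 := fun h => hk (Prod.ext hk1 h)
    have := aux k.2 L₂ hk2 h2 (by linarith)
    have := sq_nonneg (2 * Real.pi * k.1 / L₁)
    dsimp only
    linarith
  · have := aux k.1 L₁ hk1 h1 (by linarith)
    have := sq_nonneg (2 * Real.pi * k.2 / L₂)
    dsimp only
    linarith

lemma MeanFree.coef_zero {f : L2 L₁ L₂} (h : MeanFree f) : fourierCoef f 0 = 0 := by
  have h' : average f = 0 := h
  rw [fourierCoef_zero_freq, h', Complex.ofReal_zero]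

lemma meanFree_iff {f : L2 L₁ L₂} : MeanFree f ↔ fourierCoef f 0 = 0 := by
  rw [fourierCoef_zero_freq, Complex.ofReal_eq_zero]
  rfl

lemma gap_mul_norm_sq_le {f : L2 L₁ L₂} (hf : MeanFree f) (h : MemH1 f) :
    gap L₁ L₂ * ‖f‖ ^ 2 ≤ gradNorm f ^ 2 := by
  have h0 := area_pos (L₁ := L₁) (L₂ := L₂)
  have := hasSum_le (fun k => ?_) ((hasSum_normSq_fourierCoef f).mul_left (gap L₁ L₂))
    (hasSum_gradNorm h)
  · rw [mul_left_comm] at this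
    exact le_of_mul_le_mul_left this (inv_pos.mpr h0)
  · by_cases hk : k = 0
    · simp [hk, hf.coef_zero]
    · gcongr; exact gap_le_freqSq hk

lemma gap_mul_gradNorm_sq_le {f : L2 L₁ L₂} (h : MemH2 f) :
    gap L₁ L₂ * gradNorm f ^ 2 ≤ ‖lap f‖ ^ 2 := by
  have h0 := area_pos (L₁ := L₁) (L₂ := L₂)
  have := hasSum_le (fun k => ?_) ((hasSum_gradNorm h.memH1).mul_left (gap L₁ L₂))
    (hasSum_norm_lap h)
  · rw [mul_left_comm] at this
    exact le_of_mul_le_mul_left this (inv_pos.mpr h0)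
  · by_cases hk : k = 0
    · simp [hk, freqSq_zero]
    · rw [sq (freqSq L₁ L₂ k), ← mul_assoc]
      have := freqSq_nonneg (L₁ := L₁) (L₂ := L₂) k
      gcongr; exact gap_le_freqSq hk

/-! ### Measurability of `L²`-valued maps -/

/-- The inclusion of real into complex `L²` is isometric. -/
lemma isometry_compLp_ofReal :
    Isometry (fun f : L2 L₁ L₂ => Complex.ofRealCLM.compLpL 2 volume f) := by
  refine AddMonoidHomClass.isometry_of_norm
    (Complex.ofRealCLM.compLpL 2 (volume : Measure (Torus L₁ L₂))) fun f => ?_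
  rw [Lp.norm_def, Lp.norm_def]
  congr 1
  refine eLpNorm_congr_norm_ae ?_
  filter_upwards [Complex.ofRealCLM.coeFn_compLpL (p := 2)
    (μ := (volume : Measure (Torus L₁ L₂))) f] with x hx
  rw [hx]
  simp

/-- An `L²`-valued map is strongly measurable as soon as its Fourier coefficients are. -/
lemma aestronglyMeasurable_of_coef {α : Type*} [MeasurableSpace α] {μ : Measure α}
    {g : α → L2 L₁ L₂}
    (h : ∀ k, AEStronglyMeasurable (fun t => fourierCoef (g t) k) μ) :
    AEStronglyMeasurable g μ := by
  rw [← isometry_compLp_ofReal.isEmbedding.aestronglyMeasurable_comp_iff]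
  refine aestronglyMeasurable_of_tendsto_ae atTop
    (f := fun (s : Finset (ℤ × ℤ)) t => ∑ k ∈ s,
      (((√(L₁ * L₂) : ℝ) : ℂ) * fourierCoef (g t) k) • expBasis L₁ L₂ k) (fun s => ?_)
    (Eventually.of_forall fun t => ?_)
  · exact Finset.aestronglyMeasurable_fun_sum _ fun k _ =>
      ((h k).const_mul _).smul aestronglyMeasurable_const
  · have := (expBasis L₁ L₂).hasSum_repr (Complex.ofRealCLM.compLpL 2 volume (g t))
    simp only [expBasis_repr] at this
    have hc : ∀ k, cCoef (Complex.ofRealCLM.compLpL 2 volume (g t)) k = fourierCoef (g t) k := by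
      intro k
      rw [fourierCoef_eq_cCoef]
      exact cCoef_congr_ae (Complex.ofRealCLM.coeFn_compLpL (p := 2)
        (μ := (volume : Measure (Torus L₁ L₂))) (g t)) k
    simp only [hc] at this
    exact this

/-! ### Lattice sums -/

/-- Cauchy–Schwarz for infinite sums. -/
lemma sq_tsum_mul_le {ι : Type*} {u v : ι → ℝ} (hu0 : ∀ i, 0 ≤ u i)
    (hv0 : ∀ i, 0 ≤ v i) (hu : Summable fun i => u i ^ 2) (hv : Summable fun i => v i ^ 2) :
    Summable (fun i => u i * v i) ∧
      (∑' i, u i * v i) ^ 2 ≤ (∑' i, u i ^ 2) * ∑' i, v i ^ 2 := by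
  have hs : Summable (fun i => u i * v i) :=
    (hu.add hv).of_nonneg_of_le (fun i => mul_nonneg (hu0 i) (hv0 i)) fun i => by
      nlinarith [sq_nonneg (u i - v i), sq_nonneg (u i), sq_nonneg (v i)]
  refine ⟨hs, le_of_tendsto' (hs.hasSum.pow 2) fun s => ?_⟩
  refine (Finset.sum_mul_sq_le_sq_mul_sq s u v).trans ?_
  exact mul_le_mul (hu.sum_le_tsum s fun i _ => sq_nonneg (u i))
    (hv.sum_le_tsum s fun i _ => sq_nonneg (v i)) (Finset.sum_nonneg fun i _ => sq_nonneg (v i))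
    (tsum_nonneg fun i => sq_nonneg (u i))

/-- The sum over `n ≥ 1` is bounded by a telescoping sum. -/
lemma sum_range_inv_sq_add_sq_le {δ R : ℝ} (hδ : 0 < δ) (hR : 0 < R) (N : ℕ) :
    ∑ n ∈ Finset.range N, (R ^ 2 + (δ * (n + 1)) ^ 2)⁻¹ ≤ 2 / δ / R := by
  have h1 : ∀ n : ℕ, (R ^ 2 + (δ * (n + 1)) ^ 2)⁻¹ ≤
      2 / δ * ((R + δ * n)⁻¹ - (R + δ * ((n + 1 : ℕ) : ℝ))⁻¹) := by
    intro n
    have hn : (0 : ℝ) ≤ n := n.cast_nonneg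
    have ha : 0 < R + δ * n := by positivity
    have hb : 0 < R + δ * (n + 1) := by positivity
    have hid : 2 / δ * ((R + δ * n)⁻¹ - (R + δ * ((n + 1 : ℕ) : ℝ))⁻¹)
        = 2 / ((R + δ * n) * (R + δ * (n + 1))) := by
      push_cast
      field_simp
      ring
    rw [hid, ← one_div, div_le_div_iff₀ (by positivity) (by positivity)]
    nlinarith [sq_nonneg (R - δ * (n + 1)), mul_pos hδ ha, mul_nonneg hδ.le hb.le]
  calc _ ≤ ∑ n ∈ Finset.range N, 2 / δ * ((R + δ * n)⁻¹ - (R + δ * ((n + 1 : ℕ) : ℝ))⁻¹) :=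
        Finset.sum_le_sum fun n _ => h1 n
    _ = 2 / δ * ((R + δ * ((0 : ℕ) : ℝ))⁻¹ - (R + δ * N)⁻¹) := by
        rw [← Finset.mul_sum, Finset.sum_range_sub' (fun n : ℕ => (R + δ * (n : ℝ))⁻¹)]
    _ ≤ 2 / δ / R := by
        rw [div_eq_mul_inv (2 / δ) R]
        have : 0 ≤ (R + δ * N)⁻¹ := by positivity
        gcongr
        simpa using this

/-- Summation over `ℤ` of an even function from a bound for the sums over `n ≥ 1`. -/
lemma summable_int_of_even {g : ℤ → ℝ} {b : ℝ} (hg0 : ∀ n, 0 ≤ g n) (heven : ∀ n, g (-n) = g n)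
    (hb : ∀ N : ℕ, ∑ n ∈ Finset.range N, g ((n : ℤ) + 1) ≤ b) :
    Summable g ∧ ∑' n, g n ≤ g 0 + 2 * b := by
  have hs : Summable (fun n : ℕ => g ((n : ℤ) + 1)) := summable_of_sum_range_le (fun n => hg0 _) hb
  have ht : ∑' n : ℕ, g ((n : ℤ) + 1) ≤ b := Real.tsum_le_of_sum_range_le (fun n => hg0 _) hb
  have hs1 : Summable (fun n : ℕ => g n) := by
    rw [← summable_nat_add_iff 1]
    exact hs.congr fun n => by rw [Nat.cast_add, Nat.cast_one]
  have hs2 : Summable (fun n : ℕ => g (-((n : ℤ) + 1))) := by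
    simpa only [heven] using hs
  refine ⟨Summable.of_nat_of_neg_add_one hs1 hs2, ?_⟩
  rw [tsum_of_nat_of_neg_add_one hs1 hs2, hs1.tsum_eq_zero_add]
  simp only [heven, Nat.cast_add, Nat.cast_one, Nat.cast_zero]
  linarith

lemma summable_inv_sq_add_sq {δ R : ℝ} (hδ : 0 < δ) (hR : 1 ≤ R) :
    Summable (fun n : ℤ => (R ^ 2 + (δ * n) ^ 2)⁻¹) ∧
      ∑' n : ℤ, (R ^ 2 + (δ * n) ^ 2)⁻¹ ≤ (1 + 4 / δ) / R := by
  have hR0 : 0 < R := by linarith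
  obtain ⟨h1, h2⟩ := summable_int_of_even (g := fun n : ℤ => (R ^ 2 + (δ * n) ^ 2)⁻¹)
    (b := 2 / δ / R) (fun n => by positivity)
    (fun n => by rw [Int.cast_neg, mul_neg, neg_sq])
    (fun N => by
      refine le_of_eq_of_le (Finset.sum_congr rfl fun n _ => ?_)
        (sum_range_inv_sq_add_sq_le hδ hR0 N)
      rw [Int.cast_add, Int.cast_natCast, Int.cast_one])
  refine ⟨h1, h2.trans ?_⟩
  have e3 : (R ^ 2 + (δ * ((0 : ℤ) : ℝ)) ^ 2)⁻¹ ≤ 1 / R := by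
    rw [← one_div]
    refine one_div_le_one_div_of_le hR0 ?_
    simp only [Int.cast_zero, mul_zero]
    nlinarith
  calc _ ≤ 1 / R + 2 * (2 / δ / R) := by linarith
    _ = _ := by ring

variable (L₁ L₂) in
/-- The constant in the bound for the lattice sum `∑ (R² + |k̃|²)⁻²`. -/
def latticeConst : ℝ := (1 + 4 / (2 * Real.pi / L₁)) * (1 + 4 / (2 * Real.pi / L₂))

lemma latticeConst_pos : 0 < latticeConst L₁ L₂ := by
  have := hL₁.out
  have := hL₂.out
  unfold latticeConst; positivity

/-- The scaling in `R` of this lattice sum is what makes the Sobolev estimates of this file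
sharp enough for the sextic growth bound. -/
lemma summable_inv_weight_sq {R : ℝ} (hR : 1 ≤ R) :
    Summable (fun k => ((R ^ 2 + freqSq L₁ L₂ k)⁻¹) ^ 2) ∧
      ∑' k, ((R ^ 2 + freqSq L₁ L₂ k)⁻¹) ^ 2 ≤ latticeConst L₁ L₂ / R ^ 2 := by
  have h1 := hL₁.out
  have h2 := hL₂.out
  obtain ⟨s1, t1⟩ := summable_inv_sq_add_sq (δ := 2 * Real.pi / L₁) (by positivity) hR
  obtain ⟨s2, t2⟩ := summable_inv_sq_add_sq (δ := 2 * Real.pi / L₂) (by positivity) hR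
  have sp := s1.mul_of_nonneg s2 (fun n => by positivity) (fun n => by positivity)
  have hle : ∀ k : ℤ × ℤ, ((R ^ 2 + freqSq L₁ L₂ k)⁻¹) ^ 2 ≤
      (R ^ 2 + (2 * Real.pi / L₁ * k.1) ^ 2)⁻¹ * (R ^ 2 + (2 * Real.pi / L₂ * k.2) ^ 2)⁻¹ := by
    intro k
    have e : freqSq L₁ L₂ k = (2 * Real.pi / L₁ * k.1) ^ 2 + (2 * Real.pi / L₂ * k.2) ^ 2 := by
      simp only [freqSq, freq]; ring
    rw [e, sq ((_ : ℝ)⁻¹)]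
    gcongr
    · have := sq_nonneg (2 * Real.pi / L₂ * k.2); linarith
    · have := sq_nonneg (2 * Real.pi / L₁ * k.1); linarith
  have ss := sp.of_nonneg_of_le (fun k => by positivity) hle
  refine ⟨ss, (ss.tsum_le_tsum hle sp).trans ?_⟩
  rw [← s1.tsum_mul_tsum s2 sp]
  calc _ ≤ ((1 + 4 / (2 * Real.pi / L₁)) / R) * ((1 + 4 / (2 * Real.pi / L₂)) / R) := by
        gcongr
    _ = _ := by unfold latticeConst; ring

/-- Young's inequality `ℓ¹ * ℓ¹ ⊆ ℓ¹` for nonnegative families. -/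
lemma summable_convolution {p : ℤ × ℤ → ℝ} (hp0 : ∀ k, 0 ≤ p k) (hp : Summable p) :
    (∀ n, Summable fun m => p (n - m) * p m) ∧
      HasSum (fun n => ∑' m, p (n - m) * p m) ((∑' k, p k) ^ 2) := by
  let e : (ℤ × ℤ) × (ℤ × ℤ) ≃ (ℤ × ℤ) × (ℤ × ℤ) :=
    { toFun := fun x => (x.1 - x.2, x.2)
      invFun := fun x => (x.1 + x.2, x.2)
      left_inv := fun x => by simp
      right_inv := fun x => by simp }
  have h2 : Summable (fun x : (ℤ × ℤ) × (ℤ × ℤ) => p x.1 * p x.2) :=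
    hp.mul_of_nonneg hp hp0 hp0
  have h3 : HasSum (fun x : (ℤ × ℤ) × (ℤ × ℤ) => p (x.1 - x.2) * p x.2) ((∑' k, p k) ^ 2) := by
    rw [sq, hp.tsum_mul_tsum hp h2]
    exact e.hasSum_iff.mpr h2.hasSum
  have h4 : ∀ n, Summable fun m => p (n - m) * p m := fun n => h3.summable.prod_factor n
  exact ⟨h4, h3.prod_fiberwise fun n => (h4 n).hasSum⟩

/-! ### Squares of `H¹` functions -/

/-- A two-dimensional Ladyzhenskaya-type inequality with a free scale `R ≥ 1`: the square of an
`H¹` function is in `L²`.  It is obtained from the convolution formula for the Fourier coefficients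
by Cauchy–Schwarz with the weights `R² + |k̃|²`. -/
lemma sq_mem_L2 {R : ℝ} (hR : 1 ≤ R) {f : L2 L₁ L₂} (hf : MemH1 f) :
    ∃ h : L2 L₁ L₂, h =ᵐ[volume] (fun x => f x ^ 2) ∧
      ‖h‖ ≤ √(latticeConst L₁ L₂ / (L₁ * L₂)) / R * (R ^ 2 * ‖f‖ ^ 2 + gradNorm f ^ 2) := by
  have hA := area_pos (L₁ := L₁) (L₂ := L₂)
  have hR0 : 0 < R := by linarith
  set w : ℤ × ℤ → ℝ := fun k => R ^ 2 + freqSq L₁ L₂ k with hw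
  have hw0 : ∀ k, 0 < w k := fun k => by
    have := freqSq_nonneg (L₁ := L₁) (L₂ := L₂) k
    simp only [hw]; positivity
  set p : ℤ × ℤ → ℝ := fun k => w k * ‖fourierCoef f k‖ ^ 2 with hp
  have hp0 : ∀ k, 0 ≤ p k := fun k => mul_nonneg (hw0 k).le (by positivity)
  have hpS : HasSum p ((L₁ * L₂)⁻¹ * (R ^ 2 * ‖f‖ ^ 2 + gradNorm f ^ 2)) := by
    convert! ((hasSum_normSq_fourierCoef f).mul_left (R ^ 2)).add (hasSum_gradNorm hf) using 1
    · ext k; simp only [hp, hw]; ring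
    · ring
  obtain ⟨hc1, hc2⟩ := summable_convolution hp0 hpS.summable
  obtain ⟨hq1, hq2⟩ := summable_inv_weight_sq (L₁ := L₁) (L₂ := L₂) hR
  set Q : ℝ := ∑' k, ((R ^ 2 + freqSq L₁ L₂ k)⁻¹) ^ 2 with hQ
  have hfm := Lp.memLp f
  have hint : Integrable (fun x => f x ^ 2) := hfm.integrable_sq
  have hbound : ∀ n, ‖fourierCoef (fun x => f x ^ 2) n‖ ^ 2 ≤ Q * ∑' m, p (n - m) * p m := by
    intro n
    have hs := hasSum_fourierCoef_mul hfm hfm n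
    have hsub : Summable (fun m => ((w (n - m))⁻¹) ^ 2) :=
      (Equiv.subLeft n).summable_iff.mpr hq1
    have hQn : ∑' m, ((w (n - m))⁻¹) ^ 2 = Q :=
      (Equiv.subLeft n).tsum_eq (fun k => ((w k)⁻¹) ^ 2)
    have hv : Summable (fun m => (√((w (n - m))⁻¹ * (w m)⁻¹)) ^ 2) ∧
        ∑' m, (√((w (n - m))⁻¹ * (w m)⁻¹)) ^ 2 ≤ Q := by
      have hle : ∀ m, (√((w (n - m))⁻¹ * (w m)⁻¹)) ^ 2 ≤
          1 / 2 * ((w (n - m))⁻¹) ^ 2 + 1 / 2 * ((w m)⁻¹) ^ 2 := fun m => by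
        have := hw0 (n - m)
        have := hw0 m
        rw [Real.sq_sqrt (by positivity)]
        nlinarith [sq_nonneg ((w (n - m))⁻¹ - (w m)⁻¹)]
      have hss := (hsub.mul_left (1 / 2)).add (hq1.mul_left (1 / 2))
      have hsum := hss.of_nonneg_of_le (fun m => by positivity) hle
      refine ⟨hsum, (hsum.tsum_le_tsum hle hss).trans (le_of_eq ?_)⟩
      rw [(hsub.mul_left (1 / 2)).tsum_add (hq1.mul_left (1 / 2)), tsum_mul_left, tsum_mul_left,
        hQn]
      ring
    have hu : ∀ m, (√(p (n - m) * p m)) ^ 2 = p (n - m) * p m := fun m =>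
      Real.sq_sqrt (mul_nonneg (hp0 _) (hp0 _))
    have hcs := sq_tsum_mul_le (u := fun m => √(p (n - m) * p m))
      (v := fun m => √((w (n - m))⁻¹ * (w m)⁻¹)) (fun _ => Real.sqrt_nonneg _)
      (fun _ => Real.sqrt_nonneg _) (by simpa only [hu] using hc1 n) hv.1
    have hterm : ∀ m, √(p (n - m) * p m) * √((w (n - m))⁻¹ * (w m)⁻¹)
        = ‖fourierCoef f (n - m) * fourierCoef f m‖ := by
      intro m
      have h1 := hw0 (n - m)
      have h2 := hw0 m
      rw [← Real.sqrt_mul (mul_nonneg (hp0 _) (hp0 _)), norm_mul]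
      refine (Real.sqrt_eq_iff_mul_self_eq ?_ (by positivity)).mpr ?_
      · exact mul_nonneg (mul_nonneg (hp0 _) (hp0 _)) (by positivity)
      · simp only [hp]
        field_simp
    have hn : ‖fourierCoef (fun x => f x ^ 2) n‖ ≤
        ∑' m, √(p (n - m) * p m) * √((w (n - m))⁻¹ * (w m)⁻¹) := by
      have e : (fun x => f x ^ 2) = fun x => f x * f x := by ext x; ring
      rw [e, ← hs.tsum_eq]
      simp only [hterm]
      refine norm_tsum_le_tsum_norm ?_
      have := hcs.1
      simpa only [hterm] using this
    calc _ ≤ (∑' m, √(p (n - m) * p m) * √((w (n - m))⁻¹ * (w m)⁻¹)) ^ 2 := by gcongr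
      _ ≤ _ := hcs.2
      _ ≤ (∑' m, p (n - m) * p m) * Q := by
          simp only [hu]
          gcongr
          · exact tsum_nonneg fun m => mul_nonneg (hp0 _) (hp0 _)
          · exact hv.2
      _ = _ := mul_comm _ _
  have hS := (hc2.mul_left Q)
  have hsum : Summable (fun n => ‖fourierCoef (fun x => f x ^ 2) n‖ ^ 2) :=
    hS.summable.of_nonneg_of_le (fun _ => by positivity) hbound
  obtain ⟨h, hh⟩ := exists_coef_eq (L₁ := L₁) (L₂ := L₂) hsum fun k => fourierCoef_neg_freq _ k
  refine ⟨h, ae_eq_of_coef_eq ((Lp.memLp h).integrable one_le_two) hint hh, ?_⟩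
  have hG : 0 ≤ R ^ 2 * ‖f‖ ^ 2 + gradNorm f ^ 2 := by positivity
  have hlc := latticeConst_pos (L₁ := L₁) (L₂ := L₂)
  refine le_of_sq_le_sq ?_ (by positivity)
  rw [tsum_normSq_fourierCoef, mul_pow, div_pow, Real.sq_sqrt (by positivity)]
  simp only [hh]
  calc _ ≤ L₁ * L₂ * (Q * (∑' k, p k) ^ 2) := by
        gcongr
        exact (hsum.tsum_le_tsum hbound hS.summable).trans hS.tsum_eq.le
    _ ≤ L₁ * L₂ * (latticeConst L₁ L₂ / R ^ 2 * (∑' k, p k) ^ 2) := by gcongr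
    _ = _ := by
        rw [hpS.tsum_eq]
        field_simp

lemma memH1_D₁ {f : L2 L₁ L₂} (h : MemH2 f) :
    MemH1 (D₁ f) ∧ gradNorm (D₁ f) ≤ ‖lap f‖ := by
  have hA := area_pos (L₁ := L₁) (L₂ := L₂)
  have hle : ∀ k, freqSq L₁ L₂ k * ‖fourierCoef (D₁ f) k‖ ^ 2 ≤
      freqSq L₁ L₂ k ^ 2 * ‖fourierCoef f k‖ ^ 2 := fun k => by
    rw [coef_D₁ h.memH1, norm_mul, mul_pow, ← mul_assoc, sq (freqSq L₁ L₂ k)]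
    have := freqSq_nonneg (L₁ := L₁) (L₂ := L₂) k
    gcongr
    exact normSq_symD₁_le k
  have h1 : MemH1 (D₁ f) := memH1_iff.mpr ((memH2_iff.mp h).of_nonneg_of_le
    (fun k => mul_nonneg (freqSq_nonneg k) (by positivity)) hle)
  refine ⟨h1, le_of_sq_le_sq ?_ (norm_nonneg _)⟩
  exact le_of_mul_le_mul_left (hasSum_le hle (hasSum_gradNorm h1) (hasSum_norm_lap h))
    (inv_pos.mpr hA)

lemma memH1_D₂ {f : L2 L₁ L₂} (h : MemH2 f) :
    MemH1 (D₂ f) ∧ gradNorm (D₂ f) ≤ ‖lap f‖ := by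
  have hA := area_pos (L₁ := L₁) (L₂ := L₂)
  have hle : ∀ k, freqSq L₁ L₂ k * ‖fourierCoef (D₂ f) k‖ ^ 2 ≤
      freqSq L₁ L₂ k ^ 2 * ‖fourierCoef f k‖ ^ 2 := fun k => by
    rw [coef_D₂ h.memH1, norm_mul, mul_pow, ← mul_assoc, sq (freqSq L₁ L₂ k)]
    have := freqSq_nonneg (L₁ := L₁) (L₂ := L₂) k
    gcongr
    exact normSq_symD₂_le k
  have h1 : MemH1 (D₂ f) := memH1_iff.mpr ((memH2_iff.mp h).of_nonneg_of_le
    (fun k => mul_nonneg (freqSq_nonneg k) (by positivity)) hle)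
  refine ⟨h1, le_of_sq_le_sq ?_ (norm_nonneg _)⟩
  exact le_of_mul_le_mul_left (hasSum_le hle (hasSum_gradNorm h1) (hasSum_norm_lap h))
    (inv_pos.mpr hA)

variable (L₁ L₂) in
/-- The constant in the `L²` bound of `|∇ψ|²`. -/
def ladyConst : ℝ := √(latticeConst L₁ L₂ / (L₁ * L₂))

lemma gradSq_mem_L2 {R : ℝ} (hR : 1 ≤ R) {f : L2 L₁ L₂} (hf : MemH2 f) :
    ∃ h : L2 L₁ L₂, h =ᵐ[volume] gradSq f ∧
      ‖h‖ ≤ ladyConst L₁ L₂ / R * (R ^ 2 * gradNorm f ^ 2 + 2 * ‖lap f‖ ^ 2) := by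
  have hR0 : 0 < R := by linarith
  obtain ⟨h1, e1, b1⟩ := sq_mem_L2 hR (memH1_D₁ hf).1
  obtain ⟨h2, e2, b2⟩ := sq_mem_L2 hR (memH1_D₂ hf).1
  refine ⟨h1 + h2, ?_, (norm_add_le _ _).trans ((add_le_add b1 b2).trans ?_)⟩
  · filter_upwards [Lp.coeFn_add h1 h2, e1, e2] with x hx hx1 hx2
    rw [hx, Pi.add_apply, hx1, hx2, gradSq]
  · rw [← mul_add]
    unfold ladyConst
    have hK : 0 ≤ √(latticeConst L₁ L₂ / (L₁ * L₂)) / R := by positivity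
    refine mul_le_mul_of_nonneg_left ?_ hK
    rw [gradNorm_sq f]
    have g1 := pow_le_pow_left₀ (gradNorm_nonneg _) (memH1_D₁ hf).2 2
    have g2 := pow_le_pow_left₀ (gradNorm_nonneg _) (memH1_D₂ hf).2 2
    linarith

/-! ### The estimates of the operator `N` -/

lemma abs_average_le (h : L2 L₁ L₂) : |average h| * √(L₁ * L₂) ≤ ‖h‖ := by
  have hA := area_pos (L₁ := L₁) (L₂ := L₂)
  have h1 := (hasSum_normSq_fourierCoef h).summable.le_tsum 0 (fun j _ => by positivity)
  rw [(hasSum_normSq_fourierCoef h).tsum_eq, fourierCoef_zero_freq, Complex.norm_real,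
    Real.norm_eq_abs] at h1
  refine le_of_sq_le_sq ?_ (norm_nonneg _)
  rw [mul_pow, Real.sq_sqrt hA.le]
  calc _ ≤ (L₁ * L₂)⁻¹ * ‖h‖ ^ 2 * (L₁ * L₂) := by gcongr
    _ = _ := by rw [mul_comm, mul_inv_cancel_left₀ hA.ne']

lemma average_congr_ae {f g : Torus L₁ L₂ → ℝ} (h : f =ᵐ[volume] g) : average f = average g := by
  unfold average
  rw [integral_congr_ae h]

/-- `N(ψ)` as an element of `L²`, in terms of `h = |∇ψ|² ∈ L²`. -/
lemma opN_ae_eq {ψ h : L2 L₁ L₂} (he : h =ᵐ[volume] gradSq ψ) :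
    ((1 / 2 : ℝ) • h - Lp.const 2 volume (average h / 2) + lap ψ : L2 L₁ L₂)
      =ᵐ[volume] opN ψ := by
  filter_upwards [he, Lp.coeFn_add ((1 / 2 : ℝ) • h - Lp.const 2 volume (average h / 2)) (lap ψ),
    Lp.coeFn_sub ((1 / 2 : ℝ) • h) (Lp.const 2 volume (average h / 2)),
    Lp.coeFn_smul (1 / 2 : ℝ) h, Lp.coeFn_const 2 (volume : Measure (Torus L₁ L₂)) (average h / 2)]
    with x h1 h2 h3 h4 h5
  rw [h2, Pi.add_apply, h3, Pi.sub_apply, h4, Pi.smul_apply, h5, h1, opN,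
    average_congr_ae he]
  simp
  ring

lemma norm_opN_le {ψ h : L2 L₁ L₂} :
    ‖((1 / 2 : ℝ) • h - Lp.const 2 volume (average h / 2) + lap ψ : L2 L₁ L₂)‖
      ≤ ‖h‖ + ‖lap ψ‖ := by
  have h1 := abs_average_le h
  have h2 : ‖(Lp.const 2 volume (average h / 2) : L2 L₁ L₂)‖ ≤ 1 / 2 * ‖h‖ := by
    have h3 := Lp.norm_const' (μ := (volume : Measure (Torus L₁ L₂))) (p := 2)
      (c := average h / 2) (by simp) (by simp)
    refine h3.le.trans ?_
    rw [measureReal_univ_torus]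
    simp only [ENNReal.toReal_ofNat, Real.norm_eq_abs, abs_div, abs_two, ← Real.sqrt_eq_rpow]
    linarith
  have h3 : ‖((1 / 2 : ℝ) • h : L2 L₁ L₂)‖ = 1 / 2 * ‖h‖ := by
    rw [norm_smul]; norm_num
  have h4 := norm_add_le ((1 / 2 : ℝ) • h - Lp.const 2 volume (average h / 2)) (lap ψ)
  have h5 := norm_sub_le ((1 / 2 : ℝ) • h) (Lp.const 2 volume (average h / 2) : L2 L₁ L₂)
  linarith

lemma inner_const_eq_zero {ψ : L2 L₁ L₂} (hψ : MeanFree ψ) (a : ℝ) :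
    inner ℝ ψ (Lp.const 2 volume a : L2 L₁ L₂) = 0 := by
  rw [inner_eq_integral]
  have : ∫ x, ψ x * (Lp.const 2 volume a : L2 L₁ L₂) x = ∫ x, ψ x * a := by
    refine integral_congr_ae ?_
    filter_upwards [Lp.coeFn_const 2 (volume : Measure (Torus L₁ L₂)) a] with x hx
    rw [hx]; rfl
  rw [this, integral_mul_const]
  have h' : (L₁ * L₂)⁻¹ * ∫ x, ψ x = 0 := hψ
  rcases mul_eq_zero.mp h' with h | h
  · exact absurd h (inv_ne_zero area_pos.ne')
  · rw [h, zero_mul]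

variable (L₁ L₂) in
/-- An admissible constant in the estimates of `N`. -/
def nConst : ℝ := 2 + ladyConst L₁ L₂ ^ 2 + 64 * ladyConst L₁ L₂ ^ 4 +
  ladyConst L₁ L₂ * ((gap L₁ L₂)⁻¹ + 2)

lemma ladyConst_nonneg : 0 ≤ ladyConst L₁ L₂ := Real.sqrt_nonneg _

lemma nConst_pos : 0 < nConst L₁ L₂ := by
  have := ladyConst_nonneg (L₁ := L₁) (L₂ := L₂)
  have := gap_pos (L₁ := L₁) (L₂ := L₂)
  unfold nConst; positivity

/-- The scale `R = 1 + 8 K Y` makes the coefficient of `X²` in the trilinear term small. -/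
lemma trilinear_numeric {K X Y G H R : ℝ} (hK : 0 ≤ K) (hY : 0 ≤ Y)
    (hG : G ≤ Y * X) (hR : R = 1 + 8 * K * Y)
    (hH : H ≤ K / R * (R ^ 2 * G + 2 * X ^ 2)) :
    1 / 2 * (Y * H) + Y * X ≤ X ^ 2 / 2 + (2 + K ^ 2 + 64 * K ^ 4) * Y ^ 2
      + (2 + K ^ 2 + 64 * K ^ 4) * Y ^ 6 := by
  have hKY : 0 ≤ K * Y := mul_nonneg hK hY
  have hR1 : 1 ≤ R := by rw [hR]; linarith
  have hR0 : 0 < R := by linarith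
  have h1 : K / R * (R ^ 2 * G + 2 * X ^ 2) ≤ K * R * (Y * X) + K / R * (2 * X ^ 2) := by
    have e : K / R * (R ^ 2 * G + 2 * X ^ 2) = K * R * G + K / R * (2 * X ^ 2) := by
      field_simp
    rw [e]
    gcongr
  have h2 : Y * (K / R) ≤ 1 / 8 := by
    rw [← mul_div_assoc, div_le_iff₀ hR0, hR]; nlinarith
  have h3 : 1 / 2 * (Y * H) ≤ 1 / 2 * (K * R * Y ^ 2) * X + 1 / 8 * X ^ 2 := by
    have := mul_le_mul_of_nonneg_left (hH.trans h1) hY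
    have h4 := mul_le_mul_of_nonneg_right h2 (sq_nonneg X)
    nlinarith
  have h5 : 1 / 2 * (K * R * Y ^ 2) * X ≤ 1 / 8 * X ^ 2 + 1 / 2 * (K * R * Y ^ 2) ^ 2 := by
    nlinarith [sq_nonneg (1 / 2 * X - K * R * Y ^ 2)]
  have h6 : Y * X ≤ 1 / 8 * X ^ 2 + 2 * Y ^ 2 := by nlinarith [sq_nonneg (1 / 2 * X - 2 * Y)]
  have h7 : (K * R * Y ^ 2) ^ 2 ≤ 2 * K ^ 2 * Y ^ 4 + 128 * K ^ 4 * Y ^ 6 := by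
    have : R ^ 2 ≤ 2 + 128 * (K * Y) ^ 2 := by rw [hR]; nlinarith [sq_nonneg (1 - 8 * K * Y)]
    calc (K * R * Y ^ 2) ^ 2 = K ^ 2 * Y ^ 4 * R ^ 2 := by ring
      _ ≤ K ^ 2 * Y ^ 4 * (2 + 128 * (K * Y) ^ 2) := by gcongr
      _ = _ := by ring
  have h8 : Y ^ 4 ≤ Y ^ 2 + Y ^ 6 := by
    have : 0 ≤ Y ^ 2 * ((Y ^ 2 - 1) ^ 2 + Y ^ 2) := by positivity
    nlinarith
  have h9 := mul_le_mul_of_nonneg_left h8 (sq_nonneg K)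
  have h10 : 0 ≤ K ^ 4 * Y ^ 2 := by positivity
  have h11 : 0 ≤ Y ^ 6 := by positivity
  nlinarith

theorem nEstimates_nConst : NEstimates L₁ L₂ (nConst L₁ L₂) := by
  intro ψ hmean hψ
  have hK := ladyConst_nonneg (L₁ := L₁) (L₂ := L₂)
  have hgap := gap_pos (L₁ := L₁) (L₂ := L₂)
  have hY := norm_nonneg ψ
  have hX := norm_nonneg (lap ψ)
  obtain ⟨h, he, hb⟩ := gradSq_mem_L2 (R := 1 + 8 * ladyConst L₁ L₂ * ‖ψ‖)
    (by have := mul_nonneg hK hY; linarith) hψ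
  obtain ⟨h', he', hb'⟩ := gradSq_mem_L2 (R := 1) le_rfl hψ
  obtain rfl : h = h' := Lp.ext (he.trans he'.symm)
  have hN := opN_ae_eq he
  set N : L2 L₁ L₂ := (1 / 2 : ℝ) • h - Lp.const 2 volume (average h / 2) + lap ψ with hNdef
  have hNm : MemLp (opN ψ) 2 volume := (memLp_congr_ae hN).mp (Lp.memLp N)
  refine ⟨hNm, ?_, ?_⟩
  · have e1 : ∫ x, ψ x * opN ψ x = inner ℝ ψ N := by
      rw [inner_eq_integral]
      refine integral_congr_ae ?_
      filter_upwards [hN] with x hx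
      rw [hx]
    rw [e1, hNdef, inner_add_right, inner_sub_right, inner_smul_right,
      inner_const_eq_zero hmean, sub_zero]
    have i1 := abs_real_inner_le_norm ψ h
    have i2 := abs_real_inner_le_norm ψ (lap ψ)
    have i3 : |1 / 2 * inner ℝ ψ h + inner ℝ ψ (lap ψ)| ≤ 1 / 2 * (‖ψ‖ * ‖h‖) + ‖ψ‖ * ‖lap ψ‖ := by
      refine (abs_add_le _ _).trans (add_le_add ?_ i2)
      rw [abs_mul, abs_of_pos (by norm_num : (0 : ℝ) < 1 / 2)]
      linarith
    refine i3.trans ((trilinear_numeric hK hY (gradNorm_sq_le hψ) rfl hb).trans ?_)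
    have : 2 + ladyConst L₁ L₂ ^ 2 + 64 * ladyConst L₁ L₂ ^ 4 ≤ nConst L₁ L₂ := by
      unfold nConst
      have : 0 ≤ ladyConst L₁ L₂ * ((gap L₁ L₂)⁻¹ + 2) := by positivity
      linarith
    gcongr
  · have e2 : (eLpNorm (opN ψ) 2 volume).toReal = ‖N‖ := by
      rw [Lp.norm_def, eLpNorm_congr_ae hN]
    rw [e2]
    refine norm_opN_le.trans ?_
    have hg := gap_mul_gradNorm_sq_le hψ
    have hg' : gradNorm ψ ^ 2 ≤ (gap L₁ L₂)⁻¹ * ‖lap ψ‖ ^ 2 := by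
      rw [inv_mul_eq_div, le_div_iff₀ hgap]; linarith
    have b2 : ‖h‖ ≤ ladyConst L₁ L₂ * ((gap L₁ L₂)⁻¹ + 2) * ‖lap ψ‖ ^ 2 := by
      refine hb'.trans ?_
      rw [div_one, mul_assoc]
      gcongr
      nlinarith
    have c1 : ladyConst L₁ L₂ * ((gap L₁ L₂)⁻¹ + 2) ≤ nConst L₁ L₂ := by
      unfold nConst
      have : 0 ≤ ladyConst L₁ L₂ ^ 2 + 64 * ladyConst L₁ L₂ ^ 4 := by positivity
      linarith
    have c2 : 1 ≤ nConst L₁ L₂ := by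
      unfold nConst
      have : 0 ≤ ladyConst L₁ L₂ ^ 2 + 64 * ladyConst L₁ L₂ ^ 4
        + ladyConst L₁ L₂ * ((gap L₁ L₂)⁻¹ + 2) := by positivity
      linarith
    have c3 := mul_le_mul_of_nonneg_right c1 (sq_nonneg ‖lap ψ‖)
    have c4 := mul_le_mul_of_nonneg_right c2 hX
    linarith

/-! ### Products of absolutely continuous functions -/

/-- The product rule, in integrated form, for two primitives of integrable functions. -/
lemma mul_sub_mul_of_primitive {u w p q : ℝ → ℝ} {a b : ℝ} (hab : a ≤ b)
    (hp : IntervalIntegrable p volume a b) (hq : IntervalIntegrable q volume a b)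
    (hu : ∀ t ∈ Icc a b, u t = u a + ∫ τ in a..t, p τ)
    (hw : ∀ t ∈ Icc a b, w t = w a + ∫ τ in a..t, q τ) :
    u b * w b - u a * w a = ∫ τ in a..b, (p τ * w τ + u τ * q τ) := by
  have hconst : ∀ c : ℝ, AbsolutelyContinuousOnInterval (fun _ : ℝ => c) a b := fun c =>
    (LipschitzWith.const c).lipschitzOnWith.absolutelyContinuousOnInterval
  have hU := (hconst (u a)).add
    (hp.absolutelyContinuousOnInterval_intervalIntegral (c := a) left_mem_uIcc)
  have hW := (hconst (w a)).add
    (hq.absolutelyContinuousOnInterval_intervalIntegral (c := a) left_mem_uIcc)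
  have key := hU.integral_deriv_mul_eq_sub hW
  simp only [Pi.add_apply] at key
  rw [← hu b (right_mem_Icc.mpr hab), ← hw b (right_mem_Icc.mpr hab),
    intervalIntegral.integral_same, intervalIntegral.integral_same, add_zero, add_zero] at key
  rw [← key]
  refine intervalIntegral.integral_congr_ae ?_
  filter_upwards [hp.ae_hasDerivAt_integral, hq.ae_hasDerivAt_integral] with τ h1 h2 hτ
  have hτ' := uIoc_subset_uIcc hτ
  have hτI : τ ∈ Icc a b := by rwa [uIcc_of_le hab] at hτ'
  have d1 := ((h1 hτ' a left_mem_uIcc).const_add (u a)).deriv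
  have d2 := ((h2 hτ' a left_mem_uIcc).const_add (w a)).deriv
  have e1 : deriv ((fun _ : ℝ => u a) + fun x => ∫ v in a..x, p v) τ = p τ := d1
  have e2 : deriv ((fun _ : ℝ => w a) + fun x => ∫ v in a..x, q v) τ = q τ := d2
  rw [e1, e2, ← hu τ hτI, ← hw τ hτI]

lemma intervalIntegrable_re {p : ℝ → ℂ} {a b : ℝ} (hp : IntervalIntegrable p volume a b) :
    IntervalIntegrable (fun τ => (p τ).re) volume a b := ⟨hp.1.re, hp.2.re⟩

lemma intervalIntegrable_im {p : ℝ → ℂ} {a b : ℝ} (hp : IntervalIntegrable p volume a b) :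
    IntervalIntegrable (fun τ => (p τ).im) volume a b := ⟨hp.1.im, hp.2.im⟩

lemma re_intervalIntegral {p : ℝ → ℂ} {a b : ℝ} (hp : IntervalIntegrable p volume a b) :
    (∫ τ in a..b, p τ).re = ∫ τ in a..b, (p τ).re :=
  (Complex.reCLM.intervalIntegral_comp_comm hp).symm

lemma im_intervalIntegral {p : ℝ → ℂ} {a b : ℝ} (hp : IntervalIntegrable p volume a b) :
    (∫ τ in a..b, p τ).im = ∫ τ in a..b, (p τ).im :=
  (Complex.imCLM.intervalIntegral_comp_comm hp).symm

lemma IntervalIntegrable.mono_Icc {E : Type*} [NormedAddCommGroup E] {p : ℝ → E} {a b c d : ℝ}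
    (hp : IntervalIntegrable p volume a b) (hac : a ≤ c) (hcd : c ≤ d) (hdb : d ≤ b) :
    IntervalIntegrable p volume c d :=
  hp.mono_set (by
    rw [uIcc_of_le hcd, uIcc_of_le (hac.trans (hcd.trans hdb))]; exact Icc_subset_Icc hac hdb)

lemma continuousOn_of_primitive {c p : ℝ → ℂ} {a b : ℝ} (hab : a ≤ b)
    (hp : IntervalIntegrable p volume a b)
    (hc : ∀ t ∈ Icc a b, c t = c a + ∫ τ in a..t, p τ) : ContinuousOn c (Icc a b) := by
  have hp' : IntegrableOn p (uIcc a b) volume := by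
    rw [uIcc_of_le hab, integrableOn_Icc_iff_integrableOn_Ioc,
      ← intervalIntegrable_iff_integrableOn_Ioc_of_le hab]
    exact hp
  have h := intervalIntegral.continuousOn_primitive_interval hp'
  rw [uIcc_of_le hab] at h
  exact (continuousOn_const.add h).congr hc

lemma normSq_sub_normSq_of_primitive {c p : ℝ → ℂ} {a b : ℝ} (hab : a ≤ b)
    (hp : IntervalIntegrable p volume a b)
    (hc : ∀ t ∈ Icc a b, c t = c a + ∫ τ in a..t, p τ) :
    ‖c b‖ ^ 2 - ‖c a‖ ^ 2 = 2 * ∫ τ in a..b, (conj (c τ) * p τ).re := by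
  have hpt : ∀ t ∈ Icc a b, IntervalIntegrable p volume a t := fun t ht =>
    IntervalIntegrable.mono_Icc hp le_rfl ht.1 ht.2
  have hre : ∀ t ∈ Icc a b, (c t).re = (c a).re + ∫ τ in a..t, (p τ).re := fun t ht => by
    rw [hc t ht, Complex.add_re, re_intervalIntegral (hpt t ht)]
  have him : ∀ t ∈ Icc a b, (c t).im = (c a).im + ∫ τ in a..t, (p τ).im := fun t ht => by
    rw [hc t ht, Complex.add_im, im_intervalIntegral (hpt t ht)]
  have ire := intervalIntegrable_re hp
  have iim := intervalIntegrable_im hp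
  have h1 := mul_sub_mul_of_primitive (u := fun t => (c t).re) (w := fun t => (c t).re)
    hab ire ire hre hre
  have h2 := mul_sub_mul_of_primitive (u := fun t => (c t).im) (w := fun t => (c t).im)
    hab iim iim him him
  have hcc := continuousOn_of_primitive hab hp hc
  rw [← uIcc_of_le hab] at hcc
  have cre : ContinuousOn (fun t => (c t).re) (uIcc a b) :=
    Complex.continuous_re.comp_continuousOn hcc
  have cim : ContinuousOn (fun t => (c t).im) (uIcc a b) :=
    Complex.continuous_im.comp_continuousOn hcc
  have e : ∀ z : ℂ, ‖z‖ ^ 2 = z.re * z.re + z.im * z.im := fun z => by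
    rw [← Complex.normSq_eq_norm_sq, Complex.normSq_apply]
  rw [e, e]
  calc _ = ((c b).re * (c b).re - (c a).re * (c a).re)
        + ((c b).im * (c b).im - (c a).im * (c a).im) := by ring
    _ = ∫ τ in a..b, (((p τ).re * (c τ).re + (c τ).re * (p τ).re)
        + ((p τ).im * (c τ).im + (c τ).im * (p τ).im)) := by
        rw [h1, h2]
        exact (intervalIntegral.integral_add
          ((ire.mul_continuousOn cre).add (ire.continuousOn_mul cre))
          ((iim.mul_continuousOn cim).add (iim.continuousOn_mul cim))).symm
    _ = _ := by
        rw [← intervalIntegral.integral_const_mul]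
        refine intervalIntegral.integral_congr fun τ _ => ?_
        simp only [Complex.mul_re, Complex.conj_re, Complex.conj_im]
        ring

/-- Duhamel's formula for a scalar linear equation gives the equation in integrated form. -/
lemma eq_sub_integral_of_duhamel {c F : ℝ → ℂ} {lam s S : ℝ}
    (hF : IntervalIntegrable F volume s S)
    (hc : ∀ t ∈ Icc s S, c t = (Real.exp (-(t - s) * lam) : ℂ) * c s
      - ∫ τ in s..t, (Real.exp (-(t - τ) * lam) : ℂ) * F τ) :
    ∀ t ∈ Icc s S, c t = c s - ∫ τ in s..t, (lam * c τ + F τ) := by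
  intro t ht
  -- `h = exp (λ (t - s)) c` is a primitive of `-exp (λ (t - s)) F`
  set h : ℝ → ℂ := fun t => (Real.exp ((t - s) * lam) : ℂ) * c t with hh
  set E : ℝ → ℝ := fun t => Real.exp (-(t - s) * lam) with hE
  have hEE : ∀ t, (Real.exp ((t - s) * lam) : ℂ) * (E t : ℂ) = 1 := fun t => by
    have h0 : (t - s) * lam + -(t - s) * lam = 0 := by ring
    rw [hE, ← Complex.ofReal_mul, ← Real.exp_add, h0, Real.exp_zero, Complex.ofReal_one]
  have hce : ∀ t, c t = (E t : ℂ) * h t := fun t => by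
    rw [hh]
    simp only
    rw [← mul_assoc, mul_comm (E t : ℂ), hEE, one_mul]
  set P : ℝ → ℂ := fun τ => -((Real.exp ((τ - s) * lam) : ℂ) * F τ) with hP
  have hPi : IntervalIntegrable P volume s S :=
    (hF.continuousOn_mul (by fun_prop)).neg
  have hprim : ∀ t ∈ Icc s S, h t = h s + ∫ τ in s..t, P τ := by
    intro t ht
    have e : ∫ τ in s..t, (Real.exp (-(t - τ) * lam) : ℂ) * F τ
        = -((E t : ℂ) * ∫ τ in s..t, P τ) := by
      rw [← intervalIntegral.integral_const_mul, ← intervalIntegral.integral_neg]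
      refine intervalIntegral.integral_congr fun τ _ => ?_
      simp only [hP, hE]
      rw [mul_neg, neg_neg, ← mul_assoc, ← Complex.ofReal_mul, ← Real.exp_add]
      congr 3
      ring_nf
    have h1 := hc t ht
    rw [e] at h1
    simp only [hh, sub_self, zero_mul, Real.exp_zero, Complex.ofReal_one, one_mul]
    rw [h1, sub_neg_eq_add, ← mul_add, ← mul_assoc, hEE, one_mul]
  have hEprim : ∀ r ∈ Icc s t, E r = E s + ∫ τ in s..r, -lam * E τ := by
    intro r hr
    rw [intervalIntegral.integral_eq_sub_of_hasDerivAt (f := E) (f' := fun τ => -lam * E τ)]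
    · ring
    · intro x _
      have d : HasDerivAt (fun y : ℝ => -(y - s) * lam) (-lam) x := by
        simpa using! ((hasDerivAt_id x).sub_const s).neg.mul_const lam
      exact d.exp.congr_deriv (mul_comm _ _)
    · exact (by fun_prop : Continuous fun τ => -lam * E τ).intervalIntegrable _ _
  have hst := ht.1
  have hPt := IntervalIntegrable.mono_Icc hPi le_rfl ht.1 ht.2
  have hprimt : ∀ r ∈ Icc s t, h r = h s + ∫ τ in s..r, P τ := fun r hr =>
    hprim r ⟨hr.1, hr.2.trans ht.2⟩
  have hPr : ∀ r ∈ Icc s t, IntervalIntegrable P volume s r := fun r hr =>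
    IntervalIntegrable.mono_Icc hPt le_rfl hr.1 hr.2
  have hEi : IntervalIntegrable (fun τ => -lam * E τ) volume s t :=
    (by fun_prop : Continuous fun τ => -lam * E τ).intervalIntegrable _ _
  have h1 := mul_sub_mul_of_primitive (w := fun r => (h r).re) hst hEi
    (intervalIntegrable_re hPt) hEprim fun r hr => by
      rw [hprimt r hr, Complex.add_re, re_intervalIntegral (hPr r hr)]
  have h2 := mul_sub_mul_of_primitive (w := fun r => (h r).im) hst hEi
    (intervalIntegrable_im hPt) hEprim fun r hr => by
      rw [hprimt r hr, Complex.add_im, im_intervalIntegral (hPr r hr)]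
  have hcont := continuousOn_of_primitive hst hPt hprimt
  rw [← uIcc_of_le hst] at hcont
  have hcc : ContinuousOn c (uIcc s t) := by
    have : c = fun r => (E r : ℂ) * h r := funext hce
    rw [this]
    exact (by fun_prop : Continuous fun r => (E r : ℂ)).continuousOn.mul hcont
  have hFt := IntervalIntegrable.mono_Icc hF le_rfl ht.1 ht.2
  have hint : IntervalIntegrable (fun τ => lam * c τ + F τ) volume s t :=
    (hcc.intervalIntegrable.const_mul _).add hFt
  have hEP : ∀ τ, (E τ : ℂ) * P τ = -F τ := fun τ => by
    simp only [hP]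
    rw [mul_neg, ← mul_assoc, mul_comm (E τ : ℂ), hEE, one_mul]
  have hre : ∀ τ, -lam * E τ * (h τ).re + E τ * (P τ).re = -(lam * c τ + F τ).re := fun τ => by
    have a1 : (c τ).re = E τ * (h τ).re := by rw [hce, Complex.re_ofReal_mul]
    have a2 : E τ * (P τ).re = -(F τ).re := by
      rw [← Complex.re_ofReal_mul, hEP, Complex.neg_re]
    have a3 : (lam * c τ + F τ).re = lam * (c τ).re + (F τ).re := by
      rw [Complex.add_re, Complex.re_ofReal_mul]
    rw [a2, a3, a1]
    ring
  have him : ∀ τ, -lam * E τ * (h τ).im + E τ * (P τ).im = -(lam * c τ + F τ).im := fun τ => by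
    have a1 : (c τ).im = E τ * (h τ).im := by rw [hce, Complex.im_ofReal_mul]
    have a2 : E τ * (P τ).im = -(F τ).im := by
      rw [← Complex.im_ofReal_mul, hEP, Complex.neg_im]
    have a3 : (lam * c τ + F τ).im = lam * (c τ).im + (F τ).im := by
      rw [Complex.add_im, Complex.im_ofReal_mul]
    rw [a2, a3, a1]
    ring
  simp only [hre] at h1
  simp only [him] at h2
  rw [intervalIntegral.integral_neg, ← Complex.re_ofReal_mul, ← Complex.re_ofReal_mul, ← hce,
    ← hce] at h1
  rw [intervalIntegral.integral_neg, ← Complex.im_ofReal_mul, ← Complex.im_ofReal_mul, ← hce,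
    ← hce] at h2
  apply Complex.ext
  · rw [Complex.sub_re, re_intervalIntegral hint]; linarith
  · rw [Complex.sub_im, im_intervalIntegral hint]; linarith

/-! ### The equation mode by mode -/

/-- The curve `u` in `L²` solves `∂ₜ u + Δ² u + G = 0` on `[a, b]`, where `G` is given through its
Fourier coefficients `G k τ`; each mode satisfies the equation in integrated form. -/
def HasModes (u : ℝ → L2 L₁ L₂) (G : ℤ × ℤ → ℝ → ℂ) (a b : ℝ) : Prop :=
  ∀ k, IntervalIntegrable (G k) volume a b ∧ ∀ t ∈ Icc a b, fourierCoef (u t) k =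
    fourierCoef (u a) k - ∫ τ in a..t, (((freqSq L₁ L₂ k ^ 2 : ℝ) : ℂ) * fourierCoef (u τ) k
      + G k τ)

lemma continuousOn_coef {u : ℝ → L2 L₁ L₂} {s : Set ℝ} (hu : ContinuousOn u s) (k : ℤ × ℤ) :
    ContinuousOn (fun t => fourierCoef (u t) k) s :=
  (coefL k).continuous.comp_continuousOn hu

lemma intervalIntegrable_of_continuousOn_Icc {E : Type*} [NormedAddCommGroup E] {f : ℝ → E}
    {a b : ℝ} (hab : a ≤ b) (hf : ContinuousOn f (Icc a b)) : IntervalIntegrable f volume a b :=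
  ContinuousOn.intervalIntegrable (by rwa [uIcc_of_le hab])

lemma HasModes.intervalIntegrable {u : ℝ → L2 L₁ L₂} {G : ℤ × ℤ → ℝ → ℂ} {a b : ℝ}
    (h : HasModes u G a b) (hab : a ≤ b) (hu : ContinuousOn u (Icc a b)) (k : ℤ × ℤ) :
    IntervalIntegrable (fun τ => ((freqSq L₁ L₂ k ^ 2 : ℝ) : ℂ) * fourierCoef (u τ) k + G k τ)
      volume a b :=
  ((intervalIntegrable_of_continuousOn_Icc hab (continuousOn_coef hu k)).const_mul _).add (h k).1

lemma HasModes.mono {u : ℝ → L2 L₁ L₂} {G : ℤ × ℤ → ℝ → ℂ} {a b c d : ℝ}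
    (h : HasModes u G a b) (hu : ContinuousOn u (Icc a b)) (hac : a ≤ c) (hcd : c ≤ d)
    (hdb : d ≤ b) : HasModes u G c d := by
  intro k
  have hab := hac.trans (hcd.trans hdb)
  have hi := h.intervalIntegrable hab hu k
  refine ⟨IntervalIntegrable.mono_Icc (h k).1 hac hcd hdb, fun t ht => ?_⟩
  have h1 := (h k).2 t ⟨hac.trans ht.1, ht.2.trans hdb⟩
  have h2 := (h k).2 c ⟨hac, hcd.trans hdb⟩
  have h3 := intervalIntegral.integral_add_adjacent_intervals
    (IntervalIntegrable.mono_Icc hi le_rfl hac (hcd.trans hdb))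
    (IntervalIntegrable.mono_Icc hi hac ht.1 (ht.2.trans hdb))
  rw [h1, h2, ← h3]
  ring

lemma HasModes.congr {u : ℝ → L2 L₁ L₂} {G H : ℤ × ℤ → ℝ → ℂ} {a b : ℝ} (hab : a ≤ b)
    (h : HasModes u G a b) (hGH : ∀ k, ∀ᵐ τ, τ ∈ Ioc a b → G k τ = H k τ) : HasModes u H a b := by
  intro k
  refine ⟨(h k).1.congr_ae ?_, fun t ht => ?_⟩
  · rw [uIoc_of_le hab]; exact (ae_restrict_iff' measurableSet_Ioc).mpr (hGH k)
  · rw [(h k).2 t ht]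
    congr 1
    refine intervalIntegral.integral_congr_ae ?_
    filter_upwards [hGH k] with τ hτ hmem
    rw [uIoc_of_le ht.1] at hmem
    rw [hτ ⟨hmem.1, hmem.2.trans ht.2⟩]

lemma HasModes.sub {u w : ℝ → L2 L₁ L₂} {G H : ℤ × ℤ → ℝ → ℂ} {a b : ℝ} (hab : a ≤ b)
    (hu : ContinuousOn u (Icc a b)) (hw : ContinuousOn w (Icc a b))
    (h1 : HasModes u G a b) (h2 : HasModes w H a b) :
    HasModes (fun t => u t - w t) (fun k τ => G k τ - H k τ) a b := by
  intro k
  refine ⟨(h1 k).1.sub (h2 k).1, fun t ht => ?_⟩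
  have i1 := IntervalIntegrable.mono_Icc (h1.intervalIntegrable hab hu k) le_rfl ht.1 ht.2
  have i2 := IntervalIntegrable.mono_Icc (h2.intervalIntegrable hab hw k) le_rfl ht.1 ht.2
  have e : ∫ τ in a..t, (((freqSq L₁ L₂ k ^ 2 : ℝ) : ℂ) * fourierCoef (u τ - w τ : L2 L₁ L₂) k
      + (G k τ - H k τ)) = (∫ τ in a..t, (((freqSq L₁ L₂ k ^ 2 : ℝ) : ℂ) * fourierCoef (u τ) k
      + G k τ)) - ∫ τ in a..t, (((freqSq L₁ L₂ k ^ 2 : ℝ) : ℂ) * fourierCoef (w τ) k + H k τ) := by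
    rw [← intervalIntegral.integral_sub i1 i2]
    refine intervalIntegral.integral_congr fun τ _ => ?_
    simp only [coef_sub]
    ring
  rw [e, coef_sub, coef_sub, (h1 k).2 t ht, (h2 k).2 t ht]
  ring

/-- The energy balance of a single mode. -/
lemma HasModes.normSq_mode {u : ℝ → L2 L₁ L₂} {G : ℤ × ℤ → ℝ → ℂ} {a b : ℝ}
    (h : HasModes u G a b) (hab : a ≤ b) (hu : ContinuousOn u (Icc a b)) (k : ℤ × ℤ) :
    IntervalIntegrable (fun τ => freqSq L₁ L₂ k ^ 2 * ‖fourierCoef (u τ) k‖ ^ 2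
      + (conj (fourierCoef (u τ) k) * G k τ).re) volume a b ∧
    ‖fourierCoef (u b) k‖ ^ 2 - ‖fourierCoef (u a) k‖ ^ 2 =
      -2 * ∫ τ in a..b, (freqSq L₁ L₂ k ^ 2 * ‖fourierCoef (u τ) k‖ ^ 2
        + (conj (fourierCoef (u τ) k) * G k τ).re) := by
  have hi := h.intervalIntegrable hab hu k
  have e : ∀ τ, (conj (fourierCoef (u τ) k) * (((freqSq L₁ L₂ k ^ 2 : ℝ) : ℂ) * fourierCoef (u τ) k
      + G k τ)).re = freqSq L₁ L₂ k ^ 2 * ‖fourierCoef (u τ) k‖ ^ 2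
        + (conj (fourierCoef (u τ) k) * G k τ).re := fun τ => by
    rw [mul_add, Complex.add_re, mul_left_comm, Complex.re_ofReal_mul, re_conj_mul_self]
  constructor
  · simp only [← e]
    refine intervalIntegrable_re (hi.continuousOn_mul ?_)
    rw [uIcc_of_le hab]
    exact Complex.continuous_conj.comp_continuousOn (continuousOn_coef hu k)
  · have h1 := normSq_sub_normSq_of_primitive (c := fun τ => fourierCoef (u τ) k) hab hi.neg
      fun t ht => by
        rw [(h k).2 t ht, sub_eq_add_neg, ← intervalIntegral.integral_neg]
        rfl
    rw [h1]
    simp only [Pi.neg_apply, mul_neg, Complex.neg_re, e]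
    rw [intervalIntegral.integral_neg]
    ring

/-! ### Duhamel's formula -/

/-- The symbol of `exp (-t Λ)` for the operator `Λ` with real symbol `lam`. -/
def expSym (lam : ℤ × ℤ → ℝ) (t : ℝ) (k : ℤ × ℤ) : ℂ := (Real.exp (-t * lam k) : ℂ)

/-- For positive times the semigroup of a fourth-order operator maps all functions, and in
particular integrable ones, into `L²`. -/
lemma inDomain_expSym {lam : ℤ × ℤ → ℝ} (hneg : ∀ k, lam (-k) = lam k)
    (hlam : ∀ k, freqSq L₁ L₂ k ^ 2 / 2 - 1 / 2 ≤ lam k) {t : ℝ} (ht : 0 < t)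
    (f : Torus L₁ L₂ → ℝ) : InDomain (expSym lam t) f := by
  refine inDomain_of_summable (fun k => by simp only [expSym, hneg, Complex.conj_ofReal]) ?_
  set M : ℝ := (L₁ * L₂)⁻¹ * ∫ x, |f x| with hM
  have hs := (summable_inv_weight_sq (L₁ := L₁) (L₂ := L₂) (R := 1) le_rfl).1
  refine (hs.mul_left (M ^ 2 * (Real.exp t * (2 + 2 / t)))).of_nonneg_of_le
    (fun k => by positivity) fun k => ?_
  have hq := freqSq_nonneg (L₁ := L₁) (L₂ := L₂) k
  set q := freqSq L₁ L₂ k with hqdef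
  have h1 : ‖expSym lam t k‖ ^ 2 ≤ Real.exp t * Real.exp (-(t * q ^ 2)) := by
    rw [expSym, Complex.norm_real, Real.norm_eq_abs, abs_of_pos (Real.exp_pos _), sq,
      ← Real.exp_add, ← Real.exp_add]
    refine Real.exp_le_exp.mpr ?_
    have := mul_le_mul_of_nonneg_left (hlam k) ht.le
    nlinarith
  have h2 : Real.exp (-(t * q ^ 2)) ≤ (2 + 2 / t) * ((1 + q)⁻¹) ^ 2 := by
    rw [Real.exp_neg, inv_pow, ← div_eq_mul_inv, le_div_iff₀ (by positivity), inv_mul_eq_div,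
      div_le_iff₀ (Real.exp_pos _)]
    have h3 := Real.add_one_le_exp (t * q ^ 2)
    have h4 : (1 + q) ^ 2 ≤ (2 + 2 / t) * (t * q ^ 2 + 1) := by
      have e : (2 + 2 / t) * (t * q ^ 2 + 1) = 2 + 2 * q ^ 2 + (2 * t * q ^ 2 + 2 / t) := by
        field_simp; ring
      have : 0 ≤ 2 * t * q ^ 2 + 2 / t := by positivity
      rw [e]; nlinarith [sq_nonneg (q - 1)]
    exact h4.trans (mul_le_mul_of_nonneg_left h3 (by positivity))
  have h5 : ‖fourierCoef f k‖ ≤ M := norm_fourierCoef_le f k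
  rw [norm_mul, mul_pow]
  calc ‖expSym lam t k‖ ^ 2 * ‖fourierCoef f k‖ ^ 2
      ≤ (Real.exp t * ((2 + 2 / t) * ((1 + q)⁻¹) ^ 2)) * M ^ 2 := by
        gcongr
        exact h1.trans (mul_le_mul_of_nonneg_left h2 (Real.exp_pos _).le)
    _ = _ := by rw [one_pow]; ring

lemma inDomain_expSym_L2 {lam : ℤ × ℤ → ℝ} (hneg : ∀ k, lam (-k) = lam k)
    (hlam : ∀ k, freqSq L₁ L₂ k ^ 2 / 2 - 1 / 2 ≤ lam k) {t : ℝ} (ht : 0 ≤ t)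
    (f : L2 L₁ L₂) : InDomain (expSym lam t) f := by
  rcases ht.eq_or_lt with rfl | ht
  · exact ⟨f, fun k => by simp [expSym]⟩
  · exact inDomain_expSym hneg hlam ht f

/-- A mild solution, written with Duhamel's formula for `exp (-t Λ)`, solves the equation mode by
mode. -/
lemma hasModes_of_duhamel {lam : ℤ × ℤ → ℝ} (hneg : ∀ k, lam (-k) = lam k)
    (hlam : ∀ k, freqSq L₁ L₂ k ^ 2 / 2 - 1 / 2 ≤ lam k) {s S : ℝ} (hsS : s ≤ S)
    {u : ℝ → L2 L₁ L₂} {u₀ : L2 L₁ L₂} {F : ℝ → Torus L₁ L₂ → ℝ}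
    (hu : ContinuousOn u (Icc s S))
    (hint : ∀ t ∈ Icc s S, IntervalIntegrable
      (fun τ => multiplier (expSym lam (t - τ)) (F τ)) volume s t)
    (hd : ∀ t ∈ Icc s S, u t = multiplier (expSym lam (t - s)) u₀
      - ∫ τ in s..t, multiplier (expSym lam (t - τ)) (F τ)) :
    u s = u₀ ∧ HasModes u (fun k τ => fourierCoef (F τ) k
      + (((lam k - freqSq L₁ L₂ k ^ 2 : ℝ)) : ℂ) * fourierCoef (u τ) k) s S := by
  have hus : u s = u₀ := by
    refine eq_of_coef_eq fun k => ?_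
    rw [hd s ⟨le_rfl, hsS⟩, intervalIntegral.integral_same, sub_zero,
      coef_multiplier (inDomain_expSym_L2 hneg hlam (by simp) _)]
    simp [expSym]
  refine ⟨hus, fun k => ?_⟩
  have hcoefi : ∀ t ∈ Icc s S, IntervalIntegrable
      (fun τ => (Real.exp (-(t - τ) * lam k) : ℂ) * fourierCoef (F τ) k) volume s t := by
    intro t ht
    have h1 : IntervalIntegrable
        (fun τ => coefL k (multiplier (expSym lam (t - τ)) (F τ))) volume s t :=
      ⟨(coefL k).integrable_comp (hint t ht).1, (coefL k).integrable_comp (hint t ht).2⟩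
    rw [intervalIntegrable_iff_integrableOn_Ioo_of_le ht.1] at h1 ⊢
    refine h1.congr_fun (fun τ hτ => ?_) measurableSet_Ioo
    simp only [coefL_apply]
    rw [coef_multiplier (inDomain_expSym hneg hlam (sub_pos.mpr hτ.2) _)]
    rfl
  have hFi : IntervalIntegrable (fun τ => fourierCoef (F τ) k) volume s S := by
    have h1 := (hcoefi S ⟨hsS, le_rfl⟩).continuousOn_mul
      (g := fun τ => (Real.exp ((S - τ) * lam k) : ℂ)) (by fun_prop)
    refine h1.congr fun τ _ => ?_
    have h0 : (S - τ) * lam k + -(S - τ) * lam k = 0 := by ring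
    rw [← mul_assoc, ← Complex.ofReal_mul, ← Real.exp_add, h0, Real.exp_zero, Complex.ofReal_one,
      one_mul]
  have hduh : ∀ t ∈ Icc s S, fourierCoef (u t) k
      = (Real.exp (-(t - s) * lam k) : ℂ) * fourierCoef (u s) k
      - ∫ τ in s..t, (Real.exp (-(t - τ) * lam k) : ℂ) * fourierCoef (F τ) k := by
    intro t ht
    rw [hd t ht, coef_sub, coef_multiplier
      (inDomain_expSym_L2 hneg hlam (sub_nonneg.mpr ht.1) _), hus]
    congr 1
    rw [← coefL_apply, ← (coefL k).intervalIntegral_comp_comm (hint t ht)]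
    rw [intervalIntegral.integral_of_le ht.1, intervalIntegral.integral_of_le ht.1,
      integral_Ioc_eq_integral_Ioo, integral_Ioc_eq_integral_Ioo]
    refine setIntegral_congr_fun measurableSet_Ioo fun τ hτ => ?_
    simp only [coefL_apply]
    rw [coef_multiplier (inDomain_expSym hneg hlam (sub_pos.mpr hτ.2) _)]
    rfl
  have hcu := intervalIntegrable_of_continuousOn_Icc hsS (continuousOn_coef hu k)
  refine ⟨hFi.add (hcu.const_mul _), fun t ht => ?_⟩
  rw [eq_sub_integral_of_duhamel hFi hduh t ht]
  congr 1
  refine intervalIntegral.integral_congr fun τ _ => ?_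
  simp only
  push_cast
  ring

/-! ### Parabolic regularity and the energy identity -/

/-- Tonelli for a series of nonnegative functions with summable integrals. -/
lemma ae_summable_and_integrable_tsum {α ι : Type*} [Countable ι] [MeasurableSpace α]
    {μ : Measure α} {F : ι → α → ℝ} (h0 : ∀ i a, 0 ≤ F i a) (hF : ∀ i, Integrable (F i) μ)
    (hs : Summable fun i => ∫ a, F i a ∂μ) :
    (∀ᵐ a ∂μ, Summable fun i => F i a) ∧ Integrable (fun a => ∑' i, F i a) μ := by
  have hm : ∀ i, AEMeasurable (fun a => ENNReal.ofReal (F i a)) μ := fun i =>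
    (hF i).1.aemeasurable.ennreal_ofReal
  have hfin : ∫⁻ a, ∑' i, ENNReal.ofReal (F i a) ∂μ ≠ ⊤ := by
    rw [lintegral_tsum hm]
    have e : ∀ i, ∫⁻ a, ENNReal.ofReal (F i a) ∂μ = ENNReal.ofReal (∫ a, F i a ∂μ) := fun i =>
      (ofReal_integral_eq_lintegral_ofReal (hF i) (Eventually.of_forall (h0 i))).symm
    simp only [e]
    rw [← ENNReal.ofReal_tsum_of_nonneg (fun i => integral_nonneg (h0 i)) hs]
    exact ENNReal.ofReal_ne_top
  have hmt : AEMeasurable (fun a => ∑' i, ENNReal.ofReal (F i a)) μ := AEMeasurable.tsum hm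
  constructor
  · filter_upwards [ae_lt_top' hmt hfin] with a ha
    have := ENNReal.summable_toReal ha.ne
    simpa only [ENNReal.toReal_ofReal (h0 _ a)] using this
  · have h1 := integrable_toReal_of_lintegral_ne_top hmt hfin
    refine h1.congr (Eventually.of_forall fun a => ?_)
    simp only
    rw [ENNReal.tsum_toReal_eq (fun _ => ENNReal.ofReal_ne_top)]
    exact tsum_congr fun i => ENNReal.toReal_ofReal (h0 i a)

/-- Parabolic smoothing: if the forcing has bounded Fourier coefficients (as an `L¹` function
does), up to a second-order term, then the solution is in `L²` in time with values in `H²`. -/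
lemma HasModes.summable_H2 {u : ℝ → L2 L₁ L₂} {G : ℤ × ℤ → ℝ → ℂ} {a b M : ℝ}
    (h : HasModes u G a b) (hab : a ≤ b) (hu : ContinuousOn u (Icc a b))
    (hM : ∀ k, ∀ᵐ τ, τ ∈ Ioc a b → ‖G k τ‖ ≤ M + freqSq L₁ L₂ k * ‖fourierCoef (u τ) k‖) :
    Summable fun k => ∫ τ in a..b, freqSq L₁ L₂ k ^ 2 * ‖fourierCoef (u τ) k‖ ^ 2 := by
  have hgap := gap_pos (L₁ := L₁) (L₂ := L₂)
  have hcc : ∀ k, ContinuousOn (fun τ => ‖fourierCoef (u τ) k‖ ^ 2) (Icc a b) := fun k =>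
    (continuousOn_coef hu k).norm.pow 2
  have hci : ∀ k, IntervalIntegrable (fun τ => ‖fourierCoef (u τ) k‖ ^ 2) volume a b := fun k =>
    intervalIntegrable_of_continuousOn_Icc hab (hcc k)
  have hui : IntervalIntegrable (fun τ => (L₁ * L₂)⁻¹ * ‖u τ‖ ^ 2) volume a b :=
    intervalIntegrable_of_continuousOn_Icc hab (continuousOn_const.mul (hu.norm.pow 2))
  have hs1 : Summable fun k => ∫ τ in a..b, ‖fourierCoef (u τ) k‖ ^ 2 := by
    refine summable_of_sum_le (c := ∫ τ in a..b, (L₁ * L₂)⁻¹ * ‖u τ‖ ^ 2)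
      (fun k => intervalIntegral.integral_nonneg hab fun τ _ => by positivity) fun s => ?_
    rw [← intervalIntegral.integral_finsetSum fun k _ => hci k]
    refine intervalIntegral.integral_mono_on hab ?_ hui fun τ _ => ?_
    · have := IntervalIntegrable.sum s (f := fun k τ => ‖fourierCoef (u τ) k‖ ^ 2) (μ := volume)
        (a := a) (b := b) fun k _ => hci k
      convert! this using 1
      ext τ; simp
    · rw [← (hasSum_normSq_fourierCoef (u τ)).tsum_eq]
      exact (hasSum_normSq_fourierCoef (u τ)).summable.sum_le_tsum s fun k _ => by positivity
  have hs2 : Summable fun k => ‖fourierCoef (u a) k‖ ^ 2 :=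
    (hasSum_normSq_fourierCoef (u a)).summable
  have hs3 := (summable_inv_weight_sq (L₁ := L₁) (L₂ := L₂) (R := 1) le_rfl).1
  set κ : ℝ := (1 + (gap L₁ L₂)⁻¹) ^ 2 with hκ
  refine ((hs2.add (hs1.mul_left 2)).add (hs3.mul_left (2 * M ^ 2 * (b - a) * κ))).of_nonneg_of_le
    (fun k => intervalIntegral.integral_nonneg hab fun τ _ => by positivity) fun k => ?_
  have hba : 0 ≤ b - a := by linarith
  by_cases hk : k = 0
  · have e : ∀ τ, freqSq L₁ L₂ k ^ 2 * ‖fourierCoef (u τ) k‖ ^ 2 = 0 := fun τ => by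
      rw [hk, freqSq_zero]; ring
    simp only [e, intervalIntegral.integral_zero]
    have : 0 ≤ ∫ τ in a..b, ‖fourierCoef (u τ) k‖ ^ 2 :=
      intervalIntegral.integral_nonneg hab fun τ _ => by positivity
    positivity
  have hqg := gap_le_freqSq (L₁ := L₁) (L₂ := L₂) hk
  set q := freqSq L₁ L₂ k with hq
  have hq0 : 0 < q := hgap.trans_le hqg
  obtain ⟨hi, he⟩ := h.normSq_mode hab hu k
  -- absorb the forcing into the dissipation of the mode
  have hpt : ∀ᵐ τ, τ ∈ Ioc a b → q ^ 2 * ‖fourierCoef (u τ) k‖ ^ 2 ≤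
      2 * (q ^ 2 * ‖fourierCoef (u τ) k‖ ^ 2 + (conj (fourierCoef (u τ) k) * G k τ).re)
      + (2 * ‖fourierCoef (u τ) k‖ ^ 2 + 2 * M ^ 2 / q ^ 2) := by
    filter_upwards [hM k] with τ hτ hmem
    set x := ‖fourierCoef (u τ) k‖ with hx
    have hx0 : 0 ≤ x := norm_nonneg _
    have h1 : -(conj (fourierCoef (u τ) k) * G k τ).re ≤ x * (M + q * x) := by
      refine (neg_le_abs _).trans ((Complex.abs_re_le_norm _).trans ?_)
      rw [norm_mul, RCLike.norm_conj]
      exact mul_le_mul_of_nonneg_left (hτ hmem) hx0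
    have h2 : 2 * (M * x) ≤ 1 / 2 * (q ^ 2 * x ^ 2) + 2 * M ^ 2 / q ^ 2 := by
      have h3 : 0 ≤ (1 / 2 : ℝ) * (q * x - 2 * (M / q)) ^ 2 := by positivity
      have h4 : (1 / 2 : ℝ) * (q * x - 2 * (M / q)) ^ 2
          = 1 / 2 * (q ^ 2 * x ^ 2) + 2 * M ^ 2 / q ^ 2 - 2 * (M * x) := by
        field_simp; ring
      linarith
    have h3 : 2 * (q * x ^ 2) ≤ 1 / 2 * (q ^ 2 * x ^ 2) + 2 * x ^ 2 := by
      nlinarith [mul_nonneg (sq_nonneg (q - 2)) (sq_nonneg x)]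
    nlinarith
  have hint : ∫ τ in a..b, q ^ 2 * ‖fourierCoef (u τ) k‖ ^ 2 ≤
      ∫ τ in a..b, (2 * (q ^ 2 * ‖fourierCoef (u τ) k‖ ^ 2
        + (conj (fourierCoef (u τ) k) * G k τ).re)
      + (2 * ‖fourierCoef (u τ) k‖ ^ 2 + 2 * M ^ 2 / q ^ 2)) := by
    rw [intervalIntegral.integral_of_le hab, intervalIntegral.integral_of_le hab]
    refine setIntegral_mono_ae_restrict ?_ ?_ ?_
    · exact ((hci k).const_mul _).1
    · exact ((hi.const_mul 2).add (((hci k).const_mul 2).add intervalIntegrable_const)).1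
    · exact (ae_restrict_iff' measurableSet_Ioc).mpr hpt
  rw [intervalIntegral.integral_add (hi.const_mul 2)
    (((hci k).const_mul 2).add intervalIntegrable_const),
    intervalIntegral.integral_add ((hci k).const_mul 2) intervalIntegrable_const,
    intervalIntegral.integral_const_mul, intervalIntegral.integral_const_mul,
    intervalIntegral.integral_const_mul, intervalIntegral.integral_const, smul_eq_mul] at hint
  rw [intervalIntegral.integral_const_mul]
  have hw : 2 * M ^ 2 / q ^ 2 ≤ 2 * M ^ 2 * κ * ((1 ^ 2 + q)⁻¹) ^ 2 := by
    rw [mul_assoc, mul_div_assoc]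
    have h1 : 1 / q ≤ (1 + (gap L₁ L₂)⁻¹) * (1 + q)⁻¹ := by
      rw [← div_eq_mul_inv, div_le_div_iff₀ hq0 (by positivity)]
      have : 1 ≤ (gap L₁ L₂)⁻¹ * q := by
        rw [inv_mul_eq_div, le_div_iff₀ hgap]; linarith
      nlinarith
    have h2 := pow_le_pow_left₀ (by positivity) h1 2
    rw [mul_pow, div_pow, one_pow] at h2
    rw [one_pow, div_eq_mul_one_div, hκ, ← mul_assoc]
    have : 0 ≤ M ^ 2 := sq_nonneg M
    nlinarith
  have hw2 := mul_le_mul_of_nonneg_left hw hba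
  have hb0 : 0 ≤ ‖fourierCoef (u b) k‖ ^ 2 := by positivity
  nlinarith

/-- Square-integrability of the modes gives `H²` regularity at almost every time. -/
lemma memH2_of_summable {u : ℝ → L2 L₁ L₂} {a b : ℝ} (hab : a ≤ b)
    (hu : ContinuousOn u (Icc a b))
    (hs : Summable fun k => ∫ τ in a..b, freqSq L₁ L₂ k ^ 2 * ‖fourierCoef (u τ) k‖ ^ 2) :
    (∀ᵐ τ, τ ∈ Ioc a b → MemH2 (u τ)) ∧
      IntervalIntegrable (fun τ => ‖lap (u τ)‖ ^ 2) volume a b := by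
  have hci : ∀ k, IntervalIntegrable
      (fun τ => freqSq L₁ L₂ k ^ 2 * ‖fourierCoef (u τ) k‖ ^ 2) volume a b := fun k =>
    intervalIntegrable_of_continuousOn_Icc hab
      (continuousOn_const.mul ((continuousOn_coef hu k).norm.pow 2))
  simp only [intervalIntegral.integral_of_le hab] at hs
  obtain ⟨h1, h2⟩ := ae_summable_and_integrable_tsum (μ := volume.restrict (Ioc a b))
    (F := fun k τ => freqSq L₁ L₂ k ^ 2 * ‖fourierCoef (u τ) k‖ ^ 2)
    (fun k τ => by positivity) (fun k => (hci k).1) hs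
  have h3 : ∀ᵐ τ ∂(volume.restrict (Ioc a b)), MemH2 (u τ) := by
    filter_upwards [h1] with τ hτ
    exact memH2_iff.mpr hτ
  refine ⟨(ae_restrict_iff' measurableSet_Ioc).mp h3, ?_⟩
  rw [intervalIntegrable_iff_integrableOn_Ioc_of_le hab]
  refine (h2.const_mul (L₁ * L₂)).congr ?_
  filter_upwards [h3] with τ hτ
  rw [(hasSum_norm_lap hτ).tsum_eq, mul_inv_cancel_left₀ area_pos.ne']

/-- The energy identity for `∂ₜ u + Δ² u + g = 0`. -/
lemma HasModes.energy {u g : ℝ → L2 L₁ L₂} {H : ℝ → ℝ} {a b : ℝ}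
    (h : HasModes u (fun k τ => fourierCoef (g τ) k) a b) (hab : a ≤ b)
    (hu : ContinuousOn u (Icc a b)) (hH2 : ∀ᵐ τ, τ ∈ Ioc a b → MemH2 (u τ))
    (hlap : IntervalIntegrable (fun τ => ‖lap (u τ)‖ ^ 2) volume a b)
    (hH : IntervalIntegrable H volume a b) (hg : ∀ᵐ τ, τ ∈ Ioc a b → ‖g τ‖ ≤ H τ) :
    IntervalIntegrable (fun τ => inner ℝ (u τ) (g τ)) volume a b ∧
    ‖u b‖ ^ 2 = ‖u a‖ ^ 2 - 2 * (∫ τ in a..b, ‖lap (u τ)‖ ^ 2)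
      - 2 * ∫ τ in a..b, inner ℝ (u τ) (g τ) := by
  have hA := area_pos (L₁ := L₁) (L₂ := L₂)
  obtain ⟨M, hM⟩ := isCompact_Icc.exists_bound_of_continuousOn hu
  set μ := volume.restrict (Ioc a b) with hμ
  have hH2' : ∀ᵐ τ ∂μ, MemH2 (u τ) := (ae_restrict_iff' measurableSet_Ioc).mpr hH2
  have hg' : ∀ᵐ τ ∂μ, ‖g τ‖ ≤ H τ := (ae_restrict_iff' measurableSet_Ioc).mpr hg
  have hmem : ∀ᵐ τ ∂μ, τ ∈ Ioc a b := ae_restrict_mem measurableSet_Ioc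
  have hterm : ∀ k, Integrable (fun τ => freqSq L₁ L₂ k ^ 2 * ‖fourierCoef (u τ) k‖ ^ 2
      + (conj (fourierCoef (u τ) k) * fourierCoef (g τ) k).re) μ := fun k =>
    (h.normSq_mode hab hu k).1.1
  have hci : ∀ k, Integrable (fun τ => freqSq L₁ L₂ k ^ 2 * ‖fourierCoef (u τ) k‖ ^ 2) μ :=
    fun k => (intervalIntegrable_of_continuousOn_Icc hab
      (continuousOn_const.mul ((continuousOn_coef hu k).norm.pow 2))).1
  have hre : ∀ k, Integrable (fun τ => (conj (fourierCoef (u τ) k) * fourierCoef (g τ) k).re) μ :=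
    fun k => by
      refine ((hterm k).sub (hci k)).congr (Eventually.of_forall fun τ => ?_)
      simp
  have hinner : Integrable (fun τ => inner ℝ (u τ) (g τ)) μ := by
    refine Integrable.mono' (g := fun τ => M * H τ) (hH.1.const_mul M) ?_ ?_
    · refine aestronglyMeasurable_of_tendsto_ae atTop
        (f := fun (s : Finset (ℤ × ℤ)) τ => L₁ * L₂ * ∑ k ∈ s,
          (conj (fourierCoef (u τ) k) * fourierCoef (g τ) k).re) (fun s => ?_)
        (Eventually.of_forall fun τ => ?_)
      · exact (Finset.aestronglyMeasurable_fun_sum _ fun k _ => (hre k).1).const_mul _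
      · have := (hasSum_re_conj_fourierCoef_mul (u τ) (g τ)).mul_left (L₁ * L₂)
        rw [mul_inv_cancel_left₀ hA.ne'] at this
        refine Tendsto.congr (fun s => ?_) this
        rw [Finset.mul_sum]
    · filter_upwards [hg', hmem] with τ h1 h2
      refine (norm_inner_le_norm _ _).trans ?_
      have := hM τ (Ioc_subset_Icc_self h2)
      exact mul_le_mul this h1 (norm_nonneg _) ((norm_nonneg _).trans this)
  refine ⟨(intervalIntegrable_iff_integrableOn_Ioc_of_le hab).mpr hinner, ?_⟩
  -- pass to the limit in the sum of the mode balances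
  have hlim : Tendsto (fun s : Finset (ℤ × ℤ) => ∫ τ, ∑ k ∈ s,
      (freqSq L₁ L₂ k ^ 2 * ‖fourierCoef (u τ) k‖ ^ 2
        + (conj (fourierCoef (u τ) k) * fourierCoef (g τ) k).re) ∂μ) atTop
      (𝓝 (∫ τ, ((L₁ * L₂)⁻¹ * ‖lap (u τ)‖ ^ 2 + (L₁ * L₂)⁻¹ * inner ℝ (u τ) (g τ)) ∂μ)) := by
    refine tendsto_integral_filter_of_dominated_convergence
      (fun τ => (L₁ * L₂)⁻¹ * ‖lap (u τ)‖ ^ 2 + (L₁ * L₂)⁻¹ * (M * H τ)) ?_ ?_ ?_ ?_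
    · exact Eventually.of_forall fun s =>
        Finset.aestronglyMeasurable_fun_sum _ fun k _ => (hterm k).1
    · refine Eventually.of_forall fun s => ?_
      filter_upwards [hg', hmem, hH2'] with τ h1 h2 h3
      rw [Finset.sum_add_distrib, Real.norm_eq_abs]
      refine (abs_add_le _ _).trans (add_le_add ?_ ?_)
      · rw [abs_of_nonneg (Finset.sum_nonneg fun k _ => by positivity),
          ← (hasSum_norm_lap h3).tsum_eq]
        exact (hasSum_norm_lap h3).summable.sum_le_tsum s fun k _ => by positivity
      · have hu1 := hasSum_normSq_fourierCoef (u τ)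
        have hg1 := hasSum_normSq_fourierCoef (g τ)
        have c1 : |∑ k ∈ s, (conj (fourierCoef (u τ) k) * fourierCoef (g τ) k).re| ≤
            ∑ k ∈ s, ‖fourierCoef (u τ) k‖ * ‖fourierCoef (g τ) k‖ := by
          refine (Finset.abs_sum_le_sum_abs _ _).trans (Finset.sum_le_sum fun k _ => ?_)
          refine (Complex.abs_re_le_norm _).trans (le_of_eq ?_)
          rw [norm_mul, RCLike.norm_conj]
        have c2 : (∑ k ∈ s, ‖fourierCoef (u τ) k‖ * ‖fourierCoef (g τ) k‖) ^ 2 ≤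
            ((L₁ * L₂)⁻¹ * (‖u τ‖ * ‖g τ‖)) ^ 2 := by
          refine (Finset.sum_mul_sq_le_sq_mul_sq s _ _).trans ?_
          calc _ ≤ ((L₁ * L₂)⁻¹ * ‖u τ‖ ^ 2) * ((L₁ * L₂)⁻¹ * ‖g τ‖ ^ 2) := by
                refine mul_le_mul ?_ ?_ (Finset.sum_nonneg fun k _ => by positivity)
                  (by positivity)
                · rw [← hu1.tsum_eq]
                  exact hu1.summable.sum_le_tsum s fun k _ => by positivity
                · rw [← hg1.tsum_eq]
                  exact hg1.summable.sum_le_tsum s fun k _ => by positivity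
            _ = _ := by ring
        refine c1.trans ((le_of_sq_le_sq c2 (by positivity)).trans ?_)
        have := hM τ (Ioc_subset_Icc_self h2)
        have h4 : 0 ≤ M := (norm_nonneg _).trans this
        gcongr
    · exact (hlap.1.const_mul _).add ((hH.1.const_mul M).const_mul _)
    · filter_upwards [hH2'] with τ h3
      exact (hasSum_norm_lap h3).add (hasSum_re_conj_fourierCoef_mul (u τ) (g τ))
  have hsum : HasSum (fun k => ∫ τ, (freqSq L₁ L₂ k ^ 2 * ‖fourierCoef (u τ) k‖ ^ 2
      + (conj (fourierCoef (u τ) k) * fourierCoef (g τ) k).re) ∂μ)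
      (∫ τ, ((L₁ * L₂)⁻¹ * ‖lap (u τ)‖ ^ 2 + (L₁ * L₂)⁻¹ * inner ℝ (u τ) (g τ)) ∂μ) := by
    refine hlim.congr fun s => ?_
    exact integral_finsetSum s fun k _ => hterm k
  have hdiff := (hasSum_normSq_fourierCoef (u b)).sub (hasSum_normSq_fourierCoef (u a))
  have hdiff2 := hsum.mul_left (-2)
  have hk : ∀ k, ‖fourierCoef (u b) k‖ ^ 2 - ‖fourierCoef (u a) k‖ ^ 2 =
      -2 * ∫ τ, (freqSq L₁ L₂ k ^ 2 * ‖fourierCoef (u τ) k‖ ^ 2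
      + (conj (fourierCoef (u τ) k) * fourierCoef (g τ) k).re) ∂μ := fun k => by
    rw [(h.normSq_mode hab hu k).2, intervalIntegral.integral_of_le hab]
  simp only [hk] at hdiff
  have heq := hdiff.unique hdiff2
  rw [integral_add (hlap.1.const_mul _) (hinner.const_mul _), integral_const_mul,
    integral_const_mul, ← mul_sub, ← mul_add, mul_left_comm] at heq
  have heq2 := mul_left_cancel₀ (inv_ne_zero hA.ne') heq
  rw [intervalIntegral.integral_of_le hab, intervalIntegral.integral_of_le hab]
  linarith

/-! ### Transport by a bounded velocity field -/

/-- A measurable velocity field on the torus bounded by `K`. -/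
structure BddVel (K : ℝ) (w : Torus L₁ L₂ → ℝ × ℝ) : Prop where
  measurable : Measurable w
  bound : ∀ x, ‖w x‖ ≤ K

/-- The divergence of `w` vanishes in the sense of distributions. -/
def DivFree (w : Torus L₁ L₂ → ℝ × ℝ) : Prop := ∀ k : ℤ × ℤ,
  symD₁ L₁ L₂ k * fourierCoef (fun x => (w x).1) k
    + symD₂ L₁ L₂ k * fourierCoef (fun x => (w x).2) k = 0

lemma memLp_bdd_mul {g : Torus L₁ L₂ → ℝ} {K : ℝ} (hg : Measurable g) (hb : ∀ x, |g x| ≤ K)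
    (f : L2 L₁ L₂) : MemLp (fun x => g x * f x) 2 volume :=
  (Lp.memLp f).of_le_mul (c := K) (hg.aestronglyMeasurable.mul (Lp.memLp f).1)
    (Eventually.of_forall fun x => by
      rw [norm_mul]; exact mul_le_mul_of_nonneg_right (hb x) (norm_nonneg _))

lemma norm_toLp_bdd_mul_le {g : Torus L₁ L₂ → ℝ} {K : ℝ} (hg : Measurable g)
    (hb : ∀ x, |g x| ≤ K) (f : L2 L₁ L₂) :
    ‖(memLp_bdd_mul hg hb f).toLp _‖ ≤ K * ‖f‖ := by
  refine Lp.norm_le_mul_norm_of_ae_le_mul ?_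
  filter_upwards [(memLp_bdd_mul hg hb f).coeFn_toLp] with x hx
  rw [hx, norm_mul]
  exact mul_le_mul_of_nonneg_right (hb x) (norm_nonneg _)

section

variable {K : ℝ} {w : Torus L₁ L₂ → ℝ × ℝ}

lemma BddVel.nonneg (hw : BddVel K w) : 0 ≤ K := (norm_nonneg _).trans (hw.bound 0)

lemma BddVel.bound₁ (hw : BddVel K w) (x : Torus L₁ L₂) : |(w x).1| ≤ K :=
  (norm_fst_le (w x)).trans (hw.bound x)

lemma BddVel.bound₂ (hw : BddVel K w) (x : Torus L₁ L₂) : |(w x).2| ≤ K :=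
  (norm_snd_le (w x)).trans (hw.bound x)

lemma memLp_bdd {g : Torus L₁ L₂ → ℝ} (hg : Measurable g) (hb : ∀ x, |g x| ≤ K) :
    MemLp g 2 volume :=
  MemLp.of_bound hg.aestronglyMeasurable K (Eventually.of_forall hb)

lemma BddVel.memLp_advect (hw : BddVel K w) (f : L2 L₁ L₂) : MemLp (advect w f) 2 volume :=
  (memLp_bdd_mul hw.measurable.fst hw.bound₁ (D₁ f)).add
    (memLp_bdd_mul hw.measurable.snd hw.bound₂ (D₂ f))

open Classical in
/-- The transport term `w · ∇f` as an element of `L²`; it is `0` if `w · ∇f` is not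
square-integrable. -/
def advectL (w : Torus L₁ L₂ → ℝ × ℝ) (f : L2 L₁ L₂) : L2 L₁ L₂ :=
  if h : MemLp (advect w f) 2 volume then h.toLp _ else 0

lemma BddVel.advectL_ae_eq (hw : BddVel K w) (f : L2 L₁ L₂) :
    advectL w f =ᵐ[volume] advect w f := by
  rw [advectL, dif_pos (hw.memLp_advect f)]
  exact (hw.memLp_advect f).coeFn_toLp

lemma BddVel.coef_advectL (hw : BddVel K w) (f : L2 L₁ L₂) (k : ℤ × ℤ) :
    fourierCoef (advectL w f) k = fourierCoef (advect w f) k :=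
  fourierCoef_congr_ae (hw.advectL_ae_eq f) k

lemma BddVel.norm_advectL_le (hw : BddVel K w) (f : L2 L₁ L₂) :
    ‖advectL w f‖ ≤ 2 * K * gradNorm f := by
  have e : advectL w f = (memLp_bdd_mul hw.measurable.fst hw.bound₁ (D₁ f)).toLp _
      + (memLp_bdd_mul hw.measurable.snd hw.bound₂ (D₂ f)).toLp _ := by
    rw [advectL, dif_pos (hw.memLp_advect f)]
    rfl
  rw [e]
  have h1 := norm_toLp_bdd_mul_le hw.measurable.fst hw.bound₁ (D₁ f)
  have h2 := norm_toLp_bdd_mul_le hw.measurable.snd hw.bound₂ (D₂ f)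
  have h3 := mul_le_mul_of_nonneg_left (norm_D₁_le f) hw.nonneg
  have h4 := mul_le_mul_of_nonneg_left (norm_D₂_le f) hw.nonneg
  refine (norm_add_le _ _).trans ?_
  linarith

lemma memH1_sub {f g : L2 L₁ L₂} (hf : MemH1 f) (hg : MemH1 g) : MemH1 (f - g) := by
  refine ⟨⟨D₁ f - D₁ g, fun k => ?_⟩, ⟨D₂ f - D₂ g, fun k => ?_⟩⟩
  · rw [coef_sub, coef_sub, coef_D₁ hf, coef_D₁ hg, mul_sub]
  · rw [coef_sub, coef_sub, coef_D₂ hf, coef_D₂ hg, mul_sub]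

lemma memH2_sub {f g : L2 L₁ L₂} (hf : MemH2 f) (hg : MemH2 g) : MemH2 (f - g) :=
  ⟨lap f - lap g, fun k => by
    rw [coef_sub, coef_sub, lap, lap, coef_multiplier hf, coef_multiplier hg, mul_sub]⟩

lemma D₁_sub {f g : L2 L₁ L₂} (hf : MemH1 f) (hg : MemH1 g) : D₁ (f - g) = D₁ f - D₁ g :=
  eq_of_coef_eq fun k => by
    rw [coef_D₁ (memH1_sub hf hg), coef_sub, coef_sub, coef_D₁ hf, coef_D₁ hg, mul_sub]

lemma D₂_sub {f g : L2 L₁ L₂} (hf : MemH1 f) (hg : MemH1 g) : D₂ (f - g) = D₂ f - D₂ g :=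
  eq_of_coef_eq fun k => by
    rw [coef_D₂ (memH1_sub hf hg), coef_sub, coef_sub, coef_D₂ hf, coef_D₂ hg, mul_sub]

lemma sq_norm_sub_le (a b : L2 L₁ L₂) : ‖a - b‖ ^ 2 ≤ 2 * ‖a‖ ^ 2 + 2 * ‖b‖ ^ 2 := by
  have := pow_le_pow_left₀ (norm_nonneg _) (norm_sub_le a b) 2
  nlinarith [sq_nonneg (‖a‖ - ‖b‖)]

lemma gradNorm_sub_sq_le {f g : L2 L₁ L₂} (hf : MemH1 f) (hg : MemH1 g) :
    gradNorm (f - g) ^ 2 ≤ 2 * gradNorm f ^ 2 + 2 * gradNorm g ^ 2 := by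
  rw [gradNorm_sq, gradNorm_sq, gradNorm_sq, D₁_sub hf hg, D₂_sub hf hg]
  have := sq_norm_sub_le (D₁ f) (D₁ g)
  have := sq_norm_sub_le (D₂ f) (D₂ g)
  linarith

lemma lap_sub {f g : L2 L₁ L₂} (hf : MemH2 f) (hg : MemH2 g) : lap (f - g) = lap f - lap g :=
  eq_of_coef_eq fun k => by
    rw [coef_lap (memH2_sub hf hg), coef_sub, coef_sub, coef_lap hf, coef_lap hg, mul_sub]

lemma BddVel.advectL_sub (hw : BddVel K w) {f g : L2 L₁ L₂} (hf : MemH1 f) (hg : MemH1 g) :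
    advectL w (f - g) = advectL w f - advectL w g := by
  refine Lp.ext ?_
  filter_upwards [hw.advectL_ae_eq (f - g), hw.advectL_ae_eq f, hw.advectL_ae_eq g,
    Lp.coeFn_sub (advectL w f) (advectL w g), Lp.coeFn_sub (D₁ f) (D₁ g),
    Lp.coeFn_sub (D₂ f) (D₂ g)] with x h1 h2 h3 h4 h5 h6
  rw [h1, h4, Pi.sub_apply, h2, h3, advect, advect, advect, D₁_sub hf hg, D₂_sub hf hg, h5, h6,
    Pi.sub_apply, Pi.sub_apply]
  ring

/-- `w · ∇f = div (f w)` for divergence-free `w`, in terms of Fourier coefficients: the divergence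
relation is used at each frequency `k - m` of the convolution. -/
lemma BddVel.coef_advect (hw : BddVel K w) (hdiv : DivFree w) {f : L2 L₁ L₂} (hf : MemH1 f)
    (k : ℤ × ℤ) : fourierCoef (advect w f) k =
      symD₁ L₁ L₂ k * fourierCoef (fun x => (w x).1 * f x) k
        + symD₂ L₁ L₂ k * fourierCoef (fun x => (w x).2 * f x) k := by
  have m1 := memLp_bdd hw.measurable.fst hw.bound₁
  have m2 := memLp_bdd hw.measurable.snd hw.bound₂
  have a1 := hasSum_fourierCoef_mul m1 (Lp.memLp (D₁ f)) k
  have a2 := hasSum_fourierCoef_mul m2 (Lp.memLp (D₂ f)) k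
  have b1 := (hasSum_fourierCoef_mul m1 (Lp.memLp f) k).mul_left (symD₁ L₁ L₂ k)
  have b2 := (hasSum_fourierCoef_mul m2 (Lp.memLp f) k).mul_left (symD₂ L₁ L₂ k)
  have e : fourierCoef (advect w f) k = fourierCoef (fun x => (w x).1 * D₁ f x) k
      + fourierCoef (fun x => (w x).2 * D₂ f x) k :=
    fourierCoef_add ((memLp_bdd_mul hw.measurable.fst hw.bound₁ (D₁ f)).integrable one_le_two)
      ((memLp_bdd_mul hw.measurable.snd hw.bound₂ (D₂ f)).integrable one_le_two) k
  rw [e]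
  refine (a1.add a2).unique ?_
  convert! b1.add b2 using 1
  ext m
  have hd := hdiv (k - m)
  have s1 : symD₁ L₁ L₂ (k - m) = symD₁ L₁ L₂ k - symD₁ L₁ L₂ m := by
    simp only [symD₁, freq, Prod.fst_sub]; push_cast; ring
  have s2 : symD₂ L₁ L₂ (k - m) = symD₂ L₁ L₂ k - symD₂ L₁ L₂ m := by
    simp only [symD₂, freq, Prod.snd_sub]; push_cast; ring
  rw [s1, s2] at hd
  rw [coef_D₁ hf, coef_D₂ hf]
  linear_combination (-fourierCoef f m) * hd

lemma BddVel.coef_advectL_zero (hw : BddVel K w) (hdiv : DivFree w) {f : L2 L₁ L₂}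
    (hf : MemH1 f) : fourierCoef (advectL w f) 0 = 0 := by
  rw [hw.coef_advectL, hw.coef_advect hdiv hf]
  simp [symD₁, symD₂, freq]

/-- Transport by a divergence-free field is antisymmetric. -/
lemma BddVel.inner_advectL (hw : BddVel K w) (hdiv : DivFree w) {f : L2 L₁ L₂}
    (hf : MemH1 f) : inner ℝ f (advectL w f) = 0 := by
  have hA := area_pos (L₁ := L₁) (L₂ := L₂)
  have n1 := memLp_bdd_mul hw.measurable.fst hw.bound₁ f
  have n2 := memLp_bdd_mul hw.measurable.snd hw.bound₂ f
  have h1 := hasSum_conj_fourierCoef_mul (Lp.memLp f) (Lp.memLp (advectL w f))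
  have h2 := hasSum_conj_fourierCoef_mul (Lp.memLp (D₁ f)) n1
  have h3 := hasSum_conj_fourierCoef_mul (Lp.memLp (D₂ f)) n2
  have h4 := h1.unique (by
    convert! (h2.add h3).neg using 1
    ext k
    rw [hw.coef_advectL, hw.coef_advect hdiv hf, coef_D₁ hf, coef_D₂ hf, map_mul, map_mul]
    have c1 : conj (symD₁ L₁ L₂ k) = -symD₁ L₁ L₂ k := by
      simp only [symD₁, map_mul, Complex.conj_I, Complex.conj_ofReal]; ring
    have c2 : conj (symD₂ L₁ L₂ k) = -symD₂ L₁ L₂ k := by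
      simp only [symD₂, map_mul, Complex.conj_I, Complex.conj_ofReal]; ring
    rw [c1, c2]
    ring)
  rw [← Complex.ofReal_add, ← Complex.ofReal_neg, Complex.ofReal_inj, ← mul_add, ← mul_neg] at h4
  have h5 := mul_left_cancel₀ (inv_ne_zero hA.ne') h4
  have e : ∫ x, f x * advectL w f x
      = (∫ x, D₁ f x * ((w x).1 * f x)) + ∫ x, D₂ f x * ((w x).2 * f x) := by
    rw [← integral_add]
    · refine integral_congr_ae ?_
      filter_upwards [hw.advectL_ae_eq f] with x hx
      rw [hx, advect]; ring
    · exact (Lp.memLp (D₁ f)).integrable_mul n1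
    · exact (Lp.memLp (D₂ f)).integrable_mul n2
  rw [inner_eq_integral]
  linarith

end

/-! ### Measurability of the transport term in time -/

lemma measurable_coef_of_uncurry {α : Type*} [MeasurableSpace α] {g : α → Torus L₁ L₂ → ℝ}
    (hg : Measurable (Function.uncurry g)) (k : ℤ × ℤ) :
    StronglyMeasurable (fun t => fourierCoef (g t) k) := by
  simp only [fourierCoef_eq_cCoef, cCoef]
  refine StronglyMeasurable.const_mul ?_ _
  refine StronglyMeasurable.integral_prod_right
    (f := fun t x => expMono L₁ L₂ (-k) x * (g t x : ℂ)) ?_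
  refine Measurable.stronglyMeasurable ?_
  exact ((expMono L₁ L₂ (-k)).continuous.measurable.comp measurable_snd).mul
    (Complex.measurable_ofReal.comp hg)

/-- The Fourier coefficients of a product depend measurably on a parameter, being limits of finite
convolution sums. -/
lemma aestronglyMeasurable_coef_mul {α : Type*} [MeasurableSpace α] {μ : Measure α}
    {g : α → Torus L₁ L₂ → ℝ} {K : ℝ} (hg : Measurable (Function.uncurry g))
    (hb : ∀ t x, |g t x| ≤ K) {Φ : α → L2 L₁ L₂}
    (hΦ : ∀ k, AEStronglyMeasurable (fun t => fourierCoef (Φ t) k) μ) (k : ℤ × ℤ) :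
    AEStronglyMeasurable (fun t => fourierCoef (fun x => g t x * Φ t x) k) μ := by
  refine aestronglyMeasurable_of_tendsto_ae atTop
    (f := fun (s : Finset (ℤ × ℤ)) t => ∑ m ∈ s, fourierCoef (g t) (k - m) * fourierCoef (Φ t) m)
    (fun s => ?_) (Eventually.of_forall fun t => ?_)
  · exact Finset.aestronglyMeasurable_fun_sum _ fun m _ =>
      (measurable_coef_of_uncurry hg _).aestronglyMeasurable.mul (hΦ m)
  · exact hasSum_fourierCoef_mul (memLp_bdd (hg.comp measurable_prodMk_left) (hb t))
      (Lp.memLp (Φ t)) k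

lemma aestronglyMeasurable_coef_advectL {α : Type*} [MeasurableSpace α] {μ : Measure α} {K : ℝ}
    {v : α → Torus L₁ L₂ → ℝ × ℝ} (hv : Measurable (Function.uncurry v))
    (hb : ∀ t x, ‖v t x‖ ≤ K) {Φ : α → L2 L₁ L₂} (hH1 : ∀ᵐ t ∂μ, MemH1 (Φ t))
    (hΦ : ∀ k, AEStronglyMeasurable (fun t => fourierCoef (Φ t) k) μ) (k : ℤ × ℤ) :
    AEStronglyMeasurable (fun t => fourierCoef (advectL (v t) (Φ t)) k) μ := by
  have hB : ∀ t, BddVel K (v t) := fun t => ⟨hv.comp measurable_prodMk_left, hb t⟩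
  have m1 : ∀ m, AEStronglyMeasurable (fun t => fourierCoef (D₁ (Φ t)) m) μ := fun m => by
    refine ((hΦ m).const_mul (symD₁ L₁ L₂ m)).congr ?_
    filter_upwards [hH1] with t ht
    rw [coef_D₁ ht]
  have m2 : ∀ m, AEStronglyMeasurable (fun t => fourierCoef (D₂ (Φ t)) m) μ := fun m => by
    refine ((hΦ m).const_mul (symD₂ L₁ L₂ m)).congr ?_
    filter_upwards [hH1] with t ht
    rw [coef_D₂ ht]
  have a1 := aestronglyMeasurable_coef_mul (g := fun t x => (v t x).1) (K := K)
    (measurable_fst.comp hv) (fun t => (hB t).bound₁) m1 k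
  have a2 := aestronglyMeasurable_coef_mul (g := fun t x => (v t x).2) (K := K)
    (measurable_snd.comp hv) (fun t => (hB t).bound₂) m2 k
  refine (a1.add a2).congr (Eventually.of_forall fun t => ?_)
  change fourierCoef (fun x => (v t x).1 * D₁ (Φ t) x) k
    + fourierCoef (fun x => (v t x).2 * D₂ (Φ t) x) k = fourierCoef (advectL (v t) (Φ t)) k
  rw [(hB t).coef_advectL]
  exact (fourierCoef_add
    ((memLp_bdd_mul (hB t).measurable.fst (hB t).bound₁ (D₁ (Φ t))).integrable one_le_two)
    ((memLp_bdd_mul (hB t).measurable.snd (hB t).bound₂ (D₂ (Φ t))).integrable one_le_two) k).symm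

/-! ### The Duhamel integral of the biharmonic heat semigroup -/

/-- Cauchy–Schwarz for the integral of a scalar weight against a complex function. -/
lemma normSq_integral_mul_le {s t : ℝ} (hst : s ≤ t) {w : ℝ → ℝ} (hw : Continuous w)
    (hw0 : ∀ τ, 0 ≤ w τ) {g : ℝ → ℂ} (hg : AEStronglyMeasurable g (volume.restrict (Ioc s t)))
    (hg2 : IntegrableOn (fun τ => ‖g τ‖ ^ 2) (Ioc s t)) :
    ‖∫ τ in s..t, (w τ : ℂ) * g τ‖ ^ 2 ≤ (∫ τ in s..t, w τ ^ 2) * ∫ τ in s..t, ‖g τ‖ ^ 2 := by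
  have hw2 : IntegrableOn (fun τ => w τ ^ 2) (Ioc s t) :=
    ((hw.pow 2).intervalIntegrable s t).1
  have h1 : ‖∫ τ in s..t, (w τ : ℂ) * g τ‖ ≤ ∫ τ in s..t, w τ * ‖g τ‖ := by
    refine (intervalIntegral.norm_integral_le_integral_norm hst).trans_eq ?_
    refine intervalIntegral.integral_congr fun τ _ => ?_
    simp only [norm_mul, Complex.norm_real, Real.norm_eq_abs, abs_of_nonneg (hw0 τ)]
  have m1 : MemLp w 2 (volume.restrict (Ioc s t)) :=
    (memLp_two_iff_integrable_sq hw.aestronglyMeasurable).mpr hw2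
  have m2 : MemLp (fun τ => ‖g τ‖) 2 (volume.restrict (Ioc s t)) :=
    (memLp_two_iff_integrable_sq hg.norm).mpr hg2
  have h2 := integral_mul_le_Lp_mul_Lq_of_nonneg (p := 2) (q := 2)
    (μ := volume.restrict (Ioc s t)) (f := w) (g := fun τ => ‖g τ‖)
    (by constructor <;> norm_num) (Eventually.of_forall hw0)
    (Eventually.of_forall fun τ => norm_nonneg _) (by simpa using m1) (by simpa using m2)
  rw [← intervalIntegral.integral_of_le hst] at h2
  simp only [Real.rpow_two] at h2
  rw [← intervalIntegral.integral_of_le hst, ← intervalIntegral.integral_of_le hst,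
    ← Real.sqrt_eq_rpow, ← Real.sqrt_eq_rpow] at h2
  have h3 := pow_le_pow_left₀ (norm_nonneg _) (h1.trans h2) 2
  rwa [mul_pow, Real.sq_sqrt (intervalIntegral.integral_nonneg hst fun τ _ => by positivity),
    Real.sq_sqrt (intervalIntegral.integral_nonneg hst fun τ _ => by positivity)] at h3

/-- `G` is measurable on `(s, ∞)` and square-integrable on bounded subintervals. -/
structure SqInt (s : ℝ) (G : ℝ → L2 L₁ L₂) : Prop where
  meas : AEStronglyMeasurable G (volume.restrict (Ioi s))
  sq : ∀ S, IntegrableOn (fun τ => ‖G τ‖ ^ 2) (Ioc s S)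

section

variable {s t : ℝ} {G H : ℝ → L2 L₁ L₂}

lemma SqInt.coef_meas (hG : SqInt s G) (k : ℤ × ℤ) :
    AEStronglyMeasurable (fun τ => fourierCoef (G τ) k) (volume.restrict (Ioi s)) :=
  (coefL k).continuous.comp_aestronglyMeasurable hG.meas

lemma SqInt.coef_meas' (hG : SqInt s G) (t : ℝ) (k : ℤ × ℤ) :
    AEStronglyMeasurable (fun τ => fourierCoef (G τ) k) (volume.restrict (Ioc s t)) :=
  (hG.coef_meas k).mono_measure (Measure.restrict_mono Ioc_subset_Ioi_self le_rfl)

lemma normSq_coef_le (f : L2 L₁ L₂) (k : ℤ × ℤ) :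
    ‖fourierCoef f k‖ ^ 2 ≤ (L₁ * L₂)⁻¹ * ‖f‖ ^ 2 :=
  le_hasSum (hasSum_normSq_fourierCoef f) k fun _ _ => by positivity

lemma SqInt.coef_sq (hG : SqInt s G) (t : ℝ) (k : ℤ × ℤ) :
    IntegrableOn (fun τ => ‖fourierCoef (G τ) k‖ ^ 2) (Ioc s t) :=
  ((hG.sq t).const_mul (L₁ * L₂)⁻¹).mono' ((hG.coef_meas' t k).norm.pow 2)
    (Eventually.of_forall fun τ => by
      rw [Real.norm_eq_abs, abs_of_nonneg (by positivity)]; exact normSq_coef_le _ _)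

lemma SqInt.coef_integrable (hG : SqInt s G) (t : ℝ) (k : ℤ × ℤ) :
    IntegrableOn (fun τ => fourierCoef (G τ) k) (Ioc s t) :=
  (Integrable.add (hG.coef_sq t k) (integrable_const (1 : ℝ))).mono' (hG.coef_meas' t k)
    (Eventually.of_forall fun τ => by
      simp only [Pi.add_apply]; nlinarith [sq_nonneg (‖fourierCoef (G τ) k‖ - 1)])

lemma SqInt.integrable (hG : SqInt s G) (t : ℝ) : IntegrableOn G (Ioc s t) :=
  (Integrable.add (hG.sq t) (integrable_const (1 : ℝ))).mono'
    (hG.meas.mono_measure (Measure.restrict_mono Ioc_subset_Ioi_self le_rfl))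
    (Eventually.of_forall fun τ => by
      simp only [Pi.add_apply]; nlinarith [sq_nonneg (‖G τ‖ - 1)])

lemma SqInt.sub (hG : SqInt s G) (hH : SqInt s H) : SqInt s (fun τ => G τ - H τ) := by
  have hm := hG.meas.sub hH.meas
  refine ⟨hm, fun S => ?_⟩
  refine (((hG.sq S).const_mul 2).add ((hH.sq S).const_mul 2)).mono'
    ((hm.mono_measure (Measure.restrict_mono Ioc_subset_Ioi_self le_rfl)).norm.pow 2)
    (Eventually.of_forall fun τ => ?_)
  rw [Real.norm_eq_abs, abs_of_nonneg (by positivity)]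
  exact sq_norm_sub_le _ _

lemma SqInt.sum_le (hG : SqInt s G) (hst : s ≤ t) (F : Finset (ℤ × ℤ)) :
    ∑ k ∈ F, ∫ τ in s..t, ‖fourierCoef (G τ) k‖ ^ 2
      ≤ (L₁ * L₂)⁻¹ * ∫ τ in s..t, ‖G τ‖ ^ 2 := by
  have h1 : ∀ k, IntervalIntegrable (fun τ => ‖fourierCoef (G τ) k‖ ^ 2) volume s t := fun k =>
    (intervalIntegrable_iff_integrableOn_Ioc_of_le hst).mpr (hG.coef_sq t k)
  have h2 : IntervalIntegrable (fun τ => ‖G τ‖ ^ 2) volume s t :=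
    (intervalIntegrable_iff_integrableOn_Ioc_of_le hst).mpr (hG.sq t)
  rw [← intervalIntegral.integral_finsetSum fun k _ => h1 k,
    ← intervalIntegral.integral_const_mul]
  refine intervalIntegral.integral_mono_on hst 
    ((IntervalIntegrable.sum F fun k _ => h1 k).congr fun τ _ => Finset.sum_apply _ _ _)
    (h2.const_mul _) fun τ _ => ?_
  exact sum_le_hasSum F (fun _ _ => by positivity) (hasSum_normSq_fourierCoef (G τ))

lemma SqInt.summable (hG : SqInt s G) (hst : s ≤ t) :
    Summable fun k => ∫ τ in s..t, ‖fourierCoef (G τ) k‖ ^ 2 :=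
  summable_of_sum_le
    (fun k => intervalIntegral.integral_nonneg hst fun τ _ => by positivity) (hG.sum_le hst)

lemma SqInt.tsum_le (hG : SqInt s G) (hst : s ≤ t) :
    ∑' k, ∫ τ in s..t, ‖fourierCoef (G τ) k‖ ^ 2 ≤ (L₁ * L₂)⁻¹ * ∫ τ in s..t, ‖G τ‖ ^ 2 :=
  (hG.summable hst).tsum_le_of_sum_le (hG.sum_le hst)

/-- The Fourier coefficients of `∫ₛᵗ exp (-(t - τ) Δ²) G(τ) dτ`. -/
def duhCoef (s : ℝ) (G : ℝ → L2 L₁ L₂) (t : ℝ) (k : ℤ × ℤ) : ℂ :=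
  ∫ τ in s..t, (Real.exp (-(t - τ) * freqSq L₁ L₂ k ^ 2) : ℂ) * fourierCoef (G τ) k

lemma SqInt.normSq_duhCoef_le (hG : SqInt s G) (hst : s ≤ t) (k : ℤ × ℤ) :
    ‖duhCoef s G t k‖ ^ 2 ≤ (t - s) * ∫ τ in s..t, ‖fourierCoef (G τ) k‖ ^ 2 := by
  have hc : Continuous fun τ : ℝ => Real.exp (-(t - τ) * freqSq L₁ L₂ k ^ 2) := by fun_prop
  refine (normSq_integral_mul_le hst hc (fun τ => (Real.exp_pos _).le) (hG.coef_meas' t k)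
    (hG.coef_sq t k)).trans ?_
  have h0 : 0 ≤ ∫ τ in s..t, ‖fourierCoef (G τ) k‖ ^ 2 :=
    intervalIntegral.integral_nonneg hst fun τ _ => by positivity
  refine mul_le_mul_of_nonneg_right ?_ h0
  have := intervalIntegral.integral_mono_on hst ((hc.pow 2).intervalIntegrable s t)
    (intervalIntegrable_const (μ := volume) (c := (1 : ℝ))) fun τ hτ => by
      refine pow_le_one₀ (Real.exp_pos _).le (Real.exp_le_one_iff.mpr ?_)
      have := mul_nonneg (sub_nonneg.mpr hτ.2) (sq_nonneg (freqSq L₁ L₂ k))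
      linarith
  simpa using this

/-- The Duhamel integral gains one derivative in `L²`, since
`∫ₛᵗ exp (-2 (t - τ) q²) dτ ≤ 1 / (2 q²)` and `q = |k̃|²` is bounded below for `k ≠ 0`. -/
lemma SqInt.freqSq_mul_normSq_duhCoef_le (hG : SqInt s G) (hst : s ≤ t) (k : ℤ × ℤ) :
    freqSq L₁ L₂ k * ‖duhCoef s G t k‖ ^ 2
      ≤ (2 * gap L₁ L₂)⁻¹ * ∫ τ in s..t, ‖fourierCoef (G τ) k‖ ^ 2 := by
  have hgap := gap_pos (L₁ := L₁) (L₂ := L₂)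
  have h0 : 0 ≤ ∫ τ in s..t, ‖fourierCoef (G τ) k‖ ^ 2 :=
    intervalIntegral.integral_nonneg hst fun τ _ => by positivity
  by_cases hk : k = 0
  · rw [hk, freqSq_zero, zero_mul]; rw [hk] at h0; positivity
  have hq := gap_le_freqSq (L₁ := L₁) (L₂ := L₂) hk
  set q := freqSq L₁ L₂ k with hqdef
  have hq0 : 0 < q := hgap.trans_le hq
  have hc : Continuous fun τ : ℝ => Real.exp (-(t - τ) * q ^ 2) := by fun_prop
  have h1 := normSq_integral_mul_le hst hc (fun τ => (Real.exp_pos _).le) (hG.coef_meas' t k)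
    (hG.coef_sq t k)
  have h2 : ∫ τ in s..t, Real.exp (-(t - τ) * q ^ 2) ^ 2 ≤ (2 * q ^ 2)⁻¹ := by
    have hd : ∀ τ ∈ uIcc s t, HasDerivAt
        (fun τ : ℝ => (2 * q ^ 2)⁻¹ * Real.exp (-(t - τ) * q ^ 2) ^ 2)
        (Real.exp (-(t - τ) * q ^ 2) ^ 2) τ := by
      intro τ _
      have a1 : HasDerivAt (fun τ : ℝ => -(t - τ) * q ^ 2) (q ^ 2) τ := by
        have := (((hasDerivAt_id τ).const_sub t).neg).mul_const (q ^ 2)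
        simpa using this
      refine ((a1.exp.pow 2).const_mul (2 * q ^ 2)⁻¹).congr_deriv ?_
      field_simp
      simp
    rw [intervalIntegral.integral_eq_sub_of_hasDerivAt hd ((hc.pow 2).intervalIntegrable s t)]
    have : 0 ≤ (2 * q ^ 2)⁻¹ * Real.exp (-(t - s) * q ^ 2) ^ 2 := by positivity
    simp only [sub_self, neg_zero, zero_mul, Real.exp_zero, one_pow, mul_one]
    linarith
  have h3 : ‖duhCoef s G t k‖ ^ 2 ≤ (2 * q ^ 2)⁻¹ * ∫ τ in s..t, ‖fourierCoef (G τ) k‖ ^ 2 :=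
    h1.trans (mul_le_mul_of_nonneg_right h2 h0)
  calc q * ‖duhCoef s G t k‖ ^ 2
      ≤ q * ((2 * q ^ 2)⁻¹ * ∫ τ in s..t, ‖fourierCoef (G τ) k‖ ^ 2) := by gcongr
    _ = (2 * q)⁻¹ * ∫ τ in s..t, ‖fourierCoef (G τ) k‖ ^ 2 := by field_simp
    _ ≤ _ := by gcongr

lemma duhCoef_neg (k : ℤ × ℤ) : duhCoef s G t (-k) = conj (duhCoef s G t k) := by
  simp only [duhCoef, intervalIntegral, map_sub, ← integral_conj]
  simp only [freqSq_neg, fourierCoef_neg_freq, map_mul, Complex.conj_ofReal]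

open Classical in
/-- The Duhamel integral `∫ₛᵗ exp (-(t - τ) Δ²) G(τ) dτ`, defined through its Fourier
coefficients. -/
def duh (s : ℝ) (G : ℝ → L2 L₁ L₂) (t : ℝ) : L2 L₁ L₂ :=
  if h : ∃ u : L2 L₁ L₂, ∀ k, fourierCoef u k = duhCoef s G t k then h.choose else 0

lemma SqInt.coef_duh (hG : SqInt s G) (hst : s ≤ t) (k : ℤ × ℤ) :
    fourierCoef (duh s G t) k = duhCoef s G t k := by
  have h : ∃ u : L2 L₁ L₂, ∀ k, fourierCoef u k = duhCoef s G t k :=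
    exists_coef_eq (((hG.summable hst).mul_left (t - s)).of_nonneg_of_le
      (fun k => by positivity) (hG.normSq_duhCoef_le hst)) (fun k => duhCoef_neg k)
  rw [duh, dif_pos h]
  exact h.choose_spec k

lemma SqInt.memH1_duh (hG : SqInt s G) (hst : s ≤ t) : MemH1 (duh s G t) := by
  rw [memH1_iff]
  simp only [hG.coef_duh hst]
  exact ((hG.summable hst).mul_left _).of_nonneg_of_le
    (fun k => mul_nonneg (freqSq_nonneg k) (by positivity)) (hG.freqSq_mul_normSq_duhCoef_le hst)

lemma SqInt.gradNorm_duh_sq_le (hG : SqInt s G) (hst : s ≤ t) :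
    gradNorm (duh s G t) ^ 2 ≤ (2 * gap L₁ L₂)⁻¹ * ∫ τ in s..t, ‖G τ‖ ^ 2 := by
  have hgap := gap_pos (L₁ := L₁) (L₂ := L₂)
  have hA := area_pos (L₁ := L₁) (L₂ := L₂)
  have h1 := hasSum_gradNorm (hG.memH1_duh hst)
  simp only [hG.coef_duh hst] at h1
  have h2 := hasSum_le (hG.freqSq_mul_normSq_duhCoef_le hst) h1
    ((hG.summable hst).hasSum.mul_left _)
  have h3 := mul_le_mul_of_nonneg_left (hG.tsum_le hst)
    (by positivity : 0 ≤ (2 * gap L₁ L₂)⁻¹)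
  have h4 := h2.trans h3
  rw [mul_left_comm] at h4
  exact le_of_mul_le_mul_left h4 (inv_pos.mpr hA)

lemma SqInt.duh_sub (hG : SqInt s G) (hH : SqInt s H) (hst : s ≤ t) :
    duh s G t - duh s H t = duh s (fun τ => G τ - H τ) t := by
  refine eq_of_coef_eq fun k => ?_
  have hi : ∀ {G : ℝ → L2 L₁ L₂}, SqInt s G → IntervalIntegrable (fun τ =>
      (Real.exp (-(t - τ) * freqSq L₁ L₂ k ^ 2) : ℂ) * fourierCoef (G τ) k) volume s t := by
    intro G hG
    exact ((intervalIntegrable_iff_integrableOn_Ioc_of_le hst).mpr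
      (hG.coef_integrable t k)).continuousOn_mul (by fun_prop)
  rw [coef_sub, hG.coef_duh hst, hH.coef_duh hst, (hG.sub hH).coef_duh hst, duhCoef, duhCoef,
    duhCoef, ← intervalIntegral.integral_sub (hi hG) (hi hH)]
  refine intervalIntegral.integral_congr fun τ _ => ?_
  simp only [coef_sub, mul_sub]

lemma SqInt.continuousOn_duhCoef (hG : SqInt s G) (S : ℝ) (hsS : s ≤ S) (k : ℤ × ℤ) :
    ContinuousOn (fun t => duhCoef s G t k) (Icc s S) := by
  have e : ∀ t, duhCoef s G t k = (Real.exp (-t * freqSq L₁ L₂ k ^ 2) : ℂ) *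
      ∫ τ in s..t, (Real.exp (τ * freqSq L₁ L₂ k ^ 2) : ℂ) * fourierCoef (G τ) k := by
    intro t
    rw [duhCoef, ← intervalIntegral.integral_const_mul]
    refine intervalIntegral.integral_congr fun τ _ => ?_
    rw [← mul_assoc, ← Complex.ofReal_mul, ← Real.exp_add]
    congr 3
    ring
  simp only [e]
  refine ContinuousOn.mul (by fun_prop) ?_
  have hi : IntervalIntegrable (fun τ => (Real.exp (τ * freqSq L₁ L₂ k ^ 2) : ℂ)
      * fourierCoef (G τ) k) volume s S :=
    ((intervalIntegrable_iff_integrableOn_Ioc_of_le hsS).mpr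
      (hG.coef_integrable S k)).continuousOn_mul (by fun_prop)
  have := intervalIntegral.continuousOn_primitive_interval' hi (left_mem_uIcc)
  rwa [uIcc_of_le hsS] at this

/-- A path in `L²` is continuous once its Fourier coefficients are continuous and dominated by a
square-summable sequence. -/
lemma continuousOn_of_coef {u : ℝ → L2 L₁ L₂} {I : Set ℝ} {b : ℤ × ℤ → ℝ} (hb : Summable b)
    (hc : ∀ k, ContinuousOn (fun t => fourierCoef (u t) k) I)
    (hub : ∀ t ∈ I, ∀ k, ‖fourierCoef (u t) k‖ ^ 2 ≤ b k) : ContinuousOn u I := by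
  intro t₀ ht₀
  have hlim : Tendsto (fun t => ∑' k, ‖fourierCoef (u t - u t₀ : L2 L₁ L₂) k‖ ^ 2) (𝓝[I] t₀)
      (𝓝 (∑' _ : ℤ × ℤ, (0 : ℝ))) := by
    refine tendsto_tsum_of_dominated_convergence (bound := fun k => 4 * b k) (hb.mul_left 4)
      (fun k => ?_) ?_
    · have h1 := ((hc k t₀ ht₀).sub_const (fourierCoef (u t₀) k)).norm.pow 2
      simp only [sub_self, norm_zero, ne_eq, OfNat.ofNat_ne_zero, not_false_eq_true,
        zero_pow] at h1
      simpa only [coef_sub] using h1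
    · filter_upwards [self_mem_nhdsWithin] with t ht k
      rw [Real.norm_eq_abs, abs_of_nonneg (by positivity), coef_sub]
      have h1 := pow_le_pow_left₀ (norm_nonneg _)
        (norm_sub_le (fourierCoef (u t) k) (fourierCoef (u t₀) k)) 2
      nlinarith [sq_nonneg (‖fourierCoef (u t) k‖ - ‖fourierCoef (u t₀) k‖), hub t ht k,
        hub t₀ ht₀ k]
  rw [tsum_zero] at hlim
  have h2 : Tendsto (fun t => ‖u t - u t₀‖) (𝓝[I] t₀) (𝓝 0) := by
    have h3 := (hlim.const_mul (L₁ * L₂)).sqrt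
    simp only [← tsum_normSq_fourierCoef, Real.sqrt_sq (norm_nonneg _), mul_zero,
      Real.sqrt_zero] at h3
    exact h3
  exact tendsto_iff_norm_sub_tendsto_zero.mpr h2

end

/-! ### Existence of the linear evolution by Picard iteration -/

section

variable {s t : ℝ} {G H P Q : ℝ → L2 L₁ L₂} {f₀ : L2 L₁ L₂}

lemma freqSq_sq_ge (k : ℤ × ℤ) : freqSq L₁ L₂ k ^ 2 / 2 - 1 / 2 ≤ freqSq L₁ L₂ k ^ 2 := by
  nlinarith [sq_nonneg (freqSq L₁ L₂ k)]

lemma coef_semigroupHyper (ht : 0 ≤ t) (f : L2 L₁ L₂) (k : ℤ × ℤ) :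
    fourierCoef (semigroupHyper t f) k
      = (Real.exp (-t * freqSq L₁ L₂ k ^ 2) : ℂ) * fourierCoef f k :=
  coef_multiplier (inDomain_expSym_L2 (lam := fun k => freqSq L₁ L₂ k ^ 2)
    (fun k => by simp) freqSq_sq_ge ht f) k

lemma coef_semigroupHyper_of_pos (ht : 0 < t) (f : Torus L₁ L₂ → ℝ) (k : ℤ × ℤ) :
    fourierCoef (semigroupHyper t f) k
      = (Real.exp (-t * freqSq L₁ L₂ k ^ 2) : ℂ) * fourierCoef f k :=
  coef_multiplier (inDomain_expSym (lam := fun k => freqSq L₁ L₂ k ^ 2)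
    (fun k => by simp) freqSq_sq_ge ht f) k

lemma norm_exp_symbol_le_one (ht : 0 ≤ t) (k : ℤ × ℤ) :
    ‖(Real.exp (-t * freqSq L₁ L₂ k ^ 2) : ℂ)‖ ≤ 1 := by
  rw [Complex.norm_real, Real.norm_eq_abs, abs_of_pos (Real.exp_pos _), Real.exp_le_one_iff]
  have := mul_nonneg ht (sq_nonneg (freqSq L₁ L₂ k))
  linarith

lemma normSq_coef_semigroupHyper_le (ht : 0 ≤ t) (f : L2 L₁ L₂) (k : ℤ × ℤ) :
    ‖fourierCoef (semigroupHyper t f) k‖ ^ 2 ≤ ‖fourierCoef f k‖ ^ 2 := by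
  rw [coef_semigroupHyper ht, norm_mul]
  refine pow_le_pow_left₀ (by positivity) ?_ 2
  exact mul_le_of_le_one_left (norm_nonneg _) (norm_exp_symbol_le_one ht k)

lemma norm_le_of_coef_le {f g : L2 L₁ L₂}
    (h : ∀ k, ‖fourierCoef f k‖ ^ 2 ≤ ‖fourierCoef g k‖ ^ 2) : ‖f‖ ≤ ‖g‖ := by
  have hA := area_pos (L₁ := L₁) (L₂ := L₂)
  have := hasSum_le h (hasSum_normSq_fourierCoef f) (hasSum_normSq_fourierCoef g)
  exact le_of_sq_le_sq (le_of_mul_le_mul_left this (inv_pos.mpr hA)) (norm_nonneg _)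

/-- Smoothing of the semigroup, from `y exp (-2 y²) ≤ 1` at `y = √t |k̃|²`. -/
lemma freqSq_mul_normSq_coef_semigroupHyper_le (ht : 0 < t) (f : L2 L₁ L₂) (k : ℤ × ℤ) :
    freqSq L₁ L₂ k * ‖fourierCoef (semigroupHyper t f) k‖ ^ 2
      ≤ t ^ (-(1 / 2) : ℝ) * ‖fourierCoef f k‖ ^ 2 := by
  have hq := freqSq_nonneg (L₁ := L₁) (L₂ := L₂) k
  rw [coef_semigroupHyper ht.le, norm_mul, mul_pow, ← mul_assoc]
  refine mul_le_mul_of_nonneg_right ?_ (by positivity)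
  set q := freqSq L₁ L₂ k
  rw [Complex.norm_real, Real.norm_eq_abs, abs_of_pos (Real.exp_pos _), Real.rpow_neg ht.le,
    ← Real.sqrt_eq_rpow, ← Real.exp_nat_mul, ← one_div, le_div_iff₀ (Real.sqrt_pos.mpr ht)]
  have h1 := Real.sq_sqrt ht.le
  have h2 : √t * q ≤ Real.exp (2 * (t * q ^ 2)) := by
    have := Real.add_one_le_exp (2 * (t * q ^ 2))
    nlinarith [sq_nonneg (√t * q - 1)]
  have h3 : Real.exp ((2 : ℕ) * (-t * q ^ 2)) * Real.exp (2 * (t * q ^ 2)) = 1 := by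
    rw [← Real.exp_add, Real.exp_eq_one_iff]; push_cast; ring
  calc q * Real.exp ((2 : ℕ) * (-t * q ^ 2)) * √t
      = Real.exp ((2 : ℕ) * (-t * q ^ 2)) * (√t * q) := by ring
    _ ≤ Real.exp ((2 : ℕ) * (-t * q ^ 2)) * Real.exp (2 * (t * q ^ 2)) := by gcongr
    _ = 1 := h3

lemma memH1_semigroupHyper (ht : 0 < t) (f : L2 L₁ L₂) : MemH1 (semigroupHyper t f) :=
  memH1_iff.mpr (((hasSum_normSq_fourierCoef f).summable.mul_left _).of_nonneg_of_le
    (fun k => mul_nonneg (freqSq_nonneg k) (by positivity))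
    (freqSq_mul_normSq_coef_semigroupHyper_le ht f))

lemma gradNorm_semigroupHyper_sq_le (ht : 0 < t) (f : L2 L₁ L₂) :
    gradNorm (semigroupHyper t f) ^ 2 ≤ t ^ (-(1 / 2) : ℝ) * ‖f‖ ^ 2 := by
  have hA := area_pos (L₁ := L₁) (L₂ := L₂)
  have := hasSum_le (freqSq_mul_normSq_coef_semigroupHyper_le ht f)
    (hasSum_gradNorm (memH1_semigroupHyper ht f))
    ((hasSum_normSq_fourierCoef f).mul_left _)
  rw [mul_left_comm] at this
  exact le_of_mul_le_mul_left this (inv_pos.mpr hA)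

/-- The path `t ↦ exp (-(t - s) Δ²) f₀ - ∫ₛᵗ exp (-(t - τ) Δ²) G(τ) dτ`. -/
def duhPath (s : ℝ) (f₀ : L2 L₁ L₂) (G : ℝ → L2 L₁ L₂) (t : ℝ) : L2 L₁ L₂ :=
  semigroupHyper (t - s) f₀ - duh s G t

lemma SqInt.coef_duhPath (hG : SqInt s G) (hst : s ≤ t) (k : ℤ × ℤ) :
    fourierCoef (duhPath s f₀ G t) k
      = (Real.exp (-(t - s) * freqSq L₁ L₂ k ^ 2) : ℂ) * fourierCoef f₀ k - duhCoef s G t k := by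
  rw [duhPath, coef_sub, coef_semigroupHyper (sub_nonneg.mpr hst), hG.coef_duh hst]

lemma SqInt.continuousOn_duhPath (hG : SqInt s G) : ContinuousOn (duhPath s f₀ G) (Ici s) := by
  have key : ∀ S, s ≤ S → ContinuousOn (duhPath s f₀ G) (Icc s S) := by
    intro S hsS
    refine continuousOn_of_coef (((hasSum_normSq_fourierCoef f₀).summable.mul_left 2).add
      ((hG.summable hsS).mul_left (2 * (S - s)))) (fun k => ?_) fun t ht k => ?_
    · refine ContinuousOn.congr (f := fun t => (Real.exp (-(t - s) * freqSq L₁ L₂ k ^ 2) : ℂ)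
        * fourierCoef f₀ k - duhCoef s G t k) ?_ fun t ht => hG.coef_duhPath ht.1 k
      exact ContinuousOn.sub (by fun_prop) (hG.continuousOn_duhCoef S hsS k)
    · have h1 := normSq_coef_semigroupHyper_le (sub_nonneg.mpr ht.1) f₀ k
      have h2 := hG.normSq_duhCoef_le ht.1 k
      have h3 : ∫ τ in s..t, ‖fourierCoef (G τ) k‖ ^ 2 ≤ ∫ τ in s..S, ‖fourierCoef (G τ) k‖ ^ 2 :=
        intervalIntegral.integral_mono_interval le_rfl ht.1 ht.2
          (Eventually.of_forall fun τ => by positivity)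
          ((intervalIntegrable_iff_integrableOn_Ioc_of_le hsS).mpr (hG.coef_sq S k))
      have h4 : (t - s) * ∫ τ in s..t, ‖fourierCoef (G τ) k‖ ^ 2
          ≤ (S - s) * ∫ τ in s..S, ‖fourierCoef (G τ) k‖ ^ 2 :=
        mul_le_mul (by linarith [ht.2]) h3
          (intervalIntegral.integral_nonneg ht.1 fun τ _ => by positivity) (by linarith)
      rw [duhPath, coef_sub, hG.coef_duh ht.1]
      have h5 := pow_le_pow_left₀ (norm_nonneg _)
        (norm_sub_le (fourierCoef (semigroupHyper (t - s) f₀) k) (duhCoef s G t k)) 2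
      nlinarith [sq_nonneg (‖fourierCoef (semigroupHyper (t - s) f₀) k‖ - ‖duhCoef s G t k‖)]
  intro t ht
  refine (key (t + 1) (by linarith [mem_Ici.mp ht]) t ⟨ht, by linarith⟩).mono_of_mem_nhdsWithin ?_
  exact mem_nhdsWithin.mpr ⟨Iio (t + 1), isOpen_Iio, by simp, fun x hx => ⟨hx.2, hx.1.le⟩⟩

lemma SqInt.memH1_duhPath (hG : SqInt s G) (hst : s < t) : MemH1 (duhPath s f₀ G t) :=
  memH1_sub (memH1_semigroupHyper (sub_pos.mpr hst) f₀) (hG.memH1_duh hst.le)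

lemma SqInt.gradNorm_duhPath_sq_le (hG : SqInt s G) (hst : s < t) {S : ℝ} (htS : t ≤ S) :
    gradNorm (duhPath s f₀ G t) ^ 2 ≤ 2 * ((t - s) ^ (-(1 / 2) : ℝ) * ‖f₀‖ ^ 2)
      + 2 * ((2 * gap L₁ L₂)⁻¹ * ∫ τ in s..S, ‖G τ‖ ^ 2) := by
  have hgap := gap_pos (L₁ := L₁) (L₂ := L₂)
  have h1 := gradNorm_semigroupHyper_sq_le (sub_pos.mpr hst) f₀
  have h2 := hG.gradNorm_duh_sq_le hst.le
  have h3 : ∫ τ in s..t, ‖G τ‖ ^ 2 ≤ ∫ τ in s..S, ‖G τ‖ ^ 2 :=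
    intervalIntegral.integral_mono_interval le_rfl hst.le htS
      (Eventually.of_forall fun τ => by positivity)
      ((intervalIntegrable_iff_integrableOn_Ioc_of_le (hst.le.trans htS)).mpr (hG.sq S))
  have h4 := mul_le_mul_of_nonneg_left h3 (by positivity : 0 ≤ (2 * gap L₁ L₂)⁻¹)
  have h5 := gradNorm_sub_sq_le (memH1_semigroupHyper (sub_pos.mpr hst) f₀) (hG.memH1_duh hst.le)
  rw [duhPath]
  linarith

lemma SqInt.zero : SqInt s (fun _ => (0 : L2 L₁ L₂)) :=
  ⟨aestronglyMeasurable_const, fun S => by simp⟩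

/-- The Picard map: the transport term produced by the path with transport term `P`. -/
def picard (v : ℝ → Torus L₁ L₂ → ℝ × ℝ) (s : ℝ) (f₀ : L2 L₁ L₂) (P : ℝ → L2 L₁ L₂) (t : ℝ) :
    L2 L₁ L₂ :=
  advectL (v t) (duhPath s f₀ P t)

section

variable {v : ℝ → Torus L₁ L₂ → ℝ × ℝ} {K : ℝ}

lemma SqInt.picard (hv : Measurable (Function.uncurry v)) (hb : ∀ t x, ‖v t x‖ ≤ K)
    (hP : SqInt s P) : SqInt s (picard v s f₀ P) := by
  have hB : ∀ t, BddVel K (v t) := fun t => ⟨hv.comp measurable_prodMk_left, hb t⟩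
  have hm : AEStronglyMeasurable (AdvKS.picard v s f₀ P) (volume.restrict (Ioi s)) := by
    refine aestronglyMeasurable_of_coef fun k => ?_
    refine aestronglyMeasurable_coef_advectL hv hb
      ((ae_restrict_iff' measurableSet_Ioi).mpr (Eventually.of_forall fun t ht =>
        hP.memH1_duhPath ht)) (fun m => ?_) k
    exact ((continuousOn_coef hP.continuousOn_duhPath m).mono
      Ioi_subset_Ici_self).aestronglyMeasurable measurableSet_Ioi
  refine ⟨hm, fun S => ?_⟩
  rcases le_or_gt S s with hSs | hsS
  · simp [Ioc_eq_empty_of_le hSs]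
  have hi : IntervalIntegrable (fun t => (2 * K) ^ 2 * (2 * ((t - s) ^ (-(1 / 2) : ℝ) * ‖f₀‖ ^ 2)
      + 2 * ((2 * gap L₁ L₂)⁻¹ * ∫ τ in s..S, ‖P τ‖ ^ 2))) volume s S := by
    have h1 : IntervalIntegrable (fun t => (t - s) ^ (-(1 / 2) : ℝ)) volume s S := by
      have := (intervalIntegral.intervalIntegrable_rpow' (a := 0) (b := S - s)
        (r := -(1 / 2)) (by norm_num)).comp_sub_right s
      simpa using this
    exact (((h1.mul_const _).const_mul 2).add intervalIntegrable_const).const_mul _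
  refine hi.1.mono' ((hm.mono_measure
    (Measure.restrict_mono Ioc_subset_Ioi_self le_rfl)).norm.pow 2) ?_
  refine (ae_restrict_iff' measurableSet_Ioc).mpr (Eventually.of_forall fun t ht => ?_)
  rw [Real.norm_eq_abs, abs_of_nonneg (by positivity)]
  have h1 := pow_le_pow_left₀ (norm_nonneg _) ((hB t).norm_advectL_le (duhPath s f₀ P t)) 2
  rw [mul_pow] at h1
  refine h1.trans ?_
  exact mul_le_mul_of_nonneg_left (hP.gradNorm_duhPath_sq_le ht.1 ht.2) (by positivity)

/-- The Picard map is a contraction of Volterra type. The summand `1` only serves to make the constant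
positive when `K = 0`. -/
lemma normSq_picard_sub_le (hv : Measurable (Function.uncurry v)) (hb : ∀ t x, ‖v t x‖ ≤ K)
    (hP : SqInt s P) (hQ : SqInt s Q) (hst : s < t) :
    ‖picard v s f₀ P t - picard v s f₀ Q t‖ ^ 2
      ≤ ((2 * K) ^ 2 * (2 * gap L₁ L₂)⁻¹ + 1) * ∫ τ in s..t, ‖P τ - Q τ‖ ^ 2 := by
  have hB : BddVel K (v t) := ⟨hv.comp measurable_prodMk_left, hb t⟩
  have e : picard v s f₀ P t - picard v s f₀ Q t
      = advectL (v t) (duh s (fun τ => Q τ - P τ) t) := by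
    rw [picard, picard, ← hB.advectL_sub (hP.memH1_duhPath hst) (hQ.memH1_duhPath hst),
      duhPath, duhPath, sub_sub_sub_cancel_left, hQ.duh_sub hP hst.le]
  have h1 := pow_le_pow_left₀ (norm_nonneg _)
    (hB.norm_advectL_le (duh s (fun τ => Q τ - P τ) t)) 2
  have h2 := (hQ.sub hP).gradNorm_duh_sq_le hst.le
  have h3 : ∀ τ, ‖Q τ - P τ‖ = ‖P τ - Q τ‖ := fun τ => norm_sub_rev _ _
  simp only [h3] at h2
  have h4 : 0 ≤ ∫ τ in s..t, ‖P τ - Q τ‖ ^ 2 :=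
    intervalIntegral.integral_nonneg hst.le fun τ _ => by positivity
  rw [mul_pow] at h1
  rw [e]
  have h5 := mul_le_mul_of_nonneg_left h2 (sq_nonneg (2 * K))
  rw [add_mul, mul_assoc, one_mul]
  linarith

end

end

section

variable {s t : ℝ} {G H P Q : ℝ → L2 L₁ L₂} {f₀ : L2 L₁ L₂}
variable {v : ℝ → Torus L₁ L₂ → ℝ × ℝ} {K : ℝ}

/-- Iterating `d (n + 1) t ≤ R ∫ₛᵗ d n` gives geometric decay on bounded intervals: the weight
`exp (4 R (t - s))` turns the factor `R ∫ₛᵗ` into `1 / 4`. -/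
lemma geometric_of_integral_le {d : ℕ → ℝ → ℝ} {R s S : ℝ} (hR : 0 < R) (hsS : s ≤ S)
    (hd0 : ∀ n t, 0 ≤ d n t) (hdi : ∀ n, IntegrableOn (d n) (Ioc s S))
    (hd : ∀ n, ∀ t ∈ Ioc s S, d (n + 1) t ≤ R * ∫ τ in s..t, d n τ) (n : ℕ) :
    ∀ t ∈ Icc s S, ∫ τ in s..t, d n τ
      ≤ (∫ τ in s..S, d 0 τ) * Real.exp (4 * R * (t - s)) * (1 / 4) ^ n := by
  have hii : ∀ n, IntervalIntegrable (d n) volume s S := fun n =>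
    (intervalIntegrable_iff_integrableOn_Ioc_of_le hsS).mpr (hdi n)
  set M := ∫ τ in s..S, d 0 τ with hM
  have hM0 : 0 ≤ M := intervalIntegral.integral_nonneg hsS fun τ _ => hd0 0 τ
  induction n with
  | zero =>
    intro t ht
    have h1 : ∫ τ in s..t, d 0 τ ≤ M := intervalIntegral.integral_mono_interval le_rfl ht.1 ht.2
      (Eventually.of_forall (hd0 0)) (hii 0)
    have h2 : 1 ≤ Real.exp (4 * R * (t - s)) :=
      Real.one_le_exp (mul_nonneg (by positivity) (sub_nonneg.mpr ht.1))
    rw [pow_zero, mul_one]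
    nlinarith
  | succ n ih =>
    intro t ht
    have hc : Continuous fun τ : ℝ => R * (M * Real.exp (4 * R * (τ - s)) * (1 / 4) ^ n) := by
      fun_prop
    have h1 : ∫ τ in s..t, d (n + 1) τ
        ≤ ∫ τ in s..t, R * (M * Real.exp (4 * R * (τ - s)) * (1 / 4) ^ n) := by
      refine intervalIntegral.integral_mono_on_of_le_Ioo ht.1
        (IntervalIntegrable.mono_Icc (hii (n + 1)) le_rfl ht.1 ht.2)
        (hc.intervalIntegrable s t) fun τ hτ => ?_
      have hτ' : τ ∈ Ioc s S := ⟨hτ.1, hτ.2.le.trans ht.2⟩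
      exact (hd n τ hτ').trans (mul_le_mul_of_nonneg_left (ih τ ⟨hτ'.1.le, hτ'.2⟩) hR.le)
    have hder : ∀ τ ∈ uIcc s t, HasDerivAt
        (fun τ : ℝ => M * (1 / 4) ^ (n + 1) * Real.exp (4 * R * (τ - s)))
        (R * (M * Real.exp (4 * R * (τ - s)) * (1 / 4) ^ n)) τ := by
      intro τ _
      have a1 : HasDerivAt (fun τ : ℝ => 4 * R * (τ - s)) (4 * R) τ := by
        simpa using ((hasDerivAt_id τ).sub_const s).const_mul (4 * R)
      refine (a1.exp.const_mul (M * (1 / 4) ^ (n + 1))).congr_deriv ?_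
      rw [pow_succ]; ring
    rw [intervalIntegral.integral_eq_sub_of_hasDerivAt hder (hc.intervalIntegrable s t)] at h1
    refine h1.trans ?_
    have h2 : 0 ≤ M * (1 / 4) ^ (n + 1) * Real.exp (4 * R * (s - s)) := by positivity
    linarith

/-- The Picard map has a fixed point. -/
lemma exists_picard_fixed (hv : Measurable (Function.uncurry v)) (hb : ∀ t x, ‖v t x‖ ≤ K)
    (s : ℝ) (f₀ : L2 L₁ L₂) :
    ∃ G : ℝ → L2 L₁ L₂, SqInt s G ∧ ∀ t > s, picard v s f₀ G t = G t := by
  have hgap := gap_pos (L₁ := L₁) (L₂ := L₂)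
  let P : ℕ → ℝ → L2 L₁ L₂ := fun n => (picard v s f₀)^[n] (fun _ => 0)
  have hP1 : ∀ n, P (n + 1) = picard v s f₀ (P n) := fun n => Function.iterate_succ_apply' _ _ _
  have hP : ∀ n, SqInt s (P n) := by
    intro n
    induction n with
    | zero => exact SqInt.zero
    | succ n ih => rw [hP1]; exact ih.picard hv hb
  set R := (2 * K) ^ 2 * (2 * gap L₁ L₂)⁻¹ + 1 with hR
  have hR0 : 0 < R := by positivity
  set d : ℕ → ℝ → ℝ := fun n t => ‖P (n + 1) t - P n t‖ ^ 2 with hd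
  -- On each bounded interval the iterates form a Cauchy sequence with geometric rate `1 / 2`.
  have hdec : ∀ S, s < S → ∃ C : ℝ, 0 ≤ C ∧ ∀ t ∈ Ioc s S, ∀ n,
      dist (P (n + 1) t) (P (n + 2) t) ≤ C * (1 / 2) ^ n := by
    intro S hsS
    have hstep : ∀ n, ∀ t ∈ Ioc s S, d (n + 1) t ≤ R * ∫ τ in s..t, d n τ := by
      intro n t ht
      have := normSq_picard_sub_le (f₀ := f₀) hv hb (hP (n + 1)) (hP n) ht.1
      simp only [hd, hP1 (n + 1)]
      rw [hP1 n] at this ⊢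
      exact this
    have hgeo := geometric_of_integral_le (d := d) hR0 hsS.le (fun n t => by positivity)
      (fun n => ((hP (n + 1)).sub (hP n)).sq S) hstep
    have hM0 : 0 ≤ ∫ τ in s..S, d 0 τ :=
      intervalIntegral.integral_nonneg hsS.le fun τ _ => by positivity
    refine ⟨√(R * ((∫ τ in s..S, d 0 τ) * Real.exp (4 * R * (S - s)))), Real.sqrt_nonneg _,
      fun t ht n => ?_⟩
    have h1 := (hstep n t ht).trans
      (mul_le_mul_of_nonneg_left (hgeo n t ⟨ht.1.le, ht.2⟩) hR0.le)
    have h2 : Real.exp (4 * R * (t - s)) ≤ Real.exp (4 * R * (S - s)) := by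
      have := ht.2
      gcongr
    rw [dist_comm, dist_eq_norm]
    refine le_of_sq_le_sq (h1.trans ?_) (by positivity)
    rw [mul_pow, Real.sq_sqrt (by positivity), ← pow_mul, mul_comm n 2, pow_mul, mul_assoc R]
    have h3 : ((1 : ℝ) / 2) ^ 2 = 1 / 4 := by norm_num
    rw [h3]
    gcongr
  have hlim : ∀ t, ∃ g : L2 L₁ L₂, s < t → Tendsto (fun n => P (n + 1) t) atTop (𝓝 g) := by
    intro t
    by_cases ht : s < t
    · obtain ⟨C, -, hC⟩ := hdec t ht
      obtain ⟨g, hg⟩ := cauchySeq_tendsto_of_complete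
        (cauchySeq_of_le_geometric (1 / 2) C (by norm_num) (hC t ⟨ht, le_rfl⟩))
      exact ⟨g, fun _ => hg⟩
    · exact ⟨0, fun h => absurd h ht⟩
  choose G hG using hlim
  have hrate : ∀ S, s < S → ∃ C : ℝ, 0 ≤ C ∧ ∀ t ∈ Ioc s S, ∀ n,
      ‖G t - P (n + 1) t‖ ≤ C * (1 / 2) ^ n := by
    intro S hsS
    obtain ⟨C, hC0, hC⟩ := hdec S hsS
    refine ⟨2 * C, by positivity, fun t ht n => ?_⟩
    have := dist_le_of_le_geometric_of_tendsto (1 / 2) C (by norm_num) (hC t ht) (hG t ht.1) n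
    rw [dist_comm, dist_eq_norm] at this
    refine this.trans_eq ?_
    ring
  have hGm : AEStronglyMeasurable G (volume.restrict (Ioi s)) :=
    aestronglyMeasurable_of_tendsto_ae atTop (fun n => (hP (n + 1)).meas)
      ((ae_restrict_iff' measurableSet_Ioi).mpr (Eventually.of_forall fun t ht => hG t ht))
  have hGs : SqInt s G := by
    refine ⟨hGm, fun S => ?_⟩
    rcases le_or_gt S s with hSs | hsS
    · simp [Ioc_eq_empty_of_le hSs]
    obtain ⟨C, hC0, hC⟩ := hrate S hsS
    have hb : IntegrableOn (fun t => 2 * C ^ 2 + 2 * ‖P 1 t‖ ^ 2) (Ioc s S) :=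
      (integrable_const _).add (((hP 1).sq S).const_mul 2)
    refine hb.mono' ((hGm.mono_measure
      (Measure.restrict_mono Ioc_subset_Ioi_self le_rfl)).norm.pow 2) ?_
    refine (ae_restrict_iff' measurableSet_Ioc).mpr (Eventually.of_forall fun t ht => ?_)
    rw [Real.norm_eq_abs, abs_of_nonneg (by positivity)]
    have h1 := pow_le_pow_left₀ (norm_nonneg _) (hC t ht 0) 2
    rw [pow_zero, mul_one, zero_add] at h1
    have h2 : ‖G t‖ ≤ ‖G t - P 1 t‖ + ‖P 1 t‖ := by
      simpa using norm_add_le (G t - P 1 t) (P 1 t)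
    nlinarith [norm_nonneg (G t), sq_nonneg (‖G t - P 1 t‖ - ‖P 1 t‖)]
  refine ⟨G, hGs, fun t ht => ?_⟩
  obtain ⟨C, hC0, hC⟩ := hrate t ht
  refine tendsto_nhds_unique ?_ ((hG t ht).comp (tendsto_add_atTop_nat 1))
  rw [tendsto_iff_norm_sub_tendsto_zero]
  have hbound : ∀ n, ‖P (n + 1 + 1) t - picard v s f₀ G t‖ ^ 2
      ≤ R * ((C * (1 / 2) ^ n) ^ 2 * (t - s)) := by
    intro n
    rw [norm_sub_rev, hP1 (n + 1)]
    refine (normSq_picard_sub_le hv hb hGs (hP (n + 1)) ht).trans ?_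
    refine mul_le_mul_of_nonneg_left ?_ hR0.le
    have h1 := intervalIntegral.integral_mono_on_of_le_Ioo ht.le
      ((intervalIntegrable_iff_integrableOn_Ioc_of_le ht.le).mpr ((hGs.sub (hP (n + 1))).sq t))
      (intervalIntegrable_const (μ := volume) (c := (C * (1 / 2) ^ n) ^ 2)) fun τ hτ =>
        pow_le_pow_left₀ (norm_nonneg _) (hC τ ⟨hτ.1, hτ.2.le⟩ n) 2
    refine h1.trans_eq ?_
    rw [intervalIntegral.integral_const, smul_eq_mul, mul_comm]
  have hz : Tendsto (fun n : ℕ => R * ((C * (1 / 2) ^ n) ^ 2 * (t - s))) atTop (𝓝 0) := by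
    have h1 := tendsto_pow_atTop_nhds_zero_of_lt_one (r := (1 / 2 : ℝ)) (by norm_num) (by norm_num)
    have h2 := (((h1.const_mul C).pow 2).mul_const (t - s)).const_mul R
    simpa using h2
  have h3 := (squeeze_zero (fun n => by positivity) hbound hz).sqrt
  simpa [Real.sqrt_sq (norm_nonneg _)] using h3

lemma rpow_quarter_mul_le {r g M : ℝ} (hr : 0 < r)
    (h : r ^ (1 / 2 : ℝ) * g ^ 2 ≤ M) : r ^ (1 / 4 : ℝ) * g ≤ √M := by
  refine Real.le_sqrt_of_sq_le ?_
  rw [mul_pow, ← Real.rpow_natCast, ← Real.rpow_mul hr.le]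
  norm_num
  norm_num at h
  exact h

/-- Existence of the mild solution of the linear equation for a bounded measurable velocity. -/
lemma exists_isLinearSolution_of_bdd (hv : Measurable (Function.uncurry v))
    (hb : ∀ t x, ‖v t x‖ ≤ K) (s : ℝ) (f₀ : L2 L₁ L₂) : ∃ f, IsLinearSolution v s f₀ f := by
  have hgap := gap_pos (L₁ := L₁) (L₂ := L₂)
  obtain ⟨G, hG, hfix⟩ := exists_picard_fixed hv hb s f₀
  have hB : ∀ t, BddVel K (v t) := fun t => ⟨hv.comp measurable_prodMk_left, hb t⟩
  have hcoefG : ∀ t > s, ∀ k, fourierCoef (advect (v t) (duhPath s f₀ G t)) k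
      = fourierCoef (G t) k := fun t ht k => by
    rw [← (hB t).coef_advectL, ← hfix t ht]; rfl
  have hcoef : ∀ t, ∀ τ ∈ Ioo s t, ∀ k,
      fourierCoef (semigroupHyper (t - τ) (advect (v τ) (duhPath s f₀ G τ))) k
        = (Real.exp (-(t - τ) * freqSq L₁ L₂ k ^ 2) : ℂ) * fourierCoef (G τ) k :=
    fun t τ hτ k => by
      rw [coef_semigroupHyper_of_pos (sub_pos.mpr hτ.2), hcoefG τ hτ.1]
  have hint : ∀ t ≥ s, IntervalIntegrable
      (fun τ => semigroupHyper (t - τ) (advect (v τ) (duhPath s f₀ G τ))) volume s t := by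
    intro t ht
    rw [intervalIntegrable_iff_integrableOn_Ioo_of_le ht]
    refine Integrable.mono ((hG.integrable t).mono_set Ioo_subset_Ioc_self) ?_ ?_
    · refine aestronglyMeasurable_of_coef fun k => ?_
      have h1 : AEStronglyMeasurable (fun τ => (Real.exp (-(t - τ) * freqSq L₁ L₂ k ^ 2) : ℂ)
          * fourierCoef (G τ) k) (volume.restrict (Ioo s t)) :=
        AEStronglyMeasurable.mul (Continuous.aestronglyMeasurable (by fun_prop))
          ((hG.coef_meas' t k).mono_measure
            (Measure.restrict_mono Ioo_subset_Ioc_self le_rfl))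
      refine h1.congr ((ae_restrict_iff' measurableSet_Ioo).mpr
        (Eventually.of_forall fun τ hτ => (hcoef t τ hτ k).symm))
    · refine (ae_restrict_iff' measurableSet_Ioo).mpr (Eventually.of_forall fun τ hτ => ?_)
      refine norm_le_of_coef_le fun k => ?_
      rw [hcoef t τ hτ k, norm_mul]
      exact pow_le_pow_left₀ (by positivity) (mul_le_of_le_one_left (norm_nonneg _)
        (norm_exp_symbol_le_one (sub_nonneg.mpr hτ.2.le) k)) 2
  refine ⟨duhPath s f₀ G, hG.continuousOn_duhPath, fun T hT => ?_, hint, fun t ht => ?_⟩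
  · set J := 2 * ((2 * gap L₁ L₂)⁻¹ * ∫ τ in s..T, ‖G τ‖ ^ 2)
    have hJ0 : 0 ≤ J := by
      have : 0 ≤ ∫ τ in s..T, ‖G τ‖ ^ 2 :=
        intervalIntegral.integral_nonneg hT.le fun τ _ => by positivity
      positivity
    refine ⟨√(2 * ‖f₀‖ ^ 2 + (T - s) ^ (1 / 2 : ℝ) * J), fun t ht => ⟨hG.memH1_duhPath ht.1, ?_⟩⟩
    refine rpow_quarter_mul_le (sub_pos.mpr ht.1) ?_
    have h1 := mul_le_mul_of_nonneg_left (hG.gradNorm_duhPath_sq_le (f₀ := f₀) ht.1 ht.2)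
      (Real.rpow_nonneg (sub_nonneg.mpr ht.1.le) (1 / 2 : ℝ))
    have h2 : (t - s) ^ (1 / 2 : ℝ) * (t - s) ^ (-(1 / 2) : ℝ) = 1 := by
      rw [← Real.rpow_add (sub_pos.mpr ht.1)]; simp
    have h3 : (t - s) ^ (1 / 2 : ℝ) ≤ (T - s) ^ (1 / 2 : ℝ) :=
      Real.rpow_le_rpow (sub_nonneg.mpr ht.1.le) (by linarith [ht.2]) (by norm_num)
    refine h1.trans ?_
    have h4 := mul_le_mul_of_nonneg_right h3 hJ0
    have h5 : (t - s) ^ (1 / 2 : ℝ) * (2 * ((t - s) ^ (-(1 / 2) : ℝ) * ‖f₀‖ ^ 2) + J)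
        = 2 * ((t - s) ^ (1 / 2 : ℝ) * (t - s) ^ (-(1 / 2) : ℝ)) * ‖f₀‖ ^ 2
          + (t - s) ^ (1 / 2 : ℝ) * J := by ring
    rw [h2] at h5
    change (t - s) ^ (1 / 2 : ℝ) * (2 * ((t - s) ^ (-(1 / 2) : ℝ) * ‖f₀‖ ^ 2) + J) ≤ _
    rw [h5]
    linarith
  · refine eq_of_coef_eq fun k => ?_
    rw [hG.coef_duhPath ht, coef_sub, coef_semigroupHyper (sub_nonneg.mpr ht)]
    congr 1
    rw [← coefL_apply, ← (coefL k).intervalIntegral_comp_comm (hint t ht), duhCoef,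
      intervalIntegral.integral_of_le ht, intervalIntegral.integral_of_le ht,
      integral_Ioc_eq_integral_Ioo, integral_Ioc_eq_integral_Ioo]
    exact setIntegral_congr_fun measurableSet_Ioo fun τ hτ => (hcoef t τ hτ k).symm

/-- Existence for a velocity field that is bounded at almost every time: setting the field to zero off
a measurable set of full measure does not change the mild solutions. -/
lemma UniformlyLipschitz.exists_isLinearSolution (hv : UniformlyLipschitz v) {s : ℝ} (hs : 0 ≤ s)
    (f₀ : L2 L₁ L₂) : ∃ f, IsLinearSolution v s f₀ f := by
  obtain ⟨hm, K, hK⟩ := hv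
  rw [ae_restrict_iff' measurableSet_Ici, ae_iff] at hK
  obtain ⟨N, hsub, hNm, hN0⟩ := exists_measurable_superset_of_null hK
  classical
  let w : ℝ → Torus L₁ L₂ → ℝ × ℝ := fun t x => if t ∈ Ici (0 : ℝ) \ N then v t x else 0
  have hgood : MeasurableSet (Ici (0 : ℝ) \ N) := measurableSet_Ici.diff hNm
  have hw : Measurable (Function.uncurry w) :=
    Measurable.ite (measurable_fst hgood) hm measurable_const
  have hwb : ∀ t x, ‖w t x‖ ≤ K := by
    intro t x
    by_cases ht : t ∈ Ici (0 : ℝ) \ N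
    · simp only [w, if_pos ht]
      by_contra hcon
      exact ht.2 (hsub fun h => hcon ((h ht.1).2 x))
    · simp only [w, if_neg ht, norm_zero]; exact K.2
  obtain ⟨f, hf⟩ := exists_isLinearSolution_of_bdd hw hwb s f₀
  have hae : ∀ᵐ τ, 0 ≤ τ → w τ = v τ := by
    have : ∀ᵐ τ, τ ∉ N := measure_eq_zero_iff_ae_notMem.mp hN0
    filter_upwards [this] with τ hτ h0
    funext x
    exact if_pos ⟨h0, hτ⟩
  have hcongr : ∀ t ≥ s, ∀ᵐ τ, τ ∈ uIoc s t → semigroupHyper (t - τ) (advect (w τ) (f τ))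
      = semigroupHyper (t - τ) (advect (v τ) (f τ)) := by
    intro t ht
    filter_upwards [hae] with τ hτ hmem
    rw [uIoc_of_le ht] at hmem
    rw [hτ (hs.trans hmem.1.le)]
  refine ⟨f, hf.continuousOn, hf.grad_bound, fun t ht => ?_, fun t ht => ?_⟩
  · exact (hf.integrable t ht).congr_ae
      ((ae_restrict_iff' measurableSet_uIoc).mpr (hcongr t ht))
  · rw [hf.duhamel t ht, intervalIntegral.integral_congr_ae (hcongr t ht)]

end

/-! ### Energy decay of the linear evolution and the dissipation time -/

section

variable {s t : ℝ} {f₀ : L2 L₁ L₂} {f : ℝ → L2 L₁ L₂}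
variable {v : ℝ → Torus L₁ L₂ → ℝ × ℝ} {K : ℝ}

/-- At almost every nonnegative time `v` is bounded by `K` and divergence-free. -/
def GoodVel (K : ℝ) (v : ℝ → Torus L₁ L₂ → ℝ × ℝ) : Prop :=
  ∀ᵐ τ, 0 ≤ τ → BddVel K (v τ) ∧ DivFree (v τ)

lemma UniformlyLipschitz.exists_goodVel (hv : UniformlyLipschitz v) (hd : DivergenceFree v) :
    ∃ K, 0 ≤ K ∧ GoodVel K v := by
  obtain ⟨hm, K, hK⟩ := hv
  rw [ae_restrict_iff' measurableSet_Ici] at hK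
  rw [DivergenceFree, ae_restrict_iff' measurableSet_Ici] at hd
  refine ⟨K, K.2, ?_⟩
  filter_upwards [hK, hd] with τ h1 h2 h0
  exact ⟨⟨hm.comp measurable_prodMk_left, (h1 h0).2⟩, h2 h0⟩

lemma gradNorm_le_of_rpow_mul_le {a s t M : ℝ} {f : L2 L₁ L₂} (hsa : s < a) (hat : a ≤ t)
    (h : (t - s) ^ (1 / 4 : ℝ) * gradNorm f ≤ M) :
    gradNorm f ≤ M / (a - s) ^ (1 / 4 : ℝ) := by
  rw [le_div_iff₀ (Real.rpow_pos_of_pos (sub_pos.mpr hsa) _), mul_comm]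
  refine le_trans (mul_le_mul_of_nonneg_right ?_ (gradNorm_nonneg f)) h
  exact Real.rpow_le_rpow (sub_nonneg.mpr hsa.le) (by linarith) (by norm_num)

lemma norm_coef_le (f : L2 L₁ L₂) (k : ℤ × ℤ) :
    ‖fourierCoef f k‖ ≤ √((L₁ * L₂)⁻¹) * ‖f‖ := by
  have hA := area_pos (L₁ := L₁) (L₂ := L₂)
  refine le_of_sq_le_sq ?_ (by positivity)
  rw [mul_pow, Real.sq_sqrt (by positivity)]
  exact normSq_coef_le f k

lemma IsLinearSolution.hasModes (hf : IsLinearSolution v s f₀ f) (hst : s ≤ t) :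
    f s = f₀ ∧ HasModes f (fun k τ => fourierCoef (advect (v τ) (f τ)) k) s t := by
  have := hasModes_of_duhamel (lam := fun k => freqSq L₁ L₂ k ^ 2) (fun k => by simp)
    freqSq_sq_ge hst (hf.continuousOn.mono Icc_subset_Ici_self)
    (F := fun τ => advect (v τ) (f τ)) (u₀ := f₀) (fun r hr => hf.integrable r hr.1)
    (fun r hr => hf.duhamel r hr.1)
  simpa only [sub_self, Complex.ofReal_zero, zero_mul, add_zero] using this

/-- For positive elapsed times the linear solution is in `H²` almost everywhere in time, and it
satisfies the energy identity, to which the transport term does not contribute. -/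
lemma IsLinearSolution.energy (hf : IsLinearSolution v s f₀ f) (hv : GoodVel K v) (hs : 0 ≤ s)
    {a b : ℝ} (hsa : s < a) (hab : a ≤ b) :
    HasModes f (fun k τ => fourierCoef (advectL (v τ) (f τ)) k) a b ∧
    (∀ᵐ τ, τ ∈ Ioc a b → MemH2 (f τ)) ∧
    IntervalIntegrable (fun τ => ‖lap (f τ)‖ ^ 2) volume a b ∧
    ‖f b‖ ^ 2 = ‖f a‖ ^ 2 - 2 * ∫ τ in a..b, ‖lap (f τ)‖ ^ 2 := by
  have hc : ContinuousOn f (Icc s b) := hf.continuousOn.mono Icc_subset_Ici_self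
  have hc' : ContinuousOn f (Icc a b) := hc.mono (Icc_subset_Icc_left hsa.le)
  have hm := (hf.hasModes (hsa.le.trans hab)).2.mono hc hsa.le hab le_rfl
  have hm' : HasModes f (fun k τ => fourierCoef (advectL (v τ) (f τ)) k) a b := by
    refine hm.congr hab fun k => ?_
    filter_upwards [hv] with τ hτ hmem
    exact ((hτ (hs.trans (hsa.le.trans hmem.1.le))).1.coef_advectL _ k).symm
  obtain ⟨M, hM⟩ := hf.grad_bound b (hsa.trans_le hab)
  have hg : ∀ᵐ τ, τ ∈ Ioc a b →
      ‖advectL (v τ) (f τ)‖ ≤ 2 * K * (M / (a - s) ^ (1 / 4 : ℝ)) := by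
    filter_upwards [hv] with τ hτ hmem
    have hb := (hτ (hs.trans (hsa.le.trans hmem.1.le))).1
    refine (hb.norm_advectL_le _).trans (mul_le_mul_of_nonneg_left ?_
      (by have := hb.nonneg; positivity))
    exact gradNorm_le_of_rpow_mul_le hsa hmem.1.le (hM τ ⟨hsa.trans hmem.1, hmem.2⟩).2
  have hs2 := hm'.summable_H2 (M := √((L₁ * L₂)⁻¹) * (2 * K * (M / (a - s) ^ (1 / 4 : ℝ)))) hab hc'
    fun k => by
      filter_upwards [hg] with τ hτ hmem
      have h1 := (norm_coef_le (advectL (v τ) (f τ)) k).trans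
        (mul_le_mul_of_nonneg_left (hτ hmem) (Real.sqrt_nonneg _))
      have h2 := mul_nonneg (freqSq_nonneg (L₁ := L₁) (L₂ := L₂) k)
        (norm_nonneg (fourierCoef (f τ) k))
      linarith
  obtain ⟨hH2, hlap⟩ := memH2_of_summable hab hc' hs2
  have he := (hm'.energy hab hc' hH2 hlap intervalIntegrable_const hg).2
  have hz : ∫ τ in a..b, inner ℝ (f τ) (advectL (v τ) (f τ)) = 0 := by
    refine intervalIntegral.integral_zero_ae ?_
    filter_upwards [hv, hH2] with τ hτ h2 hmem
    rw [uIoc_of_le hab] at hmem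
    obtain ⟨h3, h4⟩ := hτ (hs.trans (hsa.le.trans hmem.1.le))
    exact h3.inner_advectL h4 (h2 hmem).memH1
  rw [hz, mul_zero, sub_zero] at he
  exact ⟨hm', hH2, hlap, he⟩

/-- The zero mode is conserved because the transport term is a divergence. -/
lemma IsLinearSolution.meanFree (hf : IsLinearSolution v s f₀ f) (hv : GoodVel K v) (hs : 0 ≤ s)
    (h0 : MeanFree f₀) (hst : s ≤ t) : MeanFree (f t) := by
  obtain ⟨h1, h2⟩ := hf.hasModes hst
  rw [meanFree_iff, (h2 0).2 t ⟨hst, le_rfl⟩, h1, h0.coef_zero, zero_sub, neg_eq_zero]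
  rcases hst.eq_or_lt with rfl | hst
  · simp
  obtain ⟨M, hM⟩ := hf.grad_bound t hst
  refine intervalIntegral.integral_zero_ae ?_
  filter_upwards [hv] with τ hτ hmem
  rw [uIoc_of_le hst.le] at hmem
  obtain ⟨h3, h4⟩ := hτ (hs.trans hmem.1.le)
  rw [freqSq_zero, ← h3.coef_advectL, h3.coef_advectL_zero h4 (hM τ hmem).1]
  simp

lemma gap_sq_mul_norm_sq_le {f : L2 L₁ L₂} (h0 : MeanFree f) (h : MemH2 f) :
    gap L₁ L₂ ^ 2 * ‖f‖ ^ 2 ≤ ‖lap f‖ ^ 2 := by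
  have h1 := gap_mul_norm_sq_le h0 h.memH1
  have h2 := gap_mul_gradNorm_sq_le h
  have h3 := mul_le_mul_of_nonneg_left h1 (gap_pos (L₁ := L₁) (L₂ := L₂)).le
  nlinarith

lemma IsLinearSolution.norm_le (hf : IsLinearSolution v s f₀ f) (hv : GoodVel K v) (hs : 0 ≤ s)
    {a b : ℝ} (hsa : s < a) (hab : a ≤ b) : ‖f b‖ ≤ ‖f a‖ := by
  obtain ⟨-, -, -, he⟩ := hf.energy hv hs hsa hab
  have : 0 ≤ ∫ τ in a..b, ‖lap (f τ)‖ ^ 2 :=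
    intervalIntegral.integral_nonneg hab fun τ _ => by positivity
  exact le_of_sq_le_sq (by linarith) (norm_nonneg _)

/-- Algebraic decay of mean-free solutions, at a rate that depends on the torus only. -/
lemma IsLinearSolution.decay (hf : IsLinearSolution v s f₀ f) (hv : GoodVel K v) (hs : 0 ≤ s)
    (h0 : MeanFree f₀) (hst : s < t) :
    ‖f t‖ ^ 2 * (1 + 2 * gap L₁ L₂ ^ 2 * (t - s)) ≤ ‖f₀‖ ^ 2 := by
  have key : ∀ a ∈ Ioc s t, ‖f t‖ ^ 2 * (1 + 2 * gap L₁ L₂ ^ 2 * (t - a)) ≤ ‖f a‖ ^ 2 := by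
    intro a ha
    obtain ⟨-, hH2, hlap, he⟩ := hf.energy hv hs ha.1 ha.2
    have h1 : ∫ _ in a..t, gap L₁ L₂ ^ 2 * ‖f t‖ ^ 2 ≤ ∫ τ in a..t, ‖lap (f τ)‖ ^ 2 := by
      refine intervalIntegral.integral_mono_ae_restrict ha.2 intervalIntegrable_const hlap ?_
      rw [EventuallyLE, ae_restrict_iff' measurableSet_Icc]
      have hne : ∀ᵐ τ : ℝ, τ ≠ a := by simp [ae_iff]
      filter_upwards [hH2, hne] with τ h2 hτa hmem
      have hτ : τ ∈ Ioc a t := ⟨lt_of_le_of_ne hmem.1 (Ne.symm hτa), hmem.2⟩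
      have h3 := hf.norm_le hv hs (ha.1.trans hτ.1) hτ.2
      have h4 := pow_le_pow_left₀ (norm_nonneg _) h3 2
      exact (mul_le_mul_of_nonneg_left h4 (by positivity)).trans
        (gap_sq_mul_norm_sq_le (hf.meanFree hv hs h0 (ha.1.trans hτ.1).le) (h2 hτ))
    rw [intervalIntegral.integral_const, smul_eq_mul] at h1
    nlinarith
  have hc : Tendsto (fun a => ‖f a‖ ^ 2) (𝓝[>] s) (𝓝 (‖f₀‖ ^ 2)) := by
    rw [← (hf.hasModes le_rfl).1]
    exact (((hf.continuousOn s self_mem_Ici).mono Ioi_subset_Ici_self).norm).pow 2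
  have hl : Tendsto (fun a => ‖f t‖ ^ 2 * (1 + 2 * gap L₁ L₂ ^ 2 * (t - a))) (𝓝[>] s)
      (𝓝 (‖f t‖ ^ 2 * (1 + 2 * gap L₁ L₂ ^ 2 * (t - s)))) :=
    (Continuous.tendsto (by fun_prop) s).mono_left nhdsWithin_le_nhds
  refine le_of_tendsto_of_tendsto hl hc ?_
  filter_upwards [Ioc_mem_nhdsGT hst] with a ha using key a ha

/-- The infimum defining the dissipation time is attained: the linear solution halves its norm over it. -/
lemma exists_isLinearSolution_half (hv : UniformlyLipschitz v) (hd : DivergenceFree v)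
    (hs : 0 ≤ s) (h0 : MeanFree f₀) :
    ∃ f, IsLinearSolution v s f₀ f ∧ ‖f (s + dissipationTime v)‖ ≤ 1 / 2 * ‖f₀‖ := by
  obtain ⟨K, -, hK⟩ := hv.exists_goodVel hd
  have hgap := gap_pos (L₁ := L₁) (L₂ := L₂)
  have hop : ∀ s ≥ 0, ∀ f₀ : L2 L₁ L₂, ∃ f, IsLinearSolution v s f₀ f ∧
      ∀ t, solutionOp v s t f₀ = f t := fun s hs f₀ => by
    have h := hv.exists_isLinearSolution hs f₀
    exact ⟨h.choose, h.choose_spec, fun t => by rw [solutionOp, dif_pos h]⟩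
  set D := {t : ℝ | 0 ≤ t ∧ ∀ s ≥ 0, ∀ f : L2 L₁ L₂, MeanFree f →
    ‖solutionOp v s (s + t) f‖ ≤ 1 / 2 * ‖f‖} with hD
  have hne : D.Nonempty := by
    refine ⟨2 / gap L₁ L₂ ^ 2, by positivity, fun s hs f₀ h0 => ?_⟩
    obtain ⟨f, hf, hfe⟩ := hop s hs f₀
    rw [hfe]
    have h1 := hf.decay hK hs h0 (t := s + 2 / gap L₁ L₂ ^ 2)
      (lt_add_of_pos_right s (by positivity))
    have h2 : 2 * gap L₁ L₂ ^ 2 * (s + 2 / gap L₁ L₂ ^ 2 - s) = 4 := by field_simp; ring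
    rw [h2] at h1
    refine le_of_sq_le_sq ?_ (by positivity)
    rw [mul_pow]
    nlinarith [sq_nonneg ‖f (s + 2 / gap L₁ L₂ ^ 2)‖]
  have hcl : IsClosed D := by
    have e : D = Ici 0 ∩ ⋂ (s : ℝ) (_ : s ≥ 0) (f : L2 L₁ L₂) (_ : MeanFree f),
        (Ici 0 ∩ (fun t => ‖solutionOp v s (s + t) f‖) ⁻¹' Iic (1 / 2 * ‖f‖)) := by
      ext t
      simp only [hD, mem_ofPred_eq, mem_inter_iff, mem_iInter, mem_Ici, mem_preimage, mem_Iic]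
      exact ⟨fun h => ⟨h.1, fun s hs f hf => ⟨h.1, h.2 s hs f hf⟩⟩,
        fun h => ⟨h.1, fun s hs f hf => (h.2 s hs f hf).2⟩⟩
    rw [e]
    refine isClosed_Ici.inter (isClosed_iInter fun s => isClosed_iInter fun hs =>
      isClosed_iInter fun f₀ => isClosed_iInter fun _ => ?_)
    obtain ⟨f, hf, hfe⟩ := hop s hs f₀
    simp only [hfe]
    refine ContinuousOn.preimage_isClosed_of_isClosed ?_ isClosed_Ici isClosed_Iic
    refine (hf.continuousOn.comp (by fun_prop) fun t ht => ?_).norm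
    exact le_add_of_nonneg_right (mem_Ici.mp ht)
  have hmem : dissipationTime v ∈ D := hcl.csInf_mem hne ⟨0, fun t ht => ht.1⟩
  obtain ⟨f, hf, hfe⟩ := hop s hs f₀
  exact ⟨f, hf, by rw [← hfe]; exact hmem.2 s hs f₀ h0⟩

lemma dissipationTime_nonneg : 0 ≤ dissipationTime v := Real.sInf_nonneg fun _ ht => ht.1

/-- The dissipation time is positive, since the solution operator over zero time is the identity. -/
lemma dissipationTime_pos (hv : UniformlyLipschitz v) (hd : DivergenceFree v)
    (h0 : MeanFree f₀) (hne : f₀ ≠ 0) : 0 < dissipationTime v := by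
  refine lt_of_le_of_ne dissipationTime_nonneg fun h => hne ?_
  obtain ⟨f, hf, hfe⟩ := exists_isLinearSolution_half hv hd le_rfl h0
  rw [← h, add_zero, (hf.hasModes le_rfl).1] at hfe
  exact norm_le_zero_iff.mp (by linarith)

end

/-! ### Energy estimates for mild solutions of the nonlinear equation -/

open Classical in
/-- `N(f)` as an element of `L²`; it is `0` if `N(f)` is not square-integrable. -/
def opNL (f : L2 L₁ L₂) : L2 L₁ L₂ := if h : MemLp (opN f) 2 volume then h.toLp _ else 0

section

variable {C K : ℝ} {f : L2 L₁ L₂} {w : Torus L₁ L₂ → ℝ × ℝ}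

lemma NEstimates.opNL_ae_eq (hN : NEstimates L₁ L₂ C) (h0 : MeanFree f) (h2 : MemH2 f) :
    opNL f =ᵐ[volume] opN f := by
  have h := (hN f h0 h2).1
  rw [opNL, dif_pos h]
  exact h.coeFn_toLp

lemma NEstimates.norm_opNL_le (hN : NEstimates L₁ L₂ C) (h0 : MeanFree f) (h2 : MemH2 f) :
    ‖opNL f‖ ≤ C * ‖lap f‖ ^ 2 + C * ‖lap f‖ := by
  obtain ⟨h, -, h3⟩ := hN f h0 h2
  rw [opNL, dif_pos h, Lp.norm_toLp]
  exact h3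

lemma NEstimates.abs_inner_opNL_le (hN : NEstimates L₁ L₂ C) (h0 : MeanFree f) (h2 : MemH2 f) :
    |inner ℝ f (opNL f)| ≤ ‖lap f‖ ^ 2 / 2 + C * ‖f‖ ^ 2 + C * ‖f‖ ^ 6 := by
  have e : ∫ x, f x * opNL f x = ∫ x, f x * opN f x := by
    refine integral_congr_ae ?_
    filter_upwards [hN.opNL_ae_eq h0 h2] with x hx
    rw [hx]
  rw [inner_eq_integral, e]
  exact (hN f h0 h2).2.1

lemma integrable_gradSq (f : L2 L₁ L₂) : Integrable (gradSq f) :=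
  (Lp.memLp (D₁ f)).integrable_sq.add (Lp.memLp (D₂ f)).integrable_sq

lemma integral_gradSq (f : L2 L₁ L₂) : ∫ x, gradSq f x = gradNorm f ^ 2 := by
  have h1 := inner_eq_integral (D₁ f) (D₁ f)
  have h2 := inner_eq_integral (D₂ f) (D₂ f)
  rw [real_inner_self_eq_norm_sq] at h1 h2
  simp only [← sq] at h1 h2
  rw [gradNorm_sq, h1, h2]
  exact integral_add (Lp.memLp (D₁ f)).integrable_sq (Lp.memLp (D₂ f)).integrable_sq

lemma integrable_gradSq_sub (f : L2 L₁ L₂) :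
    Integrable (fun x => (gradSq f x - average (gradSq f)) / 2) :=
  ((integrable_gradSq f).sub (integrable_const _)).div_const 2

lemma integral_abs_gradSq_sub_le (f : L2 L₁ L₂) :
    ∫ x, |(gradSq f x - average (gradSq f)) / 2| ≤ gradNorm f ^ 2 := by
  have hA := area_pos (L₁ := L₁) (L₂ := L₂)
  have h0 : ∀ x, 0 ≤ gradSq f x := fun x => by unfold gradSq; positivity
  have ha : average (gradSq f) = (L₁ * L₂)⁻¹ * gradNorm f ^ 2 := by
    rw [average, integral_gradSq]
  have ha0 : 0 ≤ average (gradSq f) := by rw [ha]; positivity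
  have h1 : ∫ x, |(gradSq f x - average (gradSq f)) / 2|
      ≤ ∫ x, (gradSq f x / 2 + average (gradSq f) / 2) := by
    refine integral_mono (integrable_gradSq_sub f).abs
      (((integrable_gradSq f).div_const 2).add (integrable_const _)) fun x => ?_
    have := h0 x
    rw [abs_le]
    constructor <;> linarith
  refine h1.trans_eq ?_
  rw [integral_add ((integrable_gradSq f).div_const 2) (integrable_const _), integral_div,
    integral_gradSq, integral_const, measureReal_univ_torus, smul_eq_mul, ha]
  have := hL₁.out.ne'
  have := hL₂.out.ne'
  field_simp
  ring

lemma BddVel.coef_forcing (hw : BddVel K w) (f : L2 L₁ L₂) (k : ℤ × ℤ) :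
    fourierCoef (forcing w f) k = fourierCoef (fun x => (gradSq f x - average (gradSq f)) / 2) k
      + fourierCoef (advectL w f) k := by
  rw [hw.coef_advectL]
  exact fourierCoef_add (integrable_gradSq_sub f)
    ((hw.memLp_advect f).integrable one_le_two) k

lemma BddVel.norm_coef_forcing_le (hw : BddVel K w) (f : L2 L₁ L₂) (k : ℤ × ℤ) :
    ‖fourierCoef (forcing w f) k‖ ≤ (L₁ * L₂)⁻¹ * gradNorm f ^ 2
      + √((L₁ * L₂)⁻¹) * (2 * K * gradNorm f) := by
  have hA := area_pos (L₁ := L₁) (L₂ := L₂)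
  rw [hw.coef_forcing]
  refine (norm_add_le _ _).trans (add_le_add ?_ ?_)
  · exact (norm_fourierCoef_le _ k).trans
      (mul_le_mul_of_nonneg_left (integral_abs_gradSq_sub_le f) (by positivity))
  · exact (norm_coef_le _ k).trans
      (mul_le_mul_of_nonneg_left (hw.norm_advectL_le f) (Real.sqrt_nonneg _))

lemma NEstimates.coef_opNL (hN : NEstimates L₁ L₂ C) (h0 : MeanFree f) (h2 : MemH2 f)
    (k : ℤ × ℤ) : fourierCoef (opNL f) k
      = fourierCoef (fun x => (gradSq f x - average (gradSq f)) / 2) k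
        - (freqSq L₁ L₂ k : ℂ) * fourierCoef f k := by
  rw [fourierCoef_congr_ae (hN.opNL_ae_eq h0 h2), sub_eq_add_neg, ← neg_mul, ← coef_lap h2]
  have e : opN f = fun x => (gradSq f x - average (gradSq f)) / 2 + lap f x := by
    funext x; unfold opN; ring
  rw [e]
  exact fourierCoef_add (integrable_gradSq_sub f) ((Lp.memLp (lap f)).integrable one_le_two) k

end

section

variable {C K T : ℝ} {v : ℝ → Torus L₁ L₂ → ℝ × ℝ} {ψ : ℝ → L2 L₁ L₂} {a b : ℝ}

lemma IsMildSolution.hasModes (hψ : IsMildSolution v T ψ) (hT : 0 ≤ T) :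
    HasModes ψ (fun k τ => fourierCoef (forcing (v τ) (ψ τ)) k
      - (freqSq L₁ L₂ k : ℂ) * fourierCoef (ψ τ) k) 0 T := by
  have hlam : ∀ k, freqSq L₁ L₂ k ^ 2 / 2 - 1 / 2 ≤ freqSq L₁ L₂ k ^ 2 - freqSq L₁ L₂ k :=
    fun k => by nlinarith [sq_nonneg (freqSq L₁ L₂ k - 1)]
  have := (hasModes_of_duhamel (lam := fun k => freqSq L₁ L₂ k ^ 2 - freqSq L₁ L₂ k)
    (fun k => by simp) hlam hT hψ.continuousOn
    (F := fun τ => forcing (v τ) (ψ τ)) (u₀ := ψ 0) (fun r hr => hψ.integrable r hr)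
    (fun r hr => by rw [sub_zero]; exact hψ.duhamel r hr)).2
  have e : (fun (k : ℤ × ℤ) τ => fourierCoef (forcing (v τ) (ψ τ)) k
      + ((freqSq L₁ L₂ k ^ 2 - freqSq L₁ L₂ k - freqSq L₁ L₂ k ^ 2 : ℝ) : ℂ)
        * fourierCoef (ψ τ) k) = fun k τ => fourierCoef (forcing (v τ) (ψ τ)) k
      - (freqSq L₁ L₂ k : ℂ) * fourierCoef (ψ τ) k := by
    funext k τ
    rw [sub_sub_cancel_left, Complex.ofReal_neg, neg_mul, sub_eq_add_neg]
  rw [e] at this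
  exact this

/-- For positive times the mild solution is in `H²` almost everywhere in time, and it solves the
equation mode by mode with the nonlinearity and the transport term in `L²`. -/
lemma IsMildSolution.regularity (hN : NEstimates L₁ L₂ C) (hψ : IsMildSolution v T ψ)
    (hv : GoodVel K v) (ha : 0 < a) (hab : a ≤ b) (hbT : b ≤ T) :
    HasModes ψ (fun k τ => fourierCoef (opNL (ψ τ) + advectL (v τ) (ψ τ) : L2 L₁ L₂) k) a b ∧
    (∀ᵐ τ, τ ∈ Ioc a b → MemH2 (ψ τ)) ∧
    IntervalIntegrable (fun τ => ‖lap (ψ τ)‖ ^ 2) volume a b ∧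
    ∃ M, ∀ᵐ τ, τ ∈ Ioc a b → ‖advectL (v τ) (ψ τ)‖ ≤ M := by
  have hA := area_pos (L₁ := L₁) (L₂ := L₂)
  have hc : ContinuousOn ψ (Icc a b) := hψ.continuousOn.mono (Icc_subset_Icc ha.le hbT)
  have hm := (hψ.hasModes (ha.le.trans (hab.trans hbT))).mono hψ.continuousOn ha.le hab hbT
  obtain ⟨M, hM⟩ := hψ.grad_bound
  set M' := M / a ^ (1 / 4 : ℝ) with hM'
  have hgr : ∀ τ ∈ Ioc a b, gradNorm (ψ τ) ≤ M' := fun τ hτ => by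
    have := gradNorm_le_of_rpow_mul_le (s := 0) ha hτ.1.le (f := ψ τ) (M := M)
      (by rw [sub_zero]; exact (hM τ ⟨ha.trans hτ.1, hτ.2.trans hbT⟩).2)
    rwa [sub_zero] at this
  have hs2 := hm.summable_H2 (M := (L₁ * L₂)⁻¹ * M' ^ 2 + √((L₁ * L₂)⁻¹) * (2 * K * M')) hab hc
    fun k => by
      filter_upwards [hv] with τ hτ hmem
      have hb := (hτ (ha.trans hmem.1).le).1
      have hK := hb.nonneg
      have h1 := hgr τ hmem
      have h2 := gradNorm_nonneg (ψ τ)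
      have h3 := hb.norm_coef_forcing_le (ψ τ) k
      have h4 : (L₁ * L₂)⁻¹ * gradNorm (ψ τ) ^ 2 + √((L₁ * L₂)⁻¹) * (2 * K * gradNorm (ψ τ))
          ≤ (L₁ * L₂)⁻¹ * M' ^ 2 + √((L₁ * L₂)⁻¹) * (2 * K * M') := by gcongr
      refine (norm_sub_le _ _).trans (add_le_add (h3.trans h4) ?_)
      rw [norm_mul, Complex.norm_real, Real.norm_eq_abs, abs_of_nonneg (freqSq_nonneg k)]
  obtain ⟨hH2, hlap⟩ := memH2_of_summable hab hc hs2
  refine ⟨hm.congr hab fun k => ?_, hH2, hlap, 2 * K * M', ?_⟩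
  · filter_upwards [hv, hH2] with τ hτ h2 hmem
    have h0 := hψ.meanFree τ ⟨(ha.trans hmem.1).le, hmem.2.trans hbT⟩
    rw [(hτ (ha.trans hmem.1).le).1.coef_forcing, coef_add, hN.coef_opNL h0 (h2 hmem)]
    ring
  · filter_upwards [hv] with τ hτ hmem
    have hb := (hτ (ha.trans hmem.1).le).1
    exact (hb.norm_advectL_le _).trans
      (mul_le_mul_of_nonneg_left (hgr τ hmem) (by have := hb.nonneg; positivity))

lemma intervalIntegrable_norm_lap
    (h : IntervalIntegrable (fun τ => ‖lap (ψ τ)‖ ^ 2) volume a b) :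
    IntervalIntegrable (fun τ => ‖lap (ψ τ)‖) volume a b := by
  have hm : AEStronglyMeasurable (fun τ => ‖lap (ψ τ)‖) (volume.restrict (uIoc a b)) := by
    have := h.def'.1.aemeasurable.sqrt.aestronglyMeasurable
    simpa only [Real.sqrt_sq (norm_nonneg _)] using this
  refine (h.add (intervalIntegrable_const (c := (1 : ℝ)))).mono_fun hm
    (Eventually.of_forall fun τ => ?_)
  simp only [Real.norm_eq_abs, abs_norm]
  rw [abs_of_nonneg (by positivity)]
  nlinarith [sq_nonneg (‖lap (ψ τ)‖ - 1)]

/-- The energy inequality; the transport term does not contribute. -/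
lemma IsMildSolution.energy_le (hN : NEstimates L₁ L₂ C) (hψ : IsMildSolution v T ψ)
    (hv : GoodVel K v) (ha : 0 < a) (hab : a ≤ b) (hbT : b ≤ T) :
    ‖ψ b‖ ^ 2 + ∫ τ in a..b, ‖lap (ψ τ)‖ ^ 2
      ≤ ‖ψ a‖ ^ 2 + 2 * C * ∫ τ in a..b, (‖ψ τ‖ ^ 2 + ‖ψ τ‖ ^ 6) := by
  have hc : ContinuousOn ψ (Icc a b) := hψ.continuousOn.mono (Icc_subset_Icc ha.le hbT)
  obtain ⟨hm, hH2, hlap, M, hM⟩ := hψ.regularity hN hv ha hab hbT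
  have h0 : ∀ τ ∈ Ioc a b, MeanFree (ψ τ) := fun τ hτ =>
    hψ.meanFree τ ⟨(ha.trans hτ.1).le, hτ.2.trans hbT⟩
  have hg : ∀ᵐ τ, τ ∈ Ioc a b → ‖opNL (ψ τ) + advectL (v τ) (ψ τ)‖
      ≤ C * ‖lap (ψ τ)‖ ^ 2 + C * ‖lap (ψ τ)‖ + M := by
    filter_upwards [hH2, hM] with τ h2 h3 hmem
    exact (norm_add_le _ _).trans
      (add_le_add (hN.norm_opNL_le (h0 τ hmem) (h2 hmem)) (h3 hmem))
  obtain ⟨hi, he⟩ := hm.energy hab hc hH2 hlap (((hlap.const_mul C).add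
    ((intervalIntegrable_norm_lap hlap).const_mul C)).add intervalIntegrable_const) hg
  have hpoly : IntervalIntegrable (fun τ => ‖ψ τ‖ ^ 2 + ‖ψ τ‖ ^ 6) volume a b :=
    intervalIntegrable_of_continuousOn_Icc hab ((hc.norm.pow 2).add (hc.norm.pow 6))
  have hmono : ∫ τ in a..b, -inner ℝ (ψ τ) (opNL (ψ τ) + advectL (v τ) (ψ τ))
      ≤ ∫ τ in a..b, (‖lap (ψ τ)‖ ^ 2 / 2 + C * (‖ψ τ‖ ^ 2 + ‖ψ τ‖ ^ 6)) := by
    rw [intervalIntegral.integral_of_le hab, intervalIntegral.integral_of_le hab]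
    refine integral_mono_ae hi.neg.1 ((hlap.div_const 2).add (hpoly.const_mul C)).1 ?_
    refine (ae_restrict_iff' measurableSet_Ioc).mpr ?_
    filter_upwards [hH2, hv] with τ h2 hτ hmem
    obtain ⟨h3, h4⟩ := hτ (ha.trans hmem.1).le
    have h5 := (abs_le.mp (hN.abs_inner_opNL_le (h0 τ hmem) (h2 hmem))).1
    simp only [inner_add_right, h3.inner_advectL h4 (h2 hmem).memH1, add_zero]
    linarith
  rw [intervalIntegral.integral_neg, intervalIntegral.integral_add (hlap.div_const 2)
    (hpoly.const_mul C), intervalIntegral.integral_div, intervalIntegral.integral_const_mul] at hmono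
  linarith

/-- The nonlinear solution stays close to the linear solution issued from the same data: their
difference is driven by `N(ψ)` alone. -/
lemma IsMildSolution.norm_sub_le (hN : NEstimates L₁ L₂ C) (hC : 0 ≤ C)
    (hψ : IsMildSolution v T ψ) (hv : GoodVel K v) {t₀ : ℝ} {f₀ : L2 L₁ L₂} {f : ℝ → L2 L₁ L₂}
    (hf : IsLinearSolution v t₀ f₀ f) (ht₀ : 0 ≤ t₀) (ha : t₀ < a) (hab : a ≤ b) (hbT : b ≤ T) :
    ‖ψ b - f b‖ ≤ ‖ψ a - f a‖
      + 2 * ∫ τ in a..b, (C * ‖lap (ψ τ)‖ ^ 2 + C * ‖lap (ψ τ)‖) := by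
  have ha0 : 0 < a := ht₀.trans_lt ha
  set η : ℝ → ℝ := fun τ => C * ‖lap (ψ τ)‖ ^ 2 + C * ‖lap (ψ τ)‖ with hη
  have hη0 : ∀ τ, 0 ≤ η τ := fun τ => by positivity
  have hlapψ := (hψ.regularity hN hv ha0 hab hbT).2.2.1
  have hηi : IntervalIntegrable η volume a b :=
    (hlapψ.const_mul C).add ((intervalIntegrable_norm_lap hlapψ).const_mul C)
  have hcψ : ContinuousOn ψ (Icc a b) := hψ.continuousOn.mono (Icc_subset_Icc ha0.le hbT)
  have hcf : ContinuousOn f (Icc a b) :=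
    hf.continuousOn.mono fun τ hτ => ha.le.trans hτ.1
  have hcw : ContinuousOn (fun τ => ‖ψ τ - f τ‖) (Icc a b) := (hcψ.sub hcf).norm
  -- Let the norm of the difference be maximal over `[a, b]` at `c`.
  obtain ⟨c, hc, hmax⟩ := isCompact_Icc.exists_isMaxOn (nonempty_Icc.mpr hab) hcw
  set m := ‖ψ c - f c‖ with hm
  have hle : ∀ τ ∈ Icc a b, ‖ψ τ - f τ‖ ≤ m := fun τ hτ => hmax hτ
  obtain ⟨hmψ, hH2ψ, hlψ, M, hM⟩ := hψ.regularity hN hv ha0 hc.1 (hc.2.trans hbT)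
  obtain ⟨hmf, hH2f, hlf, -⟩ := hf.energy hv ht₀ ha hc.1
  have hcψ' := hcψ.mono (Icc_subset_Icc_right hc.2)
  have hcf' := hcf.mono (Icc_subset_Icc_right hc.2)
  have h0 : ∀ τ ∈ Ioc a c, MeanFree (ψ τ) := fun τ hτ =>
    hψ.meanFree τ ⟨(ha0.trans hτ.1).le, hτ.2.trans (hc.2.trans hbT)⟩
  have hmw : HasModes (fun τ => ψ τ - f τ) (fun k τ =>
      fourierCoef (opNL (ψ τ) + advectL (v τ) (ψ τ - f τ) : L2 L₁ L₂) k) a c := by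
    refine (hmψ.sub hc.1 hcψ' hcf' hmf).congr hc.1 fun k => ?_
    filter_upwards [hv, hH2ψ, hH2f] with τ hτ h1 h2 hmem
    rw [(hτ (ha0.trans hmem.1).le).1.advectL_sub (h1 hmem).memH1 (h2 hmem).memH1, coef_add,
      coef_add, coef_sub]
    ring
  have hH2w : ∀ᵐ τ, τ ∈ Ioc a c → MemH2 (ψ τ - f τ) := by
    filter_upwards [hH2ψ, hH2f] with τ h1 h2 hmem
    exact memH2_sub (h1 hmem) (h2 hmem)
  have hlw : IntervalIntegrable (fun τ => ‖lap (ψ τ - f τ)‖ ^ 2) volume a c := by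
    have hmeas : AEStronglyMeasurable (fun τ => lap (ψ τ - f τ)) (volume.restrict (Ioc a c)) := by
      refine aestronglyMeasurable_of_coef fun k => ?_
      have h1 : AEStronglyMeasurable (fun τ => -(freqSq L₁ L₂ k : ℂ)
          * fourierCoef (ψ τ - f τ : L2 L₁ L₂) k) (volume.restrict (Ioc a c)) :=
        ((continuousOn_const.mul (continuousOn_coef (hcψ'.sub hcf') k)).mono
          Ioc_subset_Icc_self).aestronglyMeasurable measurableSet_Ioc
      refine h1.congr ((ae_restrict_iff' measurableSet_Ioc).mpr ?_)
      filter_upwards [hH2w] with τ h2 hmem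
      exact (coef_lap (h2 hmem) k).symm
    rw [intervalIntegrable_iff_integrableOn_Ioc_of_le hc.1]
    refine ((hlψ.const_mul 2).add (hlf.const_mul 2)).1.mono' (hmeas.norm.pow 2)
      ((ae_restrict_iff' measurableSet_Ioc).mpr ?_)
    filter_upwards [hH2ψ, hH2f] with τ h1 h2 hmem
    rw [Real.norm_eq_abs, abs_of_nonneg (by positivity), lap_sub (h1 hmem) (h2 hmem)]
    exact sq_norm_sub_le _ _
  obtain ⟨M', hM'⟩ : ∃ M', ∀ᵐ τ, τ ∈ Ioc a c → ‖advectL (v τ) (ψ τ - f τ)‖ ≤ M' := by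
    obtain ⟨Mf, hMf⟩ := hf.grad_bound c (ha.trans_le hc.1)
    refine ⟨M + 2 * K * (Mf / (a - t₀) ^ (1 / 4 : ℝ)), ?_⟩
    filter_upwards [hv, hM, hH2ψ, hH2f] with τ hτ h1 h2 h3 hmem
    have hb := (hτ (ha0.trans hmem.1).le).1
    rw [hb.advectL_sub (h2 hmem).memH1 (h3 hmem).memH1]
    refine (_root_.norm_sub_le _ _).trans (add_le_add (h1 hmem) ((hb.norm_advectL_le _).trans ?_))
    exact mul_le_mul_of_nonneg_left (gradNorm_le_of_rpow_mul_le ha hmem.1.le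
      (hMf τ ⟨ha.trans hmem.1, hmem.2⟩).2) (by have := hb.nonneg; positivity)
  have hηc : IntervalIntegrable η volume a c := IntervalIntegrable.mono_Icc hηi le_rfl hc.1 hc.2
  have hg : ∀ᵐ τ, τ ∈ Ioc a c → ‖opNL (ψ τ) + advectL (v τ) (ψ τ - f τ)‖ ≤ η τ + M' := by
    filter_upwards [hH2ψ, hM'] with τ h2 h3 hmem
    exact (norm_add_le _ _).trans
      (add_le_add (hN.norm_opNL_le (h0 τ hmem) (h2 hmem)) (h3 hmem))
  obtain ⟨hi, he⟩ := hmw.energy hc.1 (hcψ'.sub hcf') hH2w hlw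
    (hηc.add intervalIntegrable_const) hg
  have hmono : ∫ τ in a..c, -inner ℝ (ψ τ - f τ) (opNL (ψ τ) + advectL (v τ) (ψ τ - f τ))
      ≤ ∫ τ in a..c, m * η τ := by
    rw [intervalIntegral.integral_of_le hc.1, intervalIntegral.integral_of_le hc.1]
    refine integral_mono_ae hi.neg.1 (hηc.const_mul m).1 ?_
    refine (ae_restrict_iff' measurableSet_Ioc).mpr ?_
    filter_upwards [hH2ψ, hH2w, hv] with τ h1 h2 hτ hmem
    obtain ⟨h3, h4⟩ := hτ (ha0.trans hmem.1).le
    simp only [inner_add_right, h3.inner_advectL h4 (h2 hmem).memH1, add_zero]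
    refine (neg_le_abs _).trans ((abs_real_inner_le_norm _ _).trans ?_)
    exact mul_le_mul (hle τ ⟨hmem.1.le, hmem.2.trans hc.2⟩)
      (hN.norm_opNL_le (h0 τ hmem) (h1 hmem)) (norm_nonneg _) (norm_nonneg _)
  rw [intervalIntegral.integral_neg, intervalIntegral.integral_const_mul] at hmono
  have hlw0 : 0 ≤ ∫ τ in a..c, ‖lap (ψ τ - f τ)‖ ^ 2 :=
    intervalIntegral.integral_nonneg hc.1 fun τ _ => by positivity
  have hηle : ∫ τ in a..c, η τ ≤ ∫ τ in a..b, η τ :=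
    intervalIntegral.integral_mono_interval le_rfl hc.1 hc.2 (Eventually.of_forall hη0) hηi
  have hη00 : 0 ≤ ∫ τ in a..c, η τ := intervalIntegral.integral_nonneg hc.1 fun τ _ => hη0 τ
  have hma : ‖ψ a - f a‖ ≤ m := hle a ⟨le_rfl, hab⟩
  have hm0 : 0 ≤ m := norm_nonneg _
  have hsq : m ^ 2 ≤ ‖ψ a - f a‖ ^ 2 + 2 * (m * ∫ τ in a..c, η τ) := by
    rw [hm]; linarith
  refine (hle b ⟨hab, le_rfl⟩).trans ?_
  rcases hm0.eq_or_lt with h | h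
  · rw [← h]
    have := norm_nonneg (ψ a - f a)
    linarith
  · have h5 : m * m ≤ m * (‖ψ a - f a‖ + 2 * ∫ τ in a..c, η τ) := by
      nlinarith [norm_nonneg (ψ a - f a)]
    have := le_of_mul_le_mul_left h5 h
    linarith

end

/-! ### Decay over one dissipation time, and iteration -/

section

/-- The integrand of `T₀` is at most its value at the left end point `B²`. -/
lemma T₀_mul_le {C B : ℝ} (hC : 0 < C) (hB : 0 < B) : T₀ C B * (C * (1 + B ^ 4)) ≤ 3 := by
  have hle : B ^ 2 ≤ 4 * B ^ 2 := by nlinarith [sq_nonneg B]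
  have hpos : ∀ y ∈ Icc (B ^ 2) (4 * B ^ 2), 0 < C * y + C * y ^ 3 := fun y hy => by
    have : 0 < y := lt_of_lt_of_le (by positivity) hy.1
    positivity
  have hc : ContinuousOn (fun y : ℝ => 1 / (C * y + C * y ^ 3)) (Icc (B ^ 2) (4 * B ^ 2)) :=
    ContinuousOn.div (by fun_prop) (by fun_prop) fun y hy => (hpos y hy).ne'
  have h1 := intervalIntegral.integral_mono_on hle (intervalIntegrable_of_continuousOn_Icc hle hc)
    (intervalIntegrable_const (μ := volume) (c := 1 / (C * B ^ 2 * (1 + B ^ 4)))) fun y hy => by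
      have h2 : B ^ 4 ≤ y ^ 2 := by
        have := pow_le_pow_left₀ (by positivity) hy.1 2
        calc B ^ 4 = (B ^ 2) ^ 2 := by ring
          _ ≤ y ^ 2 := this
      have h3 : C * B ^ 2 * (1 + B ^ 4) ≤ C * y * (1 + y ^ 2) := by
        have := hy.1
        have : 0 ≤ y := (sq_nonneg B).trans this
        gcongr
      refine one_div_le_one_div_of_le (by positivity) (h3.trans_eq (by ring))
  rw [intervalIntegral.integral_const, smul_eq_mul] at h1
  have h4 := mul_le_mul_of_nonneg_right h1 (by positivity : 0 ≤ C * (1 + B ^ 4))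
  refine h4.trans_eq ?_
  field_simp
  ring

/-- A bound that holds on `(a, r]` for every `a > t₀` persists in the limit `a → t₀`. -/
lemma le_of_forall_gt {h : ℝ → ℝ} {t₀ r X Y : ℝ} (htr : t₀ < r)
    (hc : ContinuousWithinAt h (Ioi t₀) t₀) (hle : ∀ a ∈ Ioo t₀ r, X ≤ h a + Y) : X ≤ h t₀ + Y := by
  refine ge_of_tendsto (hc.tendsto.add_const Y) ?_
  filter_upwards [Ioo_mem_nhdsGT htr] with a ha using hle a ha

variable {c C K T μ : ℝ} {v : ℝ → Torus L₁ L₂ → ℝ × ℝ} {ψ : ℝ → L2 L₁ L₂}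

/-- The size condition relating the elapsed time `τ` and the size `B` of the data that is extracted
from `τ ≤ min (T₀ C B) (T₁ C μ B)`; it is monotone in `B`. -/
structure ShortTime (C μ τ B : ℝ) : Prop where
  growth : τ * (C * (1 + B ^ 4)) ≤ 3
  mixing : τ * (4 * C * (2 * μ + 4 * C + 64 * C * B ^ 4) * B
    + 4 * C * √(2 * μ + 4 * C + 64 * C * B ^ 4)) ≤ 1
  rate : τ * (4 * μ) ≤ 1

lemma ShortTime.mono {τ B B' : ℝ} (h : ShortTime C μ τ B) (hC : 0 < C) (hμ : 0 < μ) (hτ : 0 ≤ τ)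
    (hB' : 0 ≤ B') (hle : B' ≤ B) : ShortTime C μ τ B' := by
  have hB : 0 ≤ B := hB'.trans hle
  refine ⟨le_trans ?_ h.growth, le_trans ?_ h.mixing, h.rate⟩ <;> gcongr

lemma ShortTime.of_le_min {τ B : ℝ} (hC : 0 < C) (hμ : 0 < μ) (hB : 0 < B)
    (h : τ ≤ min (min (T₀ C B) (T₁ C μ B)) (1 / (4 * μ))) : ShortTime C μ τ B := by
  have h1 : τ ≤ T₀ C B := h.trans ((min_le_left _ _).trans (min_le_left _ _))
  have h2 : τ ≤ T₁ C μ B := h.trans ((min_le_left _ _).trans (min_le_right _ _))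
  have h3 : τ ≤ 1 / (4 * μ) := h.trans (min_le_right _ _)
  refine ⟨(mul_le_mul_of_nonneg_right h1 (by positivity)).trans (T₀_mul_le hC hB), ?_,
    (le_div_iff₀ (by positivity)).mp h3⟩
  exact (le_div_iff₀ (by positivity)).mp h2

lemma IsMildSolution.continuousWithinAt (hψ : IsMildSolution v T ψ) {t₀ : ℝ} (ht₀ : 0 ≤ t₀)
    (h : t₀ < T) : ContinuousWithinAt ψ (Ioi t₀) t₀ := by
  refine (hψ.continuousOn t₀ ⟨ht₀, h.le⟩).mono_of_mem_nhdsWithin ?_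
  filter_upwards [Ioo_mem_nhdsGT h] with x hx using ⟨ht₀.trans hx.1.le, hx.2.le⟩

/-- The integrated growth term, as long as `‖ψ‖ ≤ 2 B`. -/
lemma IsMildSolution.integral_growth_le (hψ : IsMildSolution v T ψ) {a b τ B : ℝ}
    (ha : 0 ≤ a) (hab : a ≤ b) (hbT : b ≤ T) (hτ : b - a ≤ τ)
    (hle : ∀ r ∈ Ioo a b, ‖ψ r‖ ≤ 2 * B) :
    ∫ r in a..b, (‖ψ r‖ ^ 2 + ‖ψ r‖ ^ 6) ≤ τ * (4 * B ^ 2 + 64 * B ^ 6) := by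
  have hc : ContinuousOn ψ (Icc a b) := hψ.continuousOn.mono (Icc_subset_Icc ha hbT)
  have h1 := intervalIntegral.integral_mono_on_of_le_Ioo hab
    (intervalIntegrable_of_continuousOn_Icc hab ((hc.norm.pow 2).add (hc.norm.pow 6)))
    (intervalIntegrable_const (μ := volume) (c := 4 * B ^ 2 + 64 * B ^ 6)) fun r hr => by
      have h2 := pow_le_pow_left₀ (norm_nonneg _) (hle r hr) 2
      have h3 := pow_le_pow_left₀ (norm_nonneg _) (hle r hr) 6
      calc ‖ψ r‖ ^ 2 + ‖ψ r‖ ^ 6 ≤ (2 * B) ^ 2 + (2 * B) ^ 6 := add_le_add h2 h3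
        _ = 4 * B ^ 2 + 64 * B ^ 6 := by ring
  rw [intervalIntegral.integral_const, smul_eq_mul] at h1
  exact h1.trans (mul_le_mul_of_nonneg_right hτ (by positivity))

/-- Over a short time the norm at most doubles: at the first time at which `‖ψ‖ = 2 B` the energy
inequality would be violated. -/
lemma IsMildSolution.norm_le_two_mul (hN : NEstimates L₁ L₂ c) (hc : 0 < c) (hcC : 200 * c ≤ C)
    (hψ : IsMildSolution v T ψ) (hv : GoodVel K v) {t₀ τ B : ℝ} (hB : 0 < B)
    (hτB : ShortTime C μ τ B) (hτ : 0 < τ) (ht₀ : 0 ≤ t₀) (h0 : ‖ψ t₀‖ ≤ B) :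
    ∀ t, t₀ ≤ t → t ≤ t₀ + τ → t ≤ T → ‖ψ t‖ ≤ 2 * B := by
  intro t ht htτ htT
  by_contra! hcon
  have hcψ : ContinuousOn (fun r => ‖ψ r‖) (Icc t₀ t) :=
    (hψ.continuousOn.mono (Icc_subset_Icc ht₀ htT)).norm
  have hcl : IsCompact (Icc t₀ t ∩ (fun r => ‖ψ r‖) ⁻¹' Ici (2 * B)) :=
    isCompact_Icc.of_isClosed_subset
      (hcψ.preimage_isClosed_of_isClosed isClosed_Icc isClosed_Ici) inter_subset_left
  obtain ⟨r, ⟨hr, hr2⟩, hmin⟩ := hcl.exists_isLeast ⟨t, ⟨ht, le_rfl⟩, hcon.le⟩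
  have hr2' : 2 * B ≤ ‖ψ r‖ := hr2
  have htr : t₀ < r := lt_of_le_of_ne hr.1 fun h => by rw [← h] at hr2'; linarith
  have hlt : ∀ x ∈ Ico t₀ r, ‖ψ x‖ ≤ 2 * B := fun x hx => by
    by_contra! h
    exact absurd (hmin ⟨⟨hx.1, hx.2.le.trans hr.2⟩, h.le⟩) (not_le.mpr hx.2)
  have key : ∀ a ∈ Ioo t₀ r, 4 * B ^ 2
      ≤ ‖ψ a‖ ^ 2 + 2 * c * (τ * (4 * B ^ 2 + 64 * B ^ 6)) := by
    intro a ha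
    have h1 := hψ.energy_le hN hv (ht₀.trans_lt ha.1) ha.2.le (hr.2.trans htT)
    have h2 := hψ.integral_growth_le (B := B) (τ := τ) (ht₀.trans ha.1.le) ha.2.le
      (hr.2.trans htT) (by linarith [ha.1, hr.2]) fun x hx => hlt x ⟨ha.1.le.trans hx.1.le, hx.2⟩
    have h3 : 0 ≤ ∫ x in a..r, ‖lap (ψ x)‖ ^ 2 :=
      intervalIntegral.integral_nonneg ha.2.le fun x _ => by positivity
    have h4 := mul_le_mul_of_nonneg_left h2 (by positivity : 0 ≤ 2 * c)
    have h5 := pow_le_pow_left₀ (by positivity) hr2' 2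
    nlinarith
  have h1 := le_of_forall_gt (h := fun a => ‖ψ a‖ ^ 2) htr
    ((hψ.continuousWithinAt ht₀ (htr.trans_le (hr.2.trans htT))).norm.pow 2) key
  have h2 := pow_le_pow_left₀ (norm_nonneg _) h0 2
  have h3 : 3 * B ^ 2 ≤ 128 * c * (τ * (1 + B ^ 4)) * B ^ 2 := by
    have : 0 ≤ c * τ * B ^ 2 := by positivity
    nlinarith
  have h4 : 200 * c * (τ * (1 + B ^ 4)) ≤ 3 := by
    refine le_trans ?_ hτB.growth
    have := mul_le_mul_of_nonneg_right hcC (by positivity : 0 ≤ τ * (1 + B ^ 4))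
    linarith
  have h5 : 3 ≤ 128 * c * (τ * (1 + B ^ 4)) := le_of_mul_le_mul_right h3 (by positivity)
  linarith

/-- If the accumulated dissipation is large, the energy inequality alone gives the decay. -/
lemma IsMildSolution.norm_le_of_large_dissipation (hN : NEstimates L₁ L₂ c) (hc : 0 < c)
    (hcC : 200 * c ≤ C) (hψ : IsMildSolution v T ψ) (hv : GoodVel K v) {t₀ τ B a : ℝ} (hB : 0 < B)
    (hτB : ShortTime C μ τ B) (hτ : 0 < τ) (ht₀ : 0 ≤ t₀) (h0 : ‖ψ t₀‖ ≤ B)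
    (hT : t₀ + τ ≤ T) (ha : a ∈ Ioo t₀ (t₀ + τ))
    (hD : (2 * μ + 4 * C + 64 * C * B ^ 4) * B ^ 2 * τ
      ≤ ∫ r in a..(t₀ + τ), ‖lap (ψ r)‖ ^ 2) :
    ‖ψ (t₀ + τ)‖ ≤ Real.exp (-μ * τ) * B := by
  have hbd := hψ.norm_le_two_mul hN hc hcC hv hB hτB hτ ht₀ h0
  have key : ∀ a' ∈ Ioo t₀ a, ‖ψ (t₀ + τ)‖ ^ 2 + (2 * μ + 4 * C + 64 * C * B ^ 4) * B ^ 2 * τ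
      ≤ ‖ψ a'‖ ^ 2 + 2 * c * (τ * (4 * B ^ 2 + 64 * B ^ 6)) := by
    intro a' ha'
    have hle : a' ≤ t₀ + τ := ha'.2.le.trans ha.2.le
    have h1 := hψ.energy_le hN hv (ht₀.trans_lt ha'.1) hle hT
    have h2 := hψ.integral_growth_le (B := B) (τ := τ) (ht₀.trans ha'.1.le) hle hT
      (by linarith [ha'.1]) fun x hx =>
        hbd x (ha'.1.le.trans hx.1.le) hx.2.le (hx.2.le.trans hT)
    have h3 : ∫ r in a..(t₀ + τ), ‖lap (ψ r)‖ ^ 2 ≤ ∫ r in a'..(t₀ + τ), ‖lap (ψ r)‖ ^ 2 :=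
      intervalIntegral.integral_mono_interval ha'.2.le ha.2.le le_rfl
        (Eventually.of_forall fun r => by positivity)
        (hψ.regularity hN hv (ht₀.trans_lt ha'.1) hle hT).2.2.1
    have h4 := mul_le_mul_of_nonneg_left h2 (by positivity : 0 ≤ 2 * c)
    linarith
  have h1 := le_of_forall_gt (h := fun a => ‖ψ a‖ ^ 2) ha.1
    ((hψ.continuousWithinAt ht₀ (ha.1.trans (ha.2.trans_le hT))).norm.pow 2) key
  have h2 := pow_le_pow_left₀ (norm_nonneg _) h0 2
  have h3 : ‖ψ (t₀ + τ)‖ ^ 2 ≤ B ^ 2 * (1 + -(2 * μ * τ)) := by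
    have h4 : 200 * c * (τ * B ^ 2) ≤ C * (τ * B ^ 2) :=
      mul_le_mul_of_nonneg_right hcC (by positivity)
    have h5 : 200 * c * (τ * B ^ 6) ≤ C * (τ * B ^ 6) :=
      mul_le_mul_of_nonneg_right hcC (by positivity)
    have h6 : 0 ≤ c * (τ * B ^ 2) := by positivity
    have h7 : 0 ≤ c * (τ * B ^ 6) := by positivity
    nlinarith
  refine le_of_sq_le_sq (h3.trans ?_) (by positivity)
  rw [mul_pow, ← Real.exp_nat_mul, mul_comm]
  refine mul_le_mul_of_nonneg_right ?_ (by positivity)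
  have := Real.add_one_le_exp (-(2 * μ * τ))
  have e : ((2 : ℕ) : ℝ) * (-μ * τ) = -(2 * μ * τ) := by push_cast; ring
  rw [e]
  linarith

/-- If the accumulated dissipation is small, the solution shadows the linear evolution, which
halves the norm over a dissipation time. -/
lemma IsMildSolution.norm_le_of_small_dissipation (hN : NEstimates L₁ L₂ c) (hc : 0 < c)
    (hcC : 200 * c ≤ C) (hμ : 0 < μ)
    (hψ : IsMildSolution v T ψ) (hv : GoodVel K v) {t₀ τ B : ℝ} (hB : 0 < B)
    (hτB : ShortTime C μ τ B) (hτ : 0 < τ) (ht₀ : 0 ≤ t₀) (h0 : ‖ψ t₀‖ ≤ B)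
    (hT : t₀ + τ ≤ T) {f : ℝ → L2 L₁ L₂} (hf : IsLinearSolution v t₀ (ψ t₀) f)
    (hhalf : ‖f (t₀ + τ)‖ ≤ 1 / 2 * ‖ψ t₀‖)
    (hD : ∀ a ∈ Ioo t₀ (t₀ + τ), ∫ r in a..(t₀ + τ), ‖lap (ψ r)‖ ^ 2
      ≤ (2 * μ + 4 * C + 64 * C * B ^ 4) * B ^ 2 * τ) :
    ‖ψ (t₀ + τ)‖ ≤ Real.exp (-μ * τ) * B := by
  set A := 2 * μ + 4 * C + 64 * C * B ^ 4 with hA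
  have hC : 0 < C := by linarith
  have hA0 : 0 < A := by positivity
  have hsA : 0 < √A := Real.sqrt_pos.mpr hA0
  have hsq : √A ^ 2 = A := Real.sq_sqrt hA0.le
  have htt : t₀ < t₀ + τ := by linarith
  have key : ∀ a ∈ Ioo t₀ (t₀ + τ), ‖ψ (t₀ + τ) - f (t₀ + τ)‖
      ≤ ‖ψ a - f a‖ + 2 * c * (τ * (A * B ^ 2 + √A * B)) := by
    intro a ha
    have h1 := hψ.norm_sub_le hN hc.le hv hf ht₀ ha.1 ha.2.le hT
    have hlap := (hψ.regularity hN hv (ht₀.trans_lt ha.1) ha.2.le hT).2.2.1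
    have hlap1 := intervalIntegrable_norm_lap hlap
    -- Young's inequality, with the weight `√A B` that balances the two terms.
    have h2 : ∫ r in a..(t₀ + τ), ‖lap (ψ r)‖
        ≤ ∫ r in a..(t₀ + τ), (√A * B / 2 + ‖lap (ψ r)‖ ^ 2 * (2 * (√A * B))⁻¹) := by
      refine intervalIntegral.integral_mono_on ha.2.le hlap1
        (intervalIntegrable_const.add (hlap.mul_const _)) fun r _ => ?_
      have hδ : 0 < √A * B := by positivity
      have h3 : √A * B / 2 + ‖lap (ψ r)‖ ^ 2 * (2 * (√A * B))⁻¹ - ‖lap (ψ r)‖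
          = (√A * B - ‖lap (ψ r)‖) ^ 2 * (2 * (√A * B))⁻¹ := by
        field_simp
        ring
      have h4 : 0 ≤ (√A * B - ‖lap (ψ r)‖) ^ 2 * (2 * (√A * B))⁻¹ := by positivity
      linarith
    rw [intervalIntegral.integral_add intervalIntegrable_const (hlap.mul_const _),
      intervalIntegral.integral_const, intervalIntegral.integral_mul_const, smul_eq_mul] at h2
    have h5 := mul_le_mul_of_nonneg_right (hD a ha) (by positivity : 0 ≤ (2 * (√A * B))⁻¹)
    have h6 : A * B ^ 2 * τ * (2 * (√A * B))⁻¹ = √A * B * τ / 2 := by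
      have h6' : A * B ^ 2 * τ * (2 * (√A * B))⁻¹ = √A ^ 2 * B ^ 2 * τ * (2 * (√A * B))⁻¹ := by
        rw [hsq]
      rw [h6']
      field_simp
    have h7 : (t₀ + τ - a) * (√A * B / 2) ≤ τ * (√A * B / 2) :=
      mul_le_mul_of_nonneg_right (by linarith [ha.1]) (by positivity)
    have h8 : ∫ r in a..(t₀ + τ), ‖lap (ψ r)‖ ≤ τ * (√A * B) := by linarith
    rw [intervalIntegral.integral_add (hlap.const_mul c) (hlap1.const_mul c),
      intervalIntegral.integral_const_mul, intervalIntegral.integral_const_mul] at h1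
    have h9 := mul_le_mul_of_nonneg_left (hD a ha) hc.le
    have h10 := mul_le_mul_of_nonneg_left h8 hc.le
    linarith
  have hcf : ContinuousWithinAt f (Ioi t₀) t₀ :=
    (hf.continuousOn t₀ self_mem_Ici).mono Ioi_subset_Ici_self
  have h1 := le_of_forall_gt (h := fun a => ‖ψ a - f a‖) htt
    ((hψ.continuousWithinAt ht₀ (htt.trans_le hT)).sub hcf).norm key
  simp only [(hf.hasModes le_rfl).1, sub_self, norm_zero, zero_add] at h1
  have h2 : 2 * c * (τ * (A * B ^ 2 + √A * B)) ≤ B / 4 := by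
    have h3 := mul_le_mul_of_nonneg_right hτB.mixing hB.le
    have h4 := mul_le_mul_of_nonneg_right hcC
      (by positivity : 0 ≤ τ * (A * B ^ 2 + √A * B))
    have h5 : 0 ≤ c * (τ * (A * B ^ 2 + √A * B)) := by positivity
    have h6 : τ * (4 * C * A * B + 4 * C * √A) * B = 4 * (C * (τ * (A * B ^ 2 + √A * B))) := by
      ring
    rw [h6] at h3
    linarith
  have h3 : ‖ψ (t₀ + τ)‖ ≤ ‖ψ (t₀ + τ) - f (t₀ + τ)‖ + ‖f (t₀ + τ)‖ := by
    simpa using norm_add_le (ψ (t₀ + τ) - f (t₀ + τ)) (f (t₀ + τ))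
  have h4 : 3 / 4 ≤ Real.exp (-μ * τ) := by
    have := Real.add_one_le_exp (-μ * τ)
    have := hτB.rate
    linarith
  have h5 := mul_le_mul_of_nonneg_right h4 hB.le
  linarith

/-- Decay by the factor `exp (-μ τ)` over one dissipation time `τ`. -/
lemma IsMildSolution.norm_le_of_dissipationTime (hN : NEstimates L₁ L₂ c) (hc : 0 < c)
    (hcC : 200 * c ≤ C) (hμ : 0 < μ) (hψ : IsMildSolution v T ψ) (hv : UniformlyLipschitz v)
    (hd : DivergenceFree v) {t₀ B : ℝ} (hB : 0 < B)
    (hτB : ShortTime C μ (dissipationTime v) B) (hτ : 0 < dissipationTime v) (ht₀ : 0 ≤ t₀)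
    (h0 : ‖ψ t₀‖ ≤ B) (hT : t₀ + dissipationTime v ≤ T) :
    ‖ψ (t₀ + dissipationTime v)‖ ≤ Real.exp (-μ * dissipationTime v) * B := by
  obtain ⟨K, -, hK⟩ := hv.exists_goodVel hd
  by_cases hD : ∃ a ∈ Ioo t₀ (t₀ + dissipationTime v),
      (2 * μ + 4 * C + 64 * C * B ^ 4) * B ^ 2 * dissipationTime v
        ≤ ∫ r in a..(t₀ + dissipationTime v), ‖lap (ψ r)‖ ^ 2
  · obtain ⟨a, ha, hD⟩ := hD
    exact hψ.norm_le_of_large_dissipation hN hc hcC hK hB hτB hτ ht₀ h0 hT ha hD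
  · push Not at hD
    obtain ⟨f, hf, hhalf⟩ := exists_isLinearSolution_half hv hd ht₀
      (hψ.meanFree t₀ ⟨ht₀, by linarith⟩)
    exact hψ.norm_le_of_small_dissipation hN hc hcC hμ hK hB hτB hτ ht₀ h0 hT hf hhalf
      fun a ha => (hD a ha).le

lemma NEstimates.mono {C C' : ℝ} (hN : NEstimates L₁ L₂ C) (h : C ≤ C') :
    NEstimates L₁ L₂ C' := by
  intro ψ h0 h2
  obtain ⟨h3, h4, h5⟩ := hN ψ h0 h2
  exact ⟨h3, h4.trans (by gcongr), h5.trans (by gcongr)⟩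

end

end AdvKS

end

open AdvKS in
theorem theorem2p10 (L₁ L₂ : ℝ) [Fact (0 < L₁)] [Fact (0 < L₂)] :
    ∃ C : ℝ, 0 < C ∧ NEstimates L₁ L₂ C ∧
      ∀ (v : ℝ → Torus L₁ L₂ → ℝ × ℝ), UniformlyLipschitz v → DivergenceFree v →
      ∀ (μ T : ℝ) (ψ : ℝ → L2 L₁ L₂), 0 < μ → IsMildSolution v T ψ →
      ∀ (t₀ B : ℝ), 0 ≤ t₀ → t₀ ≤ T → ‖ψ t₀‖ = B → 0 < B →
      dissipationTime v ≤ min (min (T₀ C B) (T₁ C μ B)) (1 / (4 * μ)) →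
      ∀ t : ℝ, 0 < t → t₀ + t ≤ T →
        ‖ψ (t₀ + t)‖ ≤ 2 * Real.exp (1 / 4) * Real.exp (-μ * t) * ‖ψ t₀‖ := by
  have hc : 0 < nConst L₁ L₂ := nConst_pos
  have hN : NEstimates L₁ L₂ (nConst L₁ L₂) := nEstimates_nConst
  -- The constant in the thresholds is taken larger than the one in the estimates of `N`, so that
  -- crude bounds suffice for the energy argument.
  refine ⟨200 * nConst L₁ L₂, by positivity, hN.mono (by linarith), ?_⟩
  intro v hv hd μ T ψ hμ hψ t₀ B ht₀ ht₀T hψB hB hle t ht htT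
  obtain ⟨K, -, hK⟩ := hv.exists_goodVel hd
  have hshort := ShortTime.of_le_min (by positivity) hμ hB hle
  have hτ : 0 < dissipationTime v := dissipationTime_pos hv hd
    (hψ.meanFree t₀ ⟨ht₀, ht₀T⟩) (by rw [← norm_pos_iff, hψB]; exact hB)
  set τ := dissipationTime v with hτdef
  have hshort' : ∀ n : ℕ, 0 < Real.exp (-μ * (n * τ)) * B ∧
      ShortTime (200 * nConst L₁ L₂) μ τ (Real.exp (-μ * (n * τ)) * B) := fun n => by
    have h1 : 0 < Real.exp (-μ * (n * τ)) * B := by positivity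
    refine ⟨h1, hshort.mono (by positivity) hμ hτ.le h1.le ?_⟩
    refine mul_le_of_le_one_left hB.le (Real.exp_le_one_iff.mpr ?_)
    have : 0 ≤ μ * (n * τ) := by positivity
    linarith
  have hiter : ∀ n : ℕ, t₀ + n * τ ≤ T → ‖ψ (t₀ + n * τ)‖ ≤ Real.exp (-μ * (n * τ)) * B := by
    intro n
    induction n with
    | zero => intro _; simp [hψB]
    | succ n ih =>
      intro hn
      have e : t₀ + ((n + 1 : ℕ) : ℝ) * τ = t₀ + n * τ + τ := by push_cast; ring
      rw [e] at hn ⊢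
      have h1 := hψ.norm_le_of_dissipationTime hN hc le_rfl hμ hv hd (hshort' n).1 (hshort' n).2
        hτ (by positivity) (ih (by linarith)) hn
      refine h1.trans_eq ?_
      rw [← mul_assoc, ← Real.exp_add]
      congr 2
      push_cast
      ring
  set n := ⌊t / τ⌋₊ with hn
  have hn1 : n * τ ≤ t := (le_div_iff₀ hτ).mp (Nat.floor_le (by positivity))
  have hn2 : t ≤ n * τ + τ := by
    have := (div_lt_iff₀ hτ).mp (Nat.lt_floor_add_one (t / τ))
    rw [← hn] at this
    linarith
  have h1 := hψ.norm_le_two_mul hN hc le_rfl hK (hshort' n).1 (hshort' n).2 hτ (by positivity)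
    (hiter n (by linarith)) (t₀ + t) (by linarith) (by linarith) htT
  have h2 : Real.exp (-μ * (n * τ)) ≤ Real.exp (1 / 4) * Real.exp (-μ * t) := by
    rw [← Real.exp_add, Real.exp_le_exp]
    have := mul_le_mul_of_nonneg_left hn2 hμ.le
    have := hshort.rate
    linarith
  rw [hψB]
  have h3 := mul_le_mul_of_nonneg_right h2 hB.le
  linarith
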